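/- Let $\Omega\subset\mathbb C$ be a bounded domain whose boundary $b\Omega$ consists of finitely many non-intersecting $C^\infty$ smooth simple closed curves, and let $\phi$ be a positive $C^\infty$ function on $b\Omega$. Let $L^2_\phi(b\Omega)$ be the space of complex functions on $b\Omega$ with inner product $\langle u,v\rangle_\phi=\int_{b\Omega}u\,\bar v\,\phi\,ds$, where $ds$ is arc length, and let $H^2(b\Omega)$ be the closure in $L^2_\phi(b\Omega)$ of the space $A^\infty(\Omega)$ of functions holomorphic on $\Omega$ and $C^\infty$ smooth on $\overline\Omega$. For every $w\in\Omega$ there is a unique $\sigma(\cdot,w)\in H^2(b\Omega)$ such that $h(w)=\langle h,\sigma(\cdot,w)\rangle_\phi$ for all $h\in A^\infty(\Omega)$; the weighted Szegő kernel is $\sigma(z,w)=\langle\sigma(\cdot,w),\sigma(\cdot,z)\rangle_\phi$ for $z,w\in\Omega$ (the value at $z$ of the holomorphic function on $\Omega$ with boundary values $\sigma(\cdot,w)$). Write $\sigma_{\bar n}(z,w)=\dfrac{\partial^n}{\partial\bar w^n}\sigma(z,w)$. Let $f$ be a proper holomorphic mapping of $\Omega$ onto the unit disc, with distinct zeros $a_1,\dots,a_N$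 of multiplicities $M(1),\dots,M(N)$, respectively. Then there are constants $c_{ijnm}\in\mathbb C$ such that for all $z,w\in\Omega$ $$\sigma(z,w)=\frac{1}{1-f(z)\overline{f(w)}}\left(\sum_{i,j=1}^{N}\ \sum_{n=0}^{M(i)-1}\ \sum_{m=0}^{M(j)-1}c_{ijnm}\,\sigma_{\bar n}(z,a_i)\,\overline{\sigma_{\bar m}(w,a_j)}\right).$$ -/

import Mathlib

open scoped ContDiff

/-- `Ω` is a bounded domain in the plane whose boundary consists of the finitely many
non-intersecting `C^∞` smooth simple closed curves `γ 0, …, γ (n-1)`.  Each curve is given by a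
regular parametrization of period `1`, in the standard sense: `Ω` lies to its left. -/
structure IsSmoothlyBoundedBy (Ω : Set ℂ) {n : ℕ} (γ : Fin n → ℝ → ℂ) : Prop where
  isOpen : IsOpen Ω
  isConnected : IsConnected Ω
  isBounded : Bornology.IsBounded Ω
  contDiff : ∀ j, ContDiff ℝ ∞ (γ j)
  periodic : ∀ j, Function.Periodic (γ j) 1
  deriv_ne_zero : ∀ j t, deriv (γ j) t ≠ 0
  /-- every curve is simple, and two different curves do not meet -/
  injective : ∀ i j, ∀ s ∈ Set.Ico (0 : ℝ) 1, ∀ t ∈ Set.Ico (0 : ℝ) 1,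
    γ i s = γ j t → i = j ∧ s = t
  frontier_eq : frontier Ω = ⋃ j, Set.range (γ j)
  /-- `Ω` lies on the left, and only on the left, of each boundary curve -/
  left_side : ∀ j t, ∀ᶠ ε : ℝ in nhdsWithin 0 (Set.Ioi 0),
    γ j t + ε * (Complex.I * deriv (γ j) t) ∈ Ω ∧ γ j t - ε * (Complex.I * deriv (γ j) t) ∉ Ω

/-- The measure `φ ds` carried by the curves `γ j`, where `ds` is arc length. -/
noncomputable def weightedArcLength {n : ℕ} (γ : Fin n → ℝ → ℂ) (φ : ℂ → ℝ) :
    MeasureTheory.Measure ℂ :=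
  ∑ j, MeasureTheory.Measure.map (γ j)
    ((MeasureTheory.volume.restrict (Set.Ico (0 : ℝ) 1)).withDensity
      fun t => ENNReal.ofReal (φ (γ j t) * ‖deriv (γ j) t‖))

/-- The space `L²_φ(bΩ)`, with inner product `⟨u, v⟩_φ = ∫ u v̄ φ ds`, which Mathlib writes
`inner ℂ v u` (conjugate linear in the first slot). -/
abbrev WeightedL2 {n : ℕ} (γ : Fin n → ℝ → ℂ) (φ : ℂ → ℝ) : Type :=
  MeasureTheory.Lp ℂ 2 (weightedArcLength γ φ)

/-- `h` belongs to `A^∞(Ω)`: it is holomorphic on `Ω` and `C^∞` smooth on the closure of `Ω`. -/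
def IsAInfty (Ω : Set ℂ) (h : ℂ → ℂ) : Prop :=
  DifferentiableOn ℂ h Ω ∧ ContDiffOn ℝ ∞ h (closure Ω)

/-- The elements of `L²_φ(bΩ)` that are boundary values of functions in `A^∞(Ω)`. -/
noncomputable def aInftyBoundaryValues (Ω : Set ℂ) {n : ℕ} (γ : Fin n → ℝ → ℂ) (φ : ℂ → ℝ) :
    Submodule ℂ (WeightedL2 γ φ) where
  carrier := {u | ∃ h : ℂ → ℂ, IsAInfty Ω h ∧ ⇑u =ᵐ[weightedArcLength γ φ] h}
  add_mem' := by
    rintro u v ⟨h, hh, hu⟩ ⟨k, hk, hv⟩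
    refine ⟨h + k, ⟨hh.1.add hk.1, hh.2.add hk.2⟩, ?_⟩
    exact (MeasureTheory.Lp.coeFn_add u v).trans (hu.add hv)
  zero_mem' :=
    ⟨0, ⟨differentiableOn_const 0, contDiffOn_const⟩, MeasureTheory.Lp.coeFn_zero _ _ _⟩
  smul_mem' := by
    rintro c u ⟨h, hh, hu⟩
    refine ⟨c • h, ⟨hh.1.const_smul c, hh.2.const_smul c⟩, ?_⟩
    exact (MeasureTheory.Lp.coeFn_smul c u).trans (hu.const_smul c)

/-- The Hardy space `H²(bΩ)`, as a closed subspace of `L²_φ(bΩ)`: the closure of `A^∞(Ω)`. -/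
noncomputable def hardySpace (Ω : Set ℂ) {n : ℕ} (γ : Fin n → ℝ → ℂ) (φ : ℂ → ℝ) :
    Submodule ℂ (WeightedL2 γ φ) :=
  (aInftyBoundaryValues Ω γ φ).topologicalClosure

/-- `k` is an element of the Hardy space that reproduces the value at `a`:
`h(a) = ⟨h, k⟩_φ` for `h` in `A^∞(Ω)`, hence (by density) for all of the Hardy space.
There is at most one such `k`. -/
def IsReproducingAt (Ω : Set ℂ) {n : ℕ} (γ : Fin n → ℝ → ℂ) (φ : ℂ → ℝ) (a : ℂ)
    (k : WeightedL2 γ φ) : Prop :=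
  k ∈ hardySpace Ω γ φ ∧
    ∀ (h : ℂ → ℂ) (u : WeightedL2 γ φ), IsAInfty Ω h → ⇑u =ᵐ[weightedArcLength γ φ] h →
      inner ℂ k u = h a

open Classical in
/-- The element `σ(·, a)` of the Hardy space: the one that reproduces the value at `a`
(and `0` if there were none). -/
noncomputable def szegoElement (Ω : Set ℂ) {n : ℕ} (γ : Fin n → ℝ → ℂ) (φ : ℂ → ℝ) (a : ℂ) :
    WeightedL2 γ φ :=
  if h : ∃ k, IsReproducingAt Ω γ φ a k then h.choose else 0

/-- The weighted Szegő kernel `σ(z, w)` on `Ω × Ω`: the value at `z` of the holomorphic function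
with boundary values `σ(·, w)`, that is, `⟨σ(·, w), σ(·, z)⟩_φ`. -/
noncomputable def szegoKernel (Ω : Set ℂ) {n : ℕ} (γ : Fin n → ℝ → ℂ) (φ : ℂ → ℝ) (z w : ℂ) : ℂ :=
  inner ℂ (szegoElement Ω γ φ z) (szegoElement Ω γ φ w)

/-- The Wirtinger derivative `∂g/∂w̄ = (∂g/∂x + i ∂g/∂y) / 2`. -/
noncomputable def dbar (g : ℂ → ℂ) (w : ℂ) : ℂ :=
  (fderiv ℝ g w 1 + Complex.I * fderiv ℝ g w Complex.I) / 2

/-- The function `σ_{n̄}(z, w) = (∂ⁿ/∂w̄ⁿ) σ(z, w)`. -/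
noncomputable def szegoKernelDbar (Ω : Set ℂ) {n : ℕ} (γ : Fin n → ℝ → ℂ) (φ : ℂ → ℝ) (k : ℕ)
    (z w : ℂ) : ℂ :=
  (dbar^[k] fun ζ => szegoKernel Ω γ φ z ζ) w

/-!
Write `σ_w = σ(·, w)` and, for `u` in the Hardy space, `û(z) = ⟨u, σ_z⟩` for its holomorphic
extension. Derivatives `û^{(n)}(a)` are continuous in `u`, hence represented by vectors, and the
extension of the vector for `û^{(n)}(a)` is `σ_{n̄}(·, a)`. Let `Q` be the span of those with `a =
a_i` and `n < M(i)`; its orthogonal complement consists of the `u` whose extension is divisible by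
`f`. If multiplication by `f` is an isometry of the Hardy space onto that complement, then `σ(z,
w) - f(z) f̄(w) σ(z, w)` is the reproducing kernel of `Q`, that is, a combination of the products
`σ_{n̄}(z, a_i) σ̄_{m̄}(w, a_j)`.

Boundary values of `f` are not needed for this. It is enough that multiplication by `f` is a
contraction (`IsSmoothlyBoundedBy.exists_inner_eq_mul`), because `|f| < 1`, and that division by
`f` is a contraction on the complement of `Q` (`IsSmoothlyBoundedBy.exists_mul_inner_eq`), because
`f` is proper, so that `|f|` tends to `1` at the boundary. From these two inequalities
`eq_smul_of_contraction` shows that dividing the projection of `σ_w` to the complement of `Q` by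
`f` gives exactly `f̄(w) σ_w`, which is the assertion.

Both contractions rest on an approximation theorem (`IsSmoothlyBoundedBy.exists_approx`): a
bounded holomorphic function `g` which is dominated near the boundary by `|h|`, with `h`
continuous on the closure, is a pointwise limit of functions in `A^∞(Ω)` which are asymptotically
dominated by `|h|` on the boundary. A weak limit of their boundary values represents `g` and has
norm at most `‖h‖`. The approximants are `g(z + ε V(z))`, with a smooth vector field `V` pointing
into the domain (`IsSmoothlyBoundedBy.exists_inward_field`), made holomorphic by subtracting a
Cauchy transform (`exists_dbar_eq`, `exists_cauchyTransform_bound`).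

Point evaluations on `A^∞(Ω)` are bounded in `L²_φ(bΩ)` by a Stokes inequality
(`IsSmoothlyBoundedBy.norm_setIntegral_mul_dbar_le`), `|∬ h ∂ψ/∂z̄| ≤ ∮ |h ψ| ds` for `h`
holomorphic on `Ω` and continuous on its closure. It is obtained locally from the divergence
theorem in a chart along the boundary, and globally by a partition of unity. Applied to a `ψ` that
equals `1 / (z - w)` on the boundary, it bounds `h(w)` by the Cauchy–Pompeiu formula.
-/

section

open MeasureTheory Set Filter Topology

/-! ### The operator `∂/∂z̄` -/

theorem DifferentiableAt.dbar_eq_zero {g : ℂ → ℂ} {z : ℂ} (hg : DifferentiableAt ℂ g z) :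
    dbar g z = 0 := by
  have h := (differentiableAt_complex_iff_differentiableAt_real.1 hg).2
  rw [dbar, h, smul_eq_mul, ← mul_assoc, Complex.I_mul_I]
  ring

theorem differentiableAt_of_dbar_eq_zero {g : ℂ → ℂ} {z : ℂ} (hg : DifferentiableAt ℝ g z)
    (h : dbar g z = 0) : DifferentiableAt ℂ g z := by
  refine differentiableAt_complex_iff_differentiableAt_real.2 ⟨hg, ?_⟩
  have h1 : fderiv ℝ g z 1 + Complex.I * fderiv ℝ g z Complex.I = 0 := by
    simpa [dbar] using h
  have h2 := congrArg (fun x => Complex.I * x) h1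
  simp only [mul_add, ← mul_assoc, Complex.I_mul_I, mul_zero] at h2
  rw [smul_eq_mul]
  linear_combination -h2

theorem Filter.EventuallyEq.dbar_eq {g k : ℂ → ℂ} {z : ℂ} (h : g =ᶠ[𝓝 z] k) :
    dbar g z = dbar k z := by
  rw [dbar, dbar, h.fderiv_eq]

theorem dbar_mul {g k : ℂ → ℂ} {z : ℂ} (hg : DifferentiableAt ℝ g z)
    (hk : DifferentiableAt ℝ k z) :
    dbar (fun ζ => g ζ * k ζ) z = g z * dbar k z + k z * dbar g z := by
  simp only [dbar, fderiv_fun_mul hg hk, add_apply,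
    smul_apply, smul_eq_mul]
  ring

theorem dbar_sub {g k : ℂ → ℂ} {z : ℂ} (hg : DifferentiableAt ℝ g z)
    (hk : DifferentiableAt ℝ k z) :
    dbar (fun ζ => g ζ - k ζ) z = dbar g z - dbar k z := by
  simp only [dbar, fderiv_fun_sub hg hk, sub_apply]
  ring

/-- Chain rule for a holomorphic outer function. -/
theorem dbar_comp {g Ψ : ℂ → ℂ} {z : ℂ} (hg : DifferentiableAt ℂ g (Ψ z))
    (hΨ : DifferentiableAt ℝ Ψ z) :
    dbar (fun ζ => g (Ψ ζ)) z = deriv g (Ψ z) * dbar Ψ z := by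
  have h1 : fderiv ℝ g (Ψ z) = (fderiv ℂ g (Ψ z)).restrictScalars ℝ :=
    hg.fderiv_restrictScalars ℝ
  have h2 : fderiv ℝ (fun ζ => g (Ψ ζ)) z = (fderiv ℝ g (Ψ z)).comp (fderiv ℝ Ψ z) :=
    fderiv_comp z (hg.restrictScalars ℝ) hΨ
  have h3 : ∀ v : ℂ, fderiv ℂ g (Ψ z) v = v * deriv g (Ψ z) := fun v => by
    rw [fderiv_eq_smul_deriv, smul_eq_mul]
  simp only [dbar, h2, h1, ContinuousLinearMap.comp_apply,
    ContinuousLinearMap.coe_restrictScalars', h3]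
  ring

theorem dbar_conj {g : ℂ → ℂ} {z : ℂ} (hg : DifferentiableAt ℂ g z) :
    dbar (fun ζ => (starRingEnd ℂ) (g ζ)) z = (starRingEnd ℂ) (deriv g z) := by
  have h1 : fderiv ℝ g z = (fderiv ℂ g z).restrictScalars ℝ := hg.fderiv_restrictScalars ℝ
  have h2 : fderiv ℝ (fun ζ => (starRingEnd ℂ) (g ζ)) z =
      (Complex.conjCLE : ℂ →L[ℝ] ℂ).comp (fderiv ℝ g z) :=
    ((Complex.conjCLE : ℂ →L[ℝ] ℂ).hasFDerivAt.comp z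
      (hg.restrictScalars ℝ).hasFDerivAt).fderiv
  have h3 : ∀ v : ℂ, fderiv ℂ g z v = v * deriv g z := fun v => by
    rw [fderiv_eq_smul_deriv, smul_eq_mul]
  simp only [dbar, h2, h1, ContinuousLinearMap.comp_apply,
    ContinuousLinearMap.coe_restrictScalars', h3]
  simp only [ContinuousLinearEquiv.coe_coe, Complex.conjCLE_apply, map_mul, Complex.conj_I,
    map_one]
  linear_combination (-(starRingEnd ℂ) (deriv g z) / 2) * Complex.I_mul_I

theorem ContDiff.dbar {g : ℂ → ℂ} (hg : ContDiff ℝ ∞ g) : ContDiff ℝ ∞ (dbar g) := by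
  have h : ContDiff ℝ ∞ (fderiv ℝ g) := hg.fderiv_right (by simp)
  unfold _root_.dbar
  exact ((h.clm_apply contDiff_const).add
    (contDiff_const.mul (h.clm_apply contDiff_const))).div_const 2

theorem tsupport_dbar_subset (g : ℂ → ℂ) : tsupport (dbar g) ⊆ tsupport g := by
  refine closure_minimal (fun z hz => ?_) (isClosed_tsupport g)
  by_contra h
  have : g =ᶠ[𝓝 z] fun _ => 0 := notMem_tsupport_iff_eventuallyEq.1 h
  apply hz
  rw [this.dbar_eq]
  simp [dbar]

/-! ### The Cauchy–Pompeiu formula and the Cauchy transform -/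

/-- The point of the plane with (unrestricted) polar coordinates `p = (r, θ)`. -/
noncomputable def polarPoint (p : ℝ × ℝ) : ℂ := p.1 * Complex.exp (p.2 * Complex.I)

theorem polarPoint_eq (p : ℝ × ℝ) : Complex.polarCoord.symm p = polarPoint p := by
  rw [Complex.polarCoord_symm_apply, polarPoint, Complex.exp_mul_I, Complex.ofReal_cos,
    Complex.ofReal_sin]

theorem norm_polarPoint (p : ℝ × ℝ) : ‖polarPoint p‖ = |p.1| := by
  simp [polarPoint, Complex.norm_exp_ofReal_mul_I]

theorem continuous_polarPoint : Continuous polarPoint := by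
  unfold polarPoint
  fun_prop

/-- A function of polar coordinates which is continuous and vanishes for large `r` is integrable
over the domain of polar coordinates. -/
theorem integrableOn_polarCoord_target {F : ℝ × ℝ → ℂ} (hF : Continuous F) {R : ℝ}
    (hR : ∀ p, R < |p.1| → F p = 0) :
    IntegrableOn F (Ioi 0 ×ˢ Ioo (-Real.pi) Real.pi) := by
  have h1 : IntegrableOn F (Icc 0 R ×ˢ Icc (-Real.pi) Real.pi) :=
    hF.continuousOn.integrableOn_compact (isCompact_Icc.prod isCompact_Icc)
  refine h1.of_forall_sdiff_eq_zero (measurableSet_Ioi.prod measurableSet_Ioo) ?_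
  rintro ⟨r, θ⟩ ⟨⟨hr, hθ⟩, h2⟩
  apply hR
  by_contra h3
  simp only [mem_Ioi] at hr
  rw [abs_of_pos hr, not_lt] at h3
  exact h2 ⟨⟨hr.le, h3⟩, Ioo_subset_Icc_self hθ⟩

theorem polarPoint_hasDerivAt_fst (r θ : ℝ) :
    HasDerivAt (fun r : ℝ => polarPoint (r, θ)) (Complex.exp (θ * Complex.I)) r := by
  simpa [polarPoint] using
    ((hasDerivAt_id r).ofReal_comp.mul_const (Complex.exp (θ * Complex.I)))

theorem polarPoint_hasDerivAt_snd (r θ : ℝ) :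
    HasDerivAt (fun θ : ℝ => polarPoint (r, θ))
      (r * (Complex.I * Complex.exp (θ * Complex.I))) θ := by
  have h1 : HasDerivAt (fun θ : ℝ => (θ : ℂ) * Complex.I) Complex.I θ := by
    simpa using (hasDerivAt_id θ).ofReal_comp.mul_const Complex.I
  have h2 := (h1.cexp).const_mul (r : ℂ)
  refine h2.congr_deriv ?_
  ring

/-- The Cauchy–Pompeiu formula for a compactly supported function.  In polar coordinates
`r (∂F/∂z̄) / z` is half of `∂F/∂r + (i/r) ∂F/∂θ`; the second term integrates to `0` over
circles, the first one to `-F 0` over rays. -/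
theorem integral_dbar_div {F : ℂ → ℂ} (hF : ContDiff ℝ 1 F) (hc : HasCompactSupport F) :
    ∫ ζ, dbar F ζ / ζ = -Real.pi * F 0 := by
  obtain ⟨R, hR⟩ := hc.isCompact.isBounded.subset_closedBall (0 : ℂ)
  have hR0 : ∀ z : ℂ, R < ‖z‖ → fderiv ℝ F z = 0 := fun z hz => by
    by_contra h
    have := hR (support_fderiv_subset ℝ h)
    simp only [Metric.mem_closedBall, dist_zero_right] at this
    linarith
  have hd : Differentiable ℝ F := hF.differentiable (by simp)
  have hcont : Continuous (fderiv ℝ F) := hF.continuous_fderiv (by simp)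
  -- `A` is the radial derivative `∂F/∂r`, and `B` the angular derivative `(1/r) ∂F/∂θ`
  let A : ℝ × ℝ → ℂ := fun p => fderiv ℝ F (polarPoint p) (Complex.exp (p.2 * Complex.I))
  let B : ℝ × ℝ → ℂ := fun p =>
    fderiv ℝ F (polarPoint p) (Complex.I * Complex.exp (p.2 * Complex.I))
  have hA : Continuous A := by
    have := continuous_polarPoint
    fun_prop
  have hB : Continuous B := by
    have := continuous_polarPoint
    fun_prop
  have hAR : ∀ p : ℝ × ℝ, R < |p.1| → A p = 0 := fun p hp => by
    simp [A, hR0 (polarPoint p) (by rwa [norm_polarPoint])]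
  have hBR : ∀ p : ℝ × ℝ, R < |p.1| → B p = 0 := fun p hp => by
    simp [B, hR0 (polarPoint p) (by rwa [norm_polarPoint])]
  have hAi := integrableOn_polarCoord_target hA hAR
  have hBi := integrableOn_polarCoord_target hB hBR
  have key : ∀ p ∈ polarCoord.target,
      p.1 • (dbar F (Complex.polarCoord.symm p) / Complex.polarCoord.symm p) =
        (1 / 2 : ℂ) * A p + (Complex.I / 2) * B p := by
    rintro ⟨r, θ⟩ ⟨hr, -⟩
    rw [mem_Ioi] at hr
    have hr' : (r : ℂ) ≠ 0 := by exact_mod_cast hr.ne'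
    rw [polarPoint_eq]
    have hlin : ∀ (T : ℂ →L[ℝ] ℂ) (a b : ℝ), T (a + b * Complex.I) = a * T 1 + b * T Complex.I :=
      fun T a b => by
        rw [show (a + b * Complex.I : ℂ) = a • (1 : ℂ) + b • Complex.I by simp, map_add, map_smul,
          map_smul, Complex.real_smul, Complex.real_smul]
    have hE : polarPoint (r, θ) = r * Complex.exp (θ * Complex.I) := rfl
    have h2 : Complex.exp (θ * Complex.I) = Real.cos θ + Real.sin θ * Complex.I := by
      rw [Complex.exp_mul_I, Complex.ofReal_cos, Complex.ofReal_sin]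
    have h3 : ((Real.cos θ + Real.sin θ * Complex.I : ℂ)) *
        (Real.cos θ - Real.sin θ * Complex.I) = 1 := by
      have := congrArg (fun x : ℝ => (x : ℂ)) (Real.cos_sq_add_sin_sq θ)
      push_cast at this
      push_cast
      linear_combination this - (Complex.sin θ) ^ 2 * Complex.I_mul_I
    have h4 : (Real.cos θ + Real.sin θ * Complex.I : ℂ) ≠ 0 := left_ne_zero_of_mul_eq_one h3
    have h5 : Complex.I * (Real.cos θ + Real.sin θ * Complex.I : ℂ) =
        ((-Real.sin θ : ℝ) : ℂ) + (Real.cos θ : ℝ) * Complex.I := by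
      push_cast
      linear_combination Complex.sin θ * Complex.I_mul_I
    simp only [A, B, dbar]
    rw [h2, h5, hlin, hlin]
    generalize fderiv ℝ F (polarPoint (r, θ)) 1 = X
    generalize fderiv ℝ F (polarPoint (r, θ)) Complex.I = Y
    rw [hE, h2, Complex.real_smul]
    have e5 : (r : ℂ) * ((X + Complex.I * Y) / 2 / (r * (Real.cos θ + Real.sin θ * Complex.I))) =
        (X + Complex.I * Y) / 2 * (Real.cos θ - Real.sin θ * Complex.I) := by
      rw [div_mul_eq_div_div, mul_div_assoc', mul_div_assoc', mul_div_cancel_left₀ _ hr',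
        div_eq_iff h4, mul_assoc, mul_comm (Real.cos θ - Real.sin θ * Complex.I : ℂ), h3, mul_one]
    rw [e5]
    push_cast
    linear_combination (-(Complex.sin θ) * Y / 2) * Complex.I_mul_I
  rw [← Complex.integral_comp_polarCoord_symm, setIntegral_congr_fun
    polarCoord.open_target.measurableSet key, polarCoord_target,
    integral_add (hAi.const_mul _) (hBi.const_mul _), integral_const_mul, integral_const_mul]
  have hBz : ∫ p in Ioi 0 ×ˢ Ioo (-Real.pi) Real.pi, B p = 0 := by
    rw [Measure.volume_eq_prod, setIntegral_prod _ (by rwa [← Measure.volume_eq_prod])]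
    refine setIntegral_eq_zero_of_forall_eq_zero fun r hr => ?_
    rw [mem_Ioi] at hr
    rw [← integral_Ioc_eq_integral_Ioo, ← intervalIntegral.integral_of_le
      (by linarith [Real.pi_pos])]
    -- on a circle, `B` is the derivative of a periodic function
    have h1 : ∀ θ : ℝ, HasDerivAt (fun θ : ℝ => (r : ℂ)⁻¹ * F (polarPoint (r, θ))) (B (r, θ)) θ := by
      intro θ
      have h2 := ((hd (polarPoint (r, θ))).hasFDerivAt.comp_hasDerivAt θ
        (polarPoint_hasDerivAt_snd r θ)).const_mul (r : ℂ)⁻¹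
      refine h2.congr_deriv ?_
      have hr' : (r : ℂ) ≠ 0 := by exact_mod_cast hr.ne'
      rw [← Complex.real_smul, map_smul, Complex.real_smul, inv_mul_cancel_left₀ hr']
    rw [intervalIntegral.integral_eq_sub_of_hasDerivAt (fun θ _ => h1 θ)
      (Continuous.intervalIntegrable (by fun_prop) _ _)]
    have h3 : polarPoint (r, Real.pi) = polarPoint (r, -Real.pi) := by
      simp [polarPoint, Complex.exp_neg, Complex.exp_pi_mul_I]
    rw [h3, sub_self]
  -- on a ray, `A` is the derivative of `F`, which vanishes far from the origin
  have hAz : ∫ p in Ioi 0 ×ˢ Ioo (-Real.pi) Real.pi, A p = -(2 * Real.pi) * F 0 := by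
    rw [Measure.volume_eq_prod, ← setIntegral_prod_swap, setIntegral_prod _ ?_]
    · have h1 : ∀ θ : ℝ, ∫ r in Ioi (0 : ℝ), A (r, θ) = -F 0 := by
        intro θ
        have hR' : ∀ r : ℝ, R < |r| → F (polarPoint (r, θ)) = 0 := fun r hr => by
          by_contra h
          have := hR (subset_tsupport _ h)
          simp only [Metric.mem_closedBall, dist_zero_right, norm_polarPoint] at this
          linarith
        have hAi' : IntegrableOn (fun r => A (r, θ)) (Ioi 0) := by
          have h1 : IntegrableOn (fun r => A (r, θ)) (Icc 0 R) :=
            (Continuous.continuousOn (by fun_prop)).integrableOn_compact isCompact_Icc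
          refine h1.of_forall_sdiff_eq_zero measurableSet_Ioi ?_
          rintro r ⟨hr, h2⟩
          apply hAR
          by_contra h3
          rw [mem_Ioi] at hr
          simp only [abs_of_pos hr, not_lt] at h3
          exact h2 ⟨hr.le, h3⟩
        rw [integral_Ioi_of_hasDerivAt_of_tendsto (f := fun r => F (polarPoint (r, θ))) (m := 0)
          ?_ ?_ hAi' ?_]
        · simp [polarPoint]
        · have := continuous_polarPoint
          have := hd.continuous
          exact (Continuous.continuousWithinAt (by fun_prop))
        · intro r _
          exact (hd (polarPoint (r, θ))).hasFDerivAt.comp_hasDerivAt r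
            (polarPoint_hasDerivAt_fst r θ)
        · refine tendsto_const_nhds.congr' ?_
          filter_upwards [eventually_gt_atTop |R|] with r hr
          exact (hR' r ((le_abs_self R).trans_lt (hr.trans_le (le_abs_self r)))).symm
      have h2 : ∀ θ ∈ Ioo (-Real.pi) Real.pi, ∫ r in Ioi (0 : ℝ), A (Prod.swap (θ, r)) = -F 0 :=
        fun θ _ => h1 θ
      rw [setIntegral_congr_fun measurableSet_Ioo h2, setIntegral_const]
      simp only [Measure.real, Real.volume_Ioo]
      rw [ENNReal.toReal_ofReal (by linarith [Real.pi_pos]), Complex.real_smul]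
      push_cast
      ring
    · rw [← Measure.volume_eq_prod]
      exact (Measure.volume_eq_prod ℝ ℝ ▸ hAi).swap
  rw [hBz, hAz]
  ring

theorem locallyIntegrable_inv_complex : LocallyIntegrable fun ζ : ℂ => ζ⁻¹ := by
  refine locallyIntegrable_of_norm_le_rpow (α := 1) (C := 1) (by simp [Complex.finrank_real_complex])
    (by rw [Complex.finrank_real_complex]; norm_num) (ae_of_all _ fun ζ => ?_)
    measurable_inv.aestronglyMeasurable
  rw [Real.rpow_neg (norm_nonneg _), Real.rpow_one, one_mul, norm_inv]

theorem locallyIntegrable_inv_norm : LocallyIntegrable fun ζ : ℂ => ‖ζ‖⁻¹ := by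
  intro z
  obtain ⟨s, hs, h⟩ := locallyIntegrable_inv_complex z
  refine ⟨s, hs, ?_⟩
  have h2 : IntegrableOn (fun ζ : ℂ => ‖ζ⁻¹‖) s := Integrable.norm h
  simpa only [norm_inv] using h2

theorem tendsto_setIntegral_ball_inv :
    Tendsto (fun n : ℕ => ∫ ζ in Metric.ball (0 : ℂ) (1 / ((n : ℝ) + 1)), ‖ζ‖⁻¹) atTop (𝓝 0) := by
  have hanti : Antitone fun n : ℕ => Metric.ball (0 : ℂ) (1 / ((n : ℝ) + 1)) := fun m n hmn =>
    Metric.ball_subset_ball (one_div_le_one_div_of_le (by positivity) (by gcongr))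
  have h := hanti.tendsto_setIntegral (μ := volume) (f := fun ζ : ℂ => ‖ζ‖⁻¹)
    (fun n => Metric.isOpen_ball.measurableSet) ?_
  · convert h using 2
    have h1 : ⋂ n : ℕ, Metric.ball (0 : ℂ) (1 / ((n : ℝ) + 1)) ⊆ {0} := fun z hz => by
      by_contra h0
      obtain ⟨n, hn⟩ := exists_nat_one_div_lt (norm_pos_iff.2 h0)
      have := mem_iInter.1 hz n
      rw [mem_ball_zero_iff] at this
      linarith
    rw [setIntegral_measure_zero]
    exact measure_mono_null h1 (by simp)
  · refine IntegrableOn.mono_set ?_ Metric.ball_subset_closedBall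
    exact locallyIntegrable_inv_norm.integrableOn_isCompact (isCompact_closedBall _ _)

/-- Every smooth compactly supported `v` is `∂u/∂z̄` for a smooth `u`: its Cauchy transform. -/
theorem exists_dbar_eq {v : ℂ → ℂ} (hv : ContDiff ℝ ∞ v) (hc : HasCompactSupport v) :
    ∃ u : ℂ → ℂ, ContDiff ℝ ∞ u ∧ (∀ z, dbar u z = v z) ∧
      ∀ z, ‖u z‖ ≤ ∫ ζ, ‖v (z - ζ)‖ * ‖ζ‖⁻¹ := by
  set w : ℂ → ℂ := MeasureTheory.convolution (fun ζ : ℂ => ζ⁻¹) v (ContinuousLinearMap.mul ℝ ℂ)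
    volume with hw
  have hpi : (Real.pi : ℂ) ≠ 0 := by exact_mod_cast Real.pi_ne_zero
  have hwz : ∀ z, w z = ∫ ζ, ζ⁻¹ * v (z - ζ) := fun z => rfl
  have hwd : ContDiff ℝ ∞ w :=
    hc.contDiff_convolution_right (ContinuousLinearMap.mul ℝ ℂ) locallyIntegrable_inv_complex hv
  have hv1 : ContDiff ℝ 1 v := hv.of_le (by exact_mod_cast le_top)
  refine ⟨fun z => (Real.pi : ℂ)⁻¹ * w z, contDiff_const.mul hwd, fun z => ?_, fun z => ?_⟩
  · have h1 := hc.hasFDerivAt_convolution_right (ContinuousLinearMap.mul ℝ ℂ)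
      locallyIntegrable_inv_complex hv1 z
    have hci : HasCompactSupport (fderiv ℝ v) := hc.fderiv ℝ
    have hex : ConvolutionExistsAt (fun ζ : ℂ => ζ⁻¹) (fderiv ℝ v) z
        (ContinuousLinearMap.precompR ℂ (ContinuousLinearMap.mul ℝ ℂ)) volume :=
      hci.convolutionExists_right _ locallyIntegrable_inv_complex
        (hv1.continuous_fderiv (by simp)) z
    -- the derivatives of the convolution fall on the smooth factor `v`
    have h2 : ∀ e : ℂ, fderiv ℝ w z e = ∫ ζ, ζ⁻¹ * fderiv ℝ v (z - ζ) e := fun e => by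
      rw [h1.fderiv, MeasureTheory.convolution, ContinuousLinearMap.integral_apply hex]
      rfl
    have h2i : ∀ e : ℂ, Integrable fun ζ => ζ⁻¹ * fderiv ℝ v (z - ζ) e := fun e => by
      have := hex.integrable.apply_continuousLinearMap e
      exact this
    have h3 : dbar w z = ∫ ζ, ζ⁻¹ * dbar v (z - ζ) := by
      rw [dbar, h2, h2, ← integral_const_mul, ← integral_add (h2i _) ((h2i _).const_mul _),
        ← integral_div]
      congr 1
      ext ζ
      rw [dbar]
      ring
    have h4 : ∀ ζ, dbar (fun ζ => v (z - ζ)) ζ = -dbar v (z - ζ) := fun ζ => by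
      have h5 : fderiv ℝ (fun ζ => v (z - ζ)) ζ = -fderiv ℝ v (z - ζ) := by
        have h5 := ((hv1.differentiable (by simp) (z - ζ)).hasFDerivAt.comp ζ
          ((hasFDerivAt_id ζ).const_sub z)).fderiv
        refine h5.trans ?_
        ext e
        simp
      simp only [dbar, h5, neg_apply]
      ring
    -- the Cauchy–Pompeiu formula for the reflected translate of `v`
    have h6 := integral_dbar_div (F := fun ζ => v (z - ζ))
      (hv1.comp (contDiff_const.sub contDiff_id))
      (hc.comp_homeomorph (Homeomorph.subLeft z))
    simp only [h4, sub_zero] at h6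
    have h7 : dbar w z = Real.pi * v z := by
      rw [h3, ← neg_inj, ← integral_neg, ← neg_mul, ← h6]
      congr 1
      ext ζ
      rw [div_eq_mul_inv]
      ring
    have h8 := dbar_mul (g := fun _ => (Real.pi : ℂ)⁻¹) (k := w) (z := z)
      (differentiableAt_const _) (hwd.differentiable (by simp) z)
    rw [h8, h7, inv_mul_cancel_left₀ hpi]
    simp [dbar]
  · rw [norm_mul, hwz, norm_inv, Complex.norm_real, Real.norm_of_nonneg Real.pi_pos.le]
    have h1 : ‖∫ ζ, ζ⁻¹ * v (z - ζ)‖ ≤ ∫ ζ, ‖v (z - ζ)‖ * ‖ζ‖⁻¹ := by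
      refine (norm_integral_le_integral_norm _).trans_eq ?_
      congr 1
      ext ζ
      rw [norm_mul, norm_inv, mul_comm]
    refine (mul_le_of_le_one_left (norm_nonneg _) ?_).trans h1
    exact inv_le_one_of_one_le₀ (by linarith [Real.pi_gt_three])

/-- Among the functions bounded by `B`, those with small `L¹` norm have a uniformly small Cauchy
transform. -/
theorem exists_cauchyTransform_bound (B : ℝ) {η : ℝ} (hη : 0 < η) :
    ∃ K : ℝ, ∀ v : ℂ → ℂ, Continuous v → HasCompactSupport v → (∀ z, ‖v z‖ ≤ B) →
      ∀ z, ∫ ζ, ‖v (z - ζ)‖ * ‖ζ‖⁻¹ ≤ η + K * ∫ ζ, ‖v ζ‖ := by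
  -- the kernel `1/|ζ|` has small integral over a small disc `|ζ| < r`, and is at most `1/r` outside
  have h1 := (tendsto_setIntegral_ball_inv.const_mul B)
  rw [mul_zero] at h1
  obtain ⟨n, hn⟩ := (h1.eventually (gt_mem_nhds hη)).exists
  set r : ℝ := 1 / ((n : ℝ) + 1) with hr
  have hr0 : 0 < r := by positivity
  refine ⟨r⁻¹, fun v hv hc hB z => ?_⟩
  have hcv : Continuous fun ζ => v (z - ζ) := hv.comp (continuous_const.sub continuous_id)
  have hcc : HasCompactSupport fun ζ => v (z - ζ) := hc.comp_homeomorph (Homeomorph.subLeft z)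
  have hvi : Integrable fun ζ => ‖v (z - ζ)‖ := (hcv.integrable_of_hasCompactSupport hcc).norm
  have hI : Integrable fun ζ => ‖v (z - ζ)‖ * ‖ζ‖⁻¹ :=
    locallyIntegrable_inv_norm.integrable_smul_left_of_hasCompactSupport hcv.norm hcc.norm
  rw [← integral_add_compl (Metric.isOpen_ball (x := (0 : ℂ)) (ε := r)).measurableSet hI]
  have hib : IntegrableOn (fun ζ : ℂ => ‖ζ‖⁻¹) (Metric.ball 0 r) :=
    (locallyIntegrable_inv_norm.integrableOn_isCompact (isCompact_closedBall 0 r)).mono_set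
      Metric.ball_subset_closedBall
  refine add_le_add ?_ ?_
  · refine le_trans ?_ hn.le
    rw [← integral_const_mul]
    refine integral_mono hI.integrableOn (hib.const_mul B) fun ζ => ?_
    exact mul_le_mul_of_nonneg_right (hB _) (inv_nonneg.2 (norm_nonneg _))
  · have h2 : ∫ ζ, ‖v ζ‖ = ∫ ζ, ‖v (z - ζ)‖ := (integral_sub_left_eq_self _ volume z).symm
    rw [h2, ← integral_const_mul]
    refine (setIntegral_mono_on (g := fun ζ => r⁻¹ * ‖v (z - ζ)‖) hI.integrableOn
      (hvi.const_mul _).integrableOn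
      (Metric.isOpen_ball (x := (0 : ℂ)) (ε := r)).measurableSet.compl fun ζ hζ => ?_).trans
      (setIntegral_le_integral (hvi.const_mul _) (ae_of_all _ fun ζ => by positivity))
    rw [mul_comm]
    refine mul_le_mul_of_nonneg_right ?_ (norm_nonneg _)
    simp only [mem_compl_iff, mem_ball_zero_iff, not_lt] at hζ
    exact inv_anti₀ hr0 hζ

/-! ### The domain near a boundary point -/

section Geometry

variable {Ω : Set ℂ} {d : ℕ} {γ : Fin d → ℝ → ℂ}

theorem IsSmoothlyBoundedBy.injective_mod_one (h : IsSmoothlyBoundedBy Ω γ) {i j : Fin d}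
    {s t : ℝ} (hst : γ i s = γ j t) : i = j ∧ ∃ k : ℤ, s = t + k := by
  have key : ∀ (i : Fin d) (s : ℝ), γ i (Int.fract s) = γ i s := fun i s => by
    have := (h.periodic i).sub_int_mul_eq (x := s) ⌊s⌋
    rwa [mul_one] at this
  have h1 := h.injective i j (Int.fract s) ⟨Int.fract_nonneg s, Int.fract_lt_one s⟩
    (Int.fract t) ⟨Int.fract_nonneg t, Int.fract_lt_one t⟩ (by rw [key, key, hst])
  refine ⟨h1.1, ⌊s⌋ - ⌊t⌋, ?_⟩
  have h2 := h1.2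
  rw [Int.fract, Int.fract] at h2
  push_cast
  linarith

theorem IsSmoothlyBoundedBy.mem_frontier (h : IsSmoothlyBoundedBy Ω γ) (j : Fin d) (t : ℝ) :
    γ j t ∈ frontier Ω := by
  rw [h.frontier_eq]
  exact mem_iUnion.2 ⟨j, t, rfl⟩

theorem IsSmoothlyBoundedBy.isCompact_closure (h : IsSmoothlyBoundedBy Ω γ) :
    IsCompact (closure Ω) :=
  h.isBounded.isCompact_closure

theorem IsSmoothlyBoundedBy.continuous (h : IsSmoothlyBoundedBy Ω γ) (j : Fin d) :
    Continuous (γ j) :=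
  (h.contDiff j).continuous

theorem IsSmoothlyBoundedBy.continuous_deriv (h : IsSmoothlyBoundedBy Ω γ) (j : Fin d) :
    Continuous (deriv (γ j)) :=
  (h.contDiff j).continuous_deriv (by simp)

/-- The chart `t + i s ↦ γ t + s n` of the plane along the curve `γ` near `γ t₀`, where
`n = i γ'(t₀)` is the inner normal at `γ t₀`.  A fixed direction `n`, rather than the normal at
`γ t`, keeps the chart affine in `s`. -/
noncomputable def boundaryChart (γ : ℝ → ℂ) (t₀ : ℝ) (z : ℂ) : ℂ :=
  γ z.re + z.im * (Complex.I * deriv γ t₀)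

/-- The derivative of `boundaryChart γ t₀`. -/
noncomputable def boundaryChartDeriv (γ : ℝ → ℂ) (t₀ : ℝ) (z : ℂ) : ℂ →L[ℝ] ℂ :=
  Complex.reCLM.smulRight (deriv γ z.re) + Complex.imCLM.smulRight (Complex.I * deriv γ t₀)

theorem boundaryChart_hasStrictFDerivAt {γ : ℝ → ℂ} (hγ : ContDiff ℝ ∞ γ) (t₀ : ℝ) (z : ℂ) :
    HasStrictFDerivAt (boundaryChart γ t₀) (boundaryChartDeriv γ t₀ z) z := by
  have h1 : HasStrictFDerivAt (fun z : ℂ => γ z.re) (Complex.reCLM.smulRight (deriv γ z.re)) z := by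
    have h2 : HasStrictDerivAt γ (deriv γ z.re) z.re := hγ.contDiffAt.hasStrictDerivAt (by simp)
    have h3 := h2.hasStrictFDerivAt.comp z (Complex.reCLM.hasStrictFDerivAt (x := z))
    refine h3.congr_fderiv ?_
    ext v
    simp
  have h4 : HasStrictFDerivAt (fun z : ℂ => (z.im : ℂ) * (Complex.I * deriv γ t₀))
      (Complex.imCLM.smulRight (Complex.I * deriv γ t₀)) z := by
    have := (Complex.imCLM.smulRight (Complex.I * deriv γ t₀)).hasStrictFDerivAt (x := z)
    refine this.congr_of_eventuallyEq (Eventually.of_forall fun w => ?_)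
    simp
  exact h1.add h4

theorem boundaryChart_ofReal (γ : ℝ → ℂ) (t₀ t : ℝ) : boundaryChart γ t₀ t = γ t := by
  simp [boundaryChart]

theorem boundaryChartDeriv_center (γ : ℝ → ℂ) (t₀ : ℝ) (v : ℂ) :
    boundaryChartDeriv γ t₀ t₀ v = deriv γ t₀ * v := by
  simp only [boundaryChartDeriv, add_apply, ContinuousLinearMap.smulRight_apply,
    Complex.reCLM_apply, Complex.imCLM_apply, Complex.ofReal_re, Complex.real_smul]
  conv_rhs => rw [← Complex.re_add_im v]
  ring

theorem det_boundaryChartDeriv (γ : ℝ → ℂ) (t₀ : ℝ) (z : ℂ) :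
    (boundaryChartDeriv γ t₀ z).det =
      ((starRingEnd ℂ) (deriv γ z.re) * (Complex.I * deriv γ t₀)).im := by
  rw [ContinuousLinearMap.det, ← LinearMap.det_toMatrix Complex.basisOneI, Matrix.det_fin_two]
  simp [LinearMap.toMatrix_apply, boundaryChartDeriv]
  ring

theorem IsPreconnected.subset_of_inter_frontier_eq_empty {X : Type*} [TopologicalSpace X]
    {s t : Set X} (hs : IsPreconnected s) (ht : (s ∩ t).Nonempty)
    (h : s ∩ frontier t = ∅) : s ⊆ t := by
  have hsub : s ⊆ interior t ∪ (closure t)ᶜ := fun x hx => by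
    by_contra hx'
    rw [mem_union, not_or, mem_compl_iff, not_not] at hx'
    exact h.subset ⟨hx, hx'.2, hx'.1⟩
  refine (hs.subset_left_of_subset_union isOpen_interior isClosed_closure.isOpen_compl
    ?_ hsub ?_).trans interior_subset
  · exact disjoint_compl_right.mono_left (interior_subset.trans subset_closure)
  · obtain ⟨x, hx, hxt⟩ := ht
    exact ⟨x, hx, (hsub hx).resolve_right fun h1 => h1 (subset_closure hxt)⟩

/-- The closed square of half-width `r` around the real point `t₀`. -/
def chartBox (t₀ r : ℝ) : Set ℂ := Icc (t₀ - r) (t₀ + r) ×ℂ Icc (-r) r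

theorem chartBox_mono {t₀ r r' : ℝ} (h : r ≤ r') : chartBox t₀ r ⊆ chartBox t₀ r' := by
  rintro z ⟨⟨h1, h2⟩, ⟨h3, h4⟩⟩
  exact ⟨⟨by linarith, by linarith⟩, ⟨by linarith, by linarith⟩⟩

theorem exists_chartBox_subset {t₀ : ℝ} {s : Set ℂ} (hs : s ∈ 𝓝 (t₀ : ℂ)) :
    ∃ r, 0 < r ∧ chartBox t₀ r ⊆ s := by
  obtain ⟨ε, hε, h⟩ := Metric.mem_nhds_iff.1 hs
  refine ⟨ε / 4, by positivity, fun z hz => h ?_⟩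
  obtain ⟨⟨h1, h2⟩, ⟨h3, h4⟩⟩ := hz
  rw [Metric.mem_ball, dist_eq_norm]
  refine (Complex.norm_le_abs_re_add_abs_im _).trans_lt ?_
  have h5 : |(z - t₀).re| ≤ ε / 4 := by
    rw [Complex.sub_re, Complex.ofReal_re, abs_le]
    constructor <;> linarith
  have h6 : |(z - t₀).im| ≤ ε / 4 := by
    rw [Complex.sub_im, Complex.ofReal_im, abs_le]
    constructor <;> linarith
  linarith

theorem convex_chartBox (t₀ r : ℝ) : Convex ℝ (chartBox t₀ r) :=
  ((convex_Icc (t₀ - r) (t₀ + r)).linear_preimage Complex.reLm).inter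
    ((convex_Icc (-r) r).linear_preimage Complex.imLm)

/-- Near a boundary point the domain is the part `s > 0` of the chart `boundaryChart`. -/
theorem IsSmoothlyBoundedBy.exists_chart (h : IsSmoothlyBoundedBy Ω γ) (j : Fin d) (t₀ : ℝ)
    {W : Set ℂ} (hW : W ∈ 𝓝 (t₀ : ℂ)) :
    ∃ r, 0 < r ∧ r < 1 / 2 ∧ chartBox t₀ r ⊆ W ∧ InjOn (boundaryChart (γ j) t₀) (chartBox t₀ r) ∧
      (∀ z ∈ chartBox t₀ r, boundaryChart (γ j) t₀ z ∈ Ω ↔ 0 < z.im) ∧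
      (∀ z ∈ chartBox t₀ r, 0 < (boundaryChartDeriv (γ j) t₀ z).det) := by
  set Φ := boundaryChart (γ j) t₀ with hΦ
  have hg : deriv (γ j) t₀ ≠ 0 := h.deriv_ne_zero j t₀
  have hst := boundaryChart_hasStrictFDerivAt (h.contDiff j) t₀
  have hcont : Continuous Φ := continuous_iff_continuousAt.2 fun z => (hst z).continuousAt
  have hΦ0 : Φ t₀ = γ j t₀ := boundaryChart_ofReal _ _ _
  -- injectivity near the centre
  obtain ⟨s, hs, hinj⟩ : ∃ s ∈ 𝓝 (t₀ : ℂ), InjOn Φ s := by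
    have hinv : (boundaryChartDeriv (γ j) t₀ t₀).IsInvertible := by
      refine ⟨(ContinuousLinearEquiv.unitsEquivAut ℂ (Units.mk0 _ hg)).restrictScalars ℝ, ?_⟩
      ext v
      simp [boundaryChartDeriv_center, mul_comm]
    obtain ⟨L, hL⟩ := hinv
    have h1 : HasStrictFDerivAt Φ (L : ℂ →L[ℝ] ℂ) t₀ := hL ▸ hst t₀
    exact ⟨_, (h1.toOpenPartialHomeomorph Φ).open_source.mem_nhds
      h1.mem_toOpenPartialHomeomorph_source, (h1.toOpenPartialHomeomorph Φ).injOn⟩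
  -- at the centre the determinant is `|γ'(t₀)|²`, so it is positive near by
  have hdet : {z : ℂ | 0 < (boundaryChartDeriv (γ j) t₀ z).det} ∈ 𝓝 (t₀ : ℂ) := by
    simp only [det_boundaryChartDeriv]
    have hc : Continuous fun z : ℂ =>
        ((starRingEnd ℂ) (deriv (γ j) z.re) * (Complex.I * deriv (γ j) t₀)).im := by
      have := (h.continuous_deriv j).comp Complex.continuous_re
      exact Complex.continuous_im.comp
        ((Complex.continuous_conj.comp this).mul continuous_const)
    refine (isOpen_lt continuous_const hc).mem_nhds ?_
    have h1 : (starRingEnd ℂ) (deriv (γ j) t₀) * (Complex.I * deriv (γ j) t₀) =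
        ((Complex.normSq (deriv (γ j) t₀) : ℝ) : ℂ) * Complex.I := by
      rw [Complex.normSq_eq_conj_mul_self]
      ring
    simpa only [mem_ofPred_eq, Complex.ofReal_re, h1, Complex.re_ofReal_mul, Complex.im_ofReal_mul,
      Complex.I_im, mul_one, Complex.normSq_pos] using hg
  obtain ⟨ρ₀, hρ₀, hρs⟩ := exists_chartBox_subset (inter_mem (inter_mem hs hdet) hW)
  -- half-width at most `1/4`, to stay within one period of the curve
  set ρ := min ρ₀ (1 / 4) with hρdef
  have hρ : 0 < ρ := lt_min hρ₀ (by norm_num)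
  have hρ4 : ρ ≤ 1 / 4 := min_le_right _ _
  have hρsub : chartBox t₀ ρ ⊆ (s ∩ {z : ℂ | 0 < (boundaryChartDeriv (γ j) t₀ z).det}) ∩ W :=
    (chartBox_mono (min_le_left _ _)).trans hρs
  -- the part of the boundary away from the arc around `γ j t₀`
  let I : Fin d → Set ℝ := fun i =>
    Icc (t₀ - 1 / 2) (t₀ + 1 / 2) \ (if i = j then Ioo (t₀ - ρ) (t₀ + ρ) else ∅)
  have hIc : ∀ i, IsCompact (I i) := fun i => by
    refine isCompact_Icc.diff ?_
    split_ifs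
    · exact isOpen_Ioo
    · exact isOpen_empty
  have hC : IsClosed (⋃ i, γ i '' I i) :=
    (isCompact_iUnion fun i => (hIc i).image (h.continuous i)).isClosed
  have hpC : Φ t₀ ∉ ⋃ i, γ i '' I i := by
    rw [hΦ0]
    rintro hp
    obtain ⟨i, s, ⟨hs1, hs2⟩, hsp⟩ := mem_iUnion.1 hp
    obtain ⟨rfl, k, hk⟩ := h.injective_mod_one hsp
    have hk0 : k = 0 := by
      have h1 : (k : ℝ) < 1 := by linarith [hs1.2]
      have h2 : (-1 : ℝ) < k := by linarith [hs1.1]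
      have h1' : k < 1 := by exact_mod_cast h1
      have h2' : -1 < k := by exact_mod_cast h2
      omega
    rw [if_pos rfl] at hs2
    rw [hk0, Int.cast_zero, add_zero] at hk
    exact hs2 (hk ▸ ⟨by linarith, by linarith⟩)
  obtain ⟨r₀, hr₀, hr₀sub⟩ := exists_chartBox_subset
    (hcont.continuousAt.preimage_mem_nhds (hC.isOpen_compl.mem_nhds hpC))
  set r := min r₀ ρ with hrdef
  have hr : 0 < r := lt_min hr₀ hρ
  have hrρ : chartBox t₀ r ⊆ chartBox t₀ ρ := chartBox_mono (min_le_right _ _)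
  have hinjρ : InjOn Φ (chartBox t₀ ρ) := hinj.mono (hρsub.trans
    (inter_subset_left.trans inter_subset_left))
  -- a boundary point in the small square lies on the arc, and by injectivity on its real axis
  have hfr : ∀ z ∈ chartBox t₀ r, Φ z ∈ frontier Ω → z.im = 0 := by
    intro z hz hzf
    rw [h.frontier_eq] at hzf
    obtain ⟨i, t, ht⟩ := mem_iUnion.1 hzf
    obtain ⟨t', ht', htt'⟩ := (h.periodic i).exists_mem_Ico one_pos t (t₀ - 1 / 2)
    have h1 : Φ z ∉ ⋃ i, γ i '' I i := hr₀sub (chartBox_mono (min_le_left _ _) hz)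
    have h2 : t' ∉ I i := fun h2 => h1 (mem_iUnion.2 ⟨i, t', h2, by rw [← htt', ht]⟩)
    have h3 : t' ∈ Icc (t₀ - 1 / 2) (t₀ + 1 / 2) := ⟨ht'.1, by linarith [ht'.2]⟩
    have h4 : t' ∈ (if i = j then Ioo (t₀ - ρ) (t₀ + ρ) else ∅) := by
      by_contra h4
      exact h2 ⟨h3, h4⟩
    split_ifs at h4 with hij
    · subst hij
      have h5 : Φ z = Φ t' := by
        rw [hΦ, boundaryChart_ofReal, ← htt', ht]
      have h6 : (t' : ℂ) ∈ chartBox t₀ ρ :=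
        ⟨⟨by simpa using h4.1.le, by simpa using h4.2.le⟩, by simp [hρ.le]⟩
      rw [hinjρ (hrρ hz) h6 h5]
      simp
    · exact h4.elim
  obtain ⟨ε, hε, ⟨hεr, hε0⟩⟩ := ((h.left_side j t₀).and (Ioc_mem_nhdsGT hr)).exists
  have hin : ∀ c : ℝ, |c| ≤ r → (⟨t₀, c⟩ : ℂ) ∈ chartBox t₀ r := fun c hc =>
    ⟨⟨by simp [hr.le], by simp [hr.le]⟩, abs_le.1 hc⟩
  -- each open half of the square is connected and mapped off the boundary, so that its side is
  -- decided by a single point, on the normal at `γ j t₀`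
  have hpos : ∀ z ∈ chartBox t₀ r, 0 < z.im → Φ z ∈ Ω := by
    have hconv : Convex ℝ (chartBox t₀ r ∩ {z : ℂ | 0 < z.im}) :=
      (convex_chartBox t₀ r).inter (convex_halfSpace_im_gt 0)
    have h1 := (hconv.isPreconnected.image Φ hcont.continuousOn).subset_of_inter_frontier_eq_empty
      (t := Ω) ?_ ?_
    · exact fun z hz hz0 => h1 ⟨z, ⟨hz, hz0⟩, rfl⟩
    · refine ⟨Φ ⟨t₀, ε⟩, ⟨_, ⟨hin ε (by rw [abs_of_pos hεr]; exact hε0), hεr⟩, rfl⟩, ?_⟩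
      exact hε.1
    · rw [eq_empty_iff_forall_notMem]
      rintro _ ⟨⟨z, ⟨hz, hz0⟩, rfl⟩, hzf⟩
      exact hz0.ne' (hfr z hz hzf)
  have hneg : ∀ z ∈ chartBox t₀ r, z.im < 0 → Φ z ∉ Ω := by
    have hconv : Convex ℝ (chartBox t₀ r ∩ {z : ℂ | z.im < 0}) :=
      (convex_chartBox t₀ r).inter (convex_halfSpace_im_lt 0)
    have h1 := (hconv.isPreconnected.image Φ hcont.continuousOn).subset_of_inter_frontier_eq_empty
      (t := Ωᶜ) ?_ ?_
    · exact fun z hz hz0 => h1 ⟨z, ⟨hz, hz0⟩, rfl⟩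
    · refine ⟨Φ ⟨t₀, -ε⟩, ⟨_, ⟨hin (-ε) (by rw [abs_neg, abs_of_pos hεr]; exact hε0), ?_⟩, rfl⟩, ?_⟩
      · simpa using hεr
      · have := hε.2
        simpa [hΦ, boundaryChart, sub_eq_add_neg] using this
    · rw [eq_empty_iff_forall_notMem]
      rintro _ ⟨⟨z, ⟨hz, hz0⟩, rfl⟩, hzf⟩
      rw [frontier_compl] at hzf
      exact (ne_of_lt hz0) (hfr z hz hzf)
  refine ⟨r, hr, by linarith [min_le_right r₀ ρ], fun z hz => (hρsub (hrρ hz)).2,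
    hinjρ.mono hrρ, fun z hz => ⟨fun hzΩ => ?_, hpos z hz⟩, fun z hz => (hρsub (hrρ hz)).1.2⟩
  by_contra h0
  rcases lt_or_eq_of_le (not_lt.1 h0) with h1 | h1
  · exact hneg z hz h1 hzΩ
  · have h2 : z = (z.re : ℂ) := Complex.ext rfl (by simpa using h1)
    have h3 := h.mem_frontier j z.re
    rw [← boundaryChart_ofReal (γ j) t₀, ← h2, h.isOpen.frontier_eq] at h3
    exact h3.2 hzΩ

/-! ### A smooth vector field pointing into the domain -/

/-- The interior cone of directions at `p`: the vectors `v` such that the points of `closure Ω`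
near `p` are moved into `Ω` by small positive multiples of vectors near `v`. -/
def inwardCone (Ω : Set ℂ) (p : ℂ) : Set ℂ :=
  {v | ∀ᶠ q : ℂ × ℂ × ℝ in 𝓝[closure Ω] p ×ˢ 𝓝 v ×ˢ 𝓝[>] (0 : ℝ), q.1 + q.2.2 * q.2.1 ∈ Ω}

theorem tendsto_add_smul_nhds {p v : ℂ} {s : Set ℂ} :
    Tendsto (fun q : ℂ × ℂ × ℝ => q.1 + q.2.2 * q.2.1) (𝓝[s] p ×ˢ 𝓝 v ×ˢ 𝓝[>] (0 : ℝ)) (𝓝 p) := by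
  have h1 : Tendsto (fun q : ℂ × ℂ × ℝ => q.1 + q.2.2 * q.2.1) (𝓝 p ×ˢ 𝓝 v ×ˢ 𝓝 (0 : ℝ)) (𝓝 p) := by
    rw [← nhds_prod_eq, ← nhds_prod_eq]
    have : Continuous fun q : ℂ × ℂ × ℝ => q.1 + q.2.2 * q.2.1 := by fun_prop
    convert this.tendsto (p, v, (0 : ℝ)) using 2
    simp
  exact h1.mono_left (prod_mono nhdsWithin_le_nhds (prod_mono le_rfl nhdsWithin_le_nhds))

theorem convex_inwardCone (Ω : Set ℂ) (p : ℂ) : Convex ℝ (inwardCone Ω p) := by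
  intro v₁ h₁ v₂ h₂ a b ha hb hab
  rcases ha.eq_or_lt with rfl | ha
  · rw [zero_add] at hab
    simpa [hab] using h₂
  rcases hb.eq_or_lt with rfl | hb
  · rw [add_zero] at hab
    simpa [hab] using h₁
  set v : ℂ := a • v₁ + b • v₂ with hv
  -- a step along `v` is a step along `v₁` followed by a step along `v₂`
  have hscale : ∀ c : ℝ, 0 < c → Tendsto (fun ε : ℝ => c * ε) (𝓝[>] 0) (𝓝[>] 0) := fun c hc => by
    refine tendsto_nhdsWithin_iff.2 ⟨?_, ?_⟩
    · have : Tendsto (fun ε : ℝ => c * ε) (𝓝 0) (𝓝 0) := by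
        simpa using (continuous_const_mul c).tendsto 0
      exact this.mono_left nhdsWithin_le_nhds
    · filter_upwards [self_mem_nhdsWithin] with ε hε
      exact mul_pos hc hε
  have hshift : ∀ u : ℂ, Tendsto (fun v' : ℂ => u + (v' - v)) (𝓝 v) (𝓝 u) := fun u => by
    have : Continuous fun v' : ℂ => u + (v' - v) := by fun_prop
    simpa using this.tendsto v
  have t₁ : Tendsto (fun q : ℂ × ℂ × ℝ => (q.1, v₁ + (q.2.1 - v), a * q.2.2))
      (𝓝[closure Ω] p ×ˢ 𝓝 v ×ˢ 𝓝[>] (0 : ℝ)) (𝓝[closure Ω] p ×ˢ 𝓝 v₁ ×ˢ 𝓝[>] (0 : ℝ)) :=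
    tendsto_fst.prodMk (((hshift v₁).comp (tendsto_fst.comp tendsto_snd)).prodMk
      ((hscale a ha).comp (tendsto_snd.comp tendsto_snd)))
  have e₁ := t₁.eventually h₁
  have t₂ : Tendsto (fun q : ℂ × ℂ × ℝ =>
      (q.1 + ((a * q.2.2 : ℝ) : ℂ) * (v₁ + (q.2.1 - v)), v₂ + (q.2.1 - v), b * q.2.2))
      (𝓝[closure Ω] p ×ˢ 𝓝 v ×ˢ 𝓝[>] (0 : ℝ)) (𝓝[closure Ω] p ×ˢ 𝓝 v₂ ×ˢ 𝓝[>] (0 : ℝ)) := by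
    refine Tendsto.prodMk ?_ (((hshift v₂).comp (tendsto_fst.comp tendsto_snd)).prodMk
      ((hscale b hb).comp (tendsto_snd.comp tendsto_snd)))
    refine tendsto_nhdsWithin_iff.2 ⟨tendsto_add_smul_nhds.comp t₁, ?_⟩
    filter_upwards [e₁] with q hq using subset_closure hq
  filter_upwards [t₂.eventually h₂] with q hq
  convert hq using 1
  have hab' : (b : ℂ) = 1 - a := by
    rw [eq_sub_iff_add_eq, add_comm]
    exact_mod_cast hab
  simp only [hv, Complex.real_smul]
  push_cast
  rw [hab']
  ring

theorem eventually_mem_inwardCone {p v : ℂ} (hv : v ∈ inwardCone Ω p) :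
    ∀ᶠ q in 𝓝[closure Ω] p, v ∈ inwardCone Ω q := by
  obtain ⟨A, hA, B, hB, hAB⟩ := eventually_prod_iff.1 hv
  filter_upwards [eventually_eventually_nhdsWithin.2 hA] with q hq
  exact eventually_prod_iff.2 ⟨A, hq, B, hB, hAB⟩

theorem zero_mem_inwardCone (hΩ : IsOpen Ω) {p : ℂ} (hp : p ∈ Ω) : (0 : ℂ) ∈ inwardCone Ω p :=
  tendsto_add_smul_nhds.eventually (hΩ.mem_nhds hp)

/-- The inner normal lies in the interior cone: the second coordinate `s` of the chart increases
strictly along it. -/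
theorem IsSmoothlyBoundedBy.normal_mem_inwardCone (h : IsSmoothlyBoundedBy Ω γ) (j : Fin d)
    (t₀ : ℝ) : Complex.I * deriv (γ j) t₀ ∈ inwardCone Ω (γ j t₀) := by
  set Φ := boundaryChart (γ j) t₀ with hΦ
  set n := Complex.I * deriv (γ j) t₀ with hn
  have hg : deriv (γ j) t₀ ≠ 0 := h.deriv_ne_zero j t₀
  let L : ℂ ≃L[ℝ] ℂ :=
    (ContinuousLinearEquiv.unitsEquivAut ℂ (Units.mk0 _ hg)).restrictScalars ℝ
  have hLv : ∀ v, L v = v * deriv (γ j) t₀ := fun v => by simp [L]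
  have hLn : L.symm n = Complex.I := by
    rw [ContinuousLinearEquiv.symm_apply_eq, hLv, hn]
  have hst : HasStrictFDerivAt Φ (L : ℂ →L[ℝ] ℂ) t₀ := by
    refine (boundaryChart_hasStrictFDerivAt (h.contDiff j) t₀ t₀).congr_fderiv ?_
    ext v
    simp [boundaryChartDeriv_center, hLv, mul_comm]
  set e := hst.toOpenPartialHomeomorph Φ with he
  have hsrc : (t₀ : ℂ) ∈ e.source := hst.mem_toOpenPartialHomeomorph_source
  have hp : Φ t₀ = γ j t₀ := boundaryChart_ofReal _ _ _
  have hes : e.symm (γ j t₀) = t₀ := by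
    rw [← hp]
    exact e.left_inv hsrc
  have htgt : γ j t₀ ∈ e.target := by
    rw [← hp]
    exact e.map_source hsrc
  obtain ⟨r, hr, -, hrW, -, hrΩ, -⟩ := h.exists_chart j t₀ (e.open_source.mem_nhds hsrc)
  have hinv : HasStrictFDerivAt e.symm (L.symm : ℂ →L[ℝ] ℂ) (γ j t₀) := by
    rw [← hp]
    exact hst.to_localInverse
  -- near `γ j t₀`, the domain is given by the sign of the second coordinate
  have hbox : chartBox t₀ r ∈ 𝓝 (t₀ : ℂ) :=
    inter_mem (Complex.continuous_re.continuousAt.preimage_mem_nhds (by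
      rw [Complex.ofReal_re]
      exact Icc_mem_nhds (by linarith) (by linarith)))
      (Complex.continuous_im.continuousAt.preimage_mem_nhds (by
      rw [Complex.ofReal_im]
      exact Icc_mem_nhds (by linarith) (by linarith)))
  have hΩiff : ∀ᶠ z in 𝓝 (γ j t₀), z ∈ Ω ↔ 0 < (e.symm z).im := by
    have h1 : ∀ᶠ z in 𝓝 (γ j t₀), e.symm z ∈ chartBox t₀ r := by
      have := (e.continuousAt_symm htgt).preimage_mem_nhds (by rw [hes]; exact hbox)
      exact this
    filter_upwards [h1, e.open_target.mem_nhds htgt] with z hz hzt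
    have h2 := hrΩ _ hz
    have h3 : Φ (e.symm z) = z := e.right_inv hzt
    rwa [← hΦ, h3] at h2
  -- by continuity, the second coordinate is nonnegative on the closure
  have hcl : ∀ᶠ z in 𝓝[closure Ω] (γ j t₀), 0 ≤ (e.symm z).im := by
    filter_upwards [self_mem_nhdsWithin, nhdsWithin_le_nhds hΩiff.eventually_nhds,
      nhdsWithin_le_nhds (e.open_target.mem_nhds htgt)] with z hzc hz hzt
    by_contra h0
    rw [not_le] at h0
    have h1 : ∀ᶠ y in 𝓝 z, (e.symm y).im < 0 :=
      (Complex.continuous_im.continuousAt.comp (e.continuousAt_symm hzt)).eventually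
        (gt_mem_nhds h0)
    obtain ⟨y, hy3, hy1, hy2⟩ := ((mem_closure_iff_frequently.1 hzc).and_eventually
      (hz.and h1)).exists
    exact absurd (hy1.1 hy3) (not_lt.2 hy2.le)
  -- strict differentiability of the inverse chart, with an error `η |εv| ≤ ε / 2`, makes the second
  -- coordinate increase by about `ε` along `ε n`
  set η : ℝ := 1 / (2 * (‖n‖ + 1)) with hη
  have hη0 : 0 < η := by positivity
  have hpair : Tendsto (fun q : ℂ × ℂ × ℝ => (q.1 + q.2.2 * q.2.1, q.1))
      (𝓝[closure Ω] (γ j t₀) ×ˢ 𝓝 n ×ˢ 𝓝[>] (0 : ℝ)) (𝓝 (γ j t₀, γ j t₀)) := by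
    rw [nhds_prod_eq]
    exact tendsto_add_smul_nhds.prodMk (tendsto_fst.mono_right nhdsWithin_le_nhds)
  have hv : ∀ᶠ v in 𝓝 n, ‖v‖ < ‖n‖ + 1 ∧ 1 / 2 < (L.symm v).im := by
    refine (continuous_norm.tendsto n |>.eventually (gt_mem_nhds (by linarith))).and ?_
    have hc : Continuous fun v => (L.symm v).im :=
      Complex.continuous_im.comp L.symm.continuous
    refine (hc.tendsto n).eventually (lt_mem_nhds ?_)
    rw [hLn, Complex.I_im]
    norm_num
  filter_upwards [tendsto_add_smul_nhds.eventually hΩiff,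
    (tendsto_fst (f := 𝓝[closure Ω] (γ j t₀)) (g := 𝓝 n ×ˢ 𝓝[>] (0 : ℝ))).eventually hcl,
    hpair.eventually (hinv.isLittleO.def hη0),
    (tendsto_fst.comp (tendsto_snd (f := 𝓝[closure Ω] (γ j t₀))
      (g := 𝓝 n ×ˢ 𝓝[>] (0 : ℝ)))).eventually hv,
    (tendsto_snd.comp (tendsto_snd (f := 𝓝[closure Ω] (γ j t₀))
      (g := 𝓝 n ×ˢ 𝓝[>] (0 : ℝ)))).eventually self_mem_nhdsWithin] with ⟨x, v, ε⟩ h1 h2 h3 h4 h5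
  simp only [Function.comp_apply] at h1 h2 h3 h4 h5
  rw [h1]
  simp only [add_sub_cancel_left, norm_mul, Complex.norm_real, Real.norm_of_nonneg h5.le] at h3
  have h6 := (Complex.abs_im_le_norm _).trans h3
  rw [← Complex.real_smul, ContinuousLinearEquiv.coe_coe, map_smul, Complex.sub_im, Complex.sub_im,
    Complex.smul_im, smul_eq_mul] at h6
  have h7 : η * (ε * ‖v‖) ≤ ε * (1 / 2) := by
    have : η * ‖v‖ ≤ 1 / 2 := by
      rw [hη, div_mul_eq_mul_div, one_mul, div_le_iff₀ (by positivity)]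
      linarith [h4.1]
    nlinarith
  have h8 := (abs_le.1 h6).1
  rw [Complex.real_smul] at h8
  have h9 : ε * (1 / 2) < ε * (L.symm v).im := mul_lt_mul_of_pos_left h4.2 h5
  linarith

/-- There is a smooth vector field `V` such that `z ↦ z + ε V z` moves `closure Ω` into `Ω`, to a
distance at least of the order of `ε` from the boundary. -/
theorem IsSmoothlyBoundedBy.exists_inward_field (h : IsSmoothlyBoundedBy Ω γ) :
    ∃ V : ℂ → ℂ, ContDiff ℝ ∞ V ∧ ∃ c > 0, ∃ ε₀ > 0, ∀ z ∈ closure Ω, ∀ ε ∈ Ioo 0 ε₀,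
      Metric.ball (z + (ε : ℝ) * V z) (c * ε) ⊆ Ω := by
  classical
  -- the interior cones are convex and locally admit constant selections, so that a partition of
  -- unity gives a smooth selection
  obtain ⟨V, hV⟩ := exists_contMDiffMap_forall_mem_convex_of_local_const (n := ⊤)
    (modelWithCornersSelf ℝ ℂ) (M := ℂ) (F := ℂ)
    (t := fun x => if x ∈ closure Ω then inwardCone Ω x else univ)
    (fun x => by
      split_ifs
      · exact convex_inwardCone Ω x
      · exact convex_univ)
    (fun x => by
      have key : ∀ v ∈ inwardCone Ω x,
          ∀ᶠ y in 𝓝 x, v ∈ (if y ∈ closure Ω then inwardCone Ω y else univ) := fun v hv => by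
        filter_upwards [eventually_nhdsWithin_iff.1 (eventually_mem_inwardCone hv)] with y hy
        split_ifs with hy'
        · exact hy hy'
        · trivial
      by_cases hx : x ∈ closure Ω
      · by_cases hxΩ : x ∈ Ω
        · exact ⟨0, key 0 (zero_mem_inwardCone h.isOpen hxΩ)⟩
        · have hf : x ∈ frontier Ω := by
            rw [h.isOpen.frontier_eq]
            exact ⟨hx, hxΩ⟩
          rw [h.frontier_eq] at hf
          obtain ⟨j, t, rfl⟩ := mem_iUnion.1 hf
          exact ⟨_, key _ (h.normal_mem_inwardCone j t)⟩
      · refine ⟨0, ?_⟩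
        filter_upwards [isClosed_closure.isOpen_compl.mem_nhds hx] with y hy
        rw [if_neg hy]
        trivial)
  have hVd : ContDiff ℝ ∞ V := contMDiff_iff_contDiff.1 V.contMDiff
  refine ⟨V, hVd, ?_⟩
  -- `c` and `ε₀` exist locally, so by compactness they exist on the whole closure
  refine h.isCompact_closure.induction_on
    (p := fun S => ∃ c > 0, ∃ ε₀ > 0, ∀ z ∈ S, ∀ ε ∈ Ioo 0 ε₀,
      Metric.ball (z + (ε : ℝ) * V z) (c * ε) ⊆ Ω) ?_ ?_ ?_ ?_
  · exact ⟨1, one_pos, 1, one_pos, fun z hz => hz.elim⟩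
  · rintro S T hST ⟨c, hc, ε₀, hε₀, hT⟩
    exact ⟨c, hc, ε₀, hε₀, fun z hz => hT z (hST hz)⟩
  · rintro S T ⟨c, hc, ε₀, hε₀, hS⟩ ⟨c', hc', ε₀', hε₀', hT⟩
    refine ⟨min c c', lt_min hc hc', min ε₀ ε₀', lt_min hε₀ hε₀', ?_⟩
    rintro z (hz | hz) ε ⟨hε, hε'⟩
    · refine (Metric.ball_subset_ball ?_).trans (hS z hz ε ⟨hε, hε'.trans_le (min_le_left _ _)⟩)
      exact mul_le_mul_of_nonneg_right (min_le_left _ _) hε.le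
    · refine (Metric.ball_subset_ball ?_).trans (hT z hz ε ⟨hε, hε'.trans_le (min_le_right _ _)⟩)
      exact mul_le_mul_of_nonneg_right (min_le_right _ _) hε.le
  · intro p hp
    have hc : V p ∈ inwardCone Ω p := by
      have := hV p
      rwa [if_pos hp] at this
    obtain ⟨A, hA, B, hB, hAB⟩ := eventually_prod_iff.1 hc
    obtain ⟨B₁, hB₁, B₂, hB₂, hB₁₂⟩ := eventually_prod_iff.1 hB
    obtain ⟨r, hr, hrB⟩ := Metric.eventually_nhds_iff.1 hB₁
    obtain ⟨ε₀, hε₀, hε₀B⟩ := mem_nhdsGT_iff_exists_Ioo_subset.1 hB₂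
    have hVc : ∀ᶠ z in 𝓝[closure Ω] p, dist (V z) (V p) < r / 2 :=
      nhdsWithin_le_nhds ((hVd.continuous.tendsto p).eventually
        (Metric.ball_mem_nhds _ (by positivity)))
    refine ⟨_, hA.and hVc, r / 2, by positivity, ε₀, hε₀, ?_⟩
    rintro z ⟨hzA, hzV⟩ ε hε y hy
    have hε0 : (ε : ℂ) ≠ 0 := by exact_mod_cast hε.1.ne'
    have h1 : dist ((y - z) / ε) (V p) < r := by
      have h2 : dist ((y - z) / ε) (V z) < r / 2 := by
        have h3 : (y - z) / ε - V z = (y - (z + ε * V z)) / ε := by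
          field_simp
          ring
        rw [dist_eq_norm, h3, norm_div, Complex.norm_real, Real.norm_of_nonneg hε.1.le,
          div_lt_iff₀ hε.1, ← dist_eq_norm]
        exact hy
      linarith [dist_triangle ((y - z) / ε) (V z) (V p)]
    have h4 := hAB hzA (hB₁₂ (hrB h1) (hε₀B hε))
    simp only at h4
    rwa [mul_div_cancel₀ _ hε0, add_sub_cancel] at h4

end Geometry

/-! ### Stokes' theorem near the boundary -/

section Stokes

variable {Ω : Set ℂ} {d : ℕ} {γ : Fin d → ℝ → ℂ}

/-- Stokes' theorem `∮ F dζ = 2i ∬ ∂F/∂ζ̄ dA` for `F = f ψ` in the chart along a boundary curve.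
It is the divergence theorem on a rectangle. -/
theorem integral_boundaryChart {f ψ : ℂ → ℂ} (hf : ContinuousOn f (closure Ω))
    (hfd : DifferentiableOn ℂ f Ω) (hψ : ContDiff ℝ ∞ ψ) (hΩ : IsOpen Ω) {γ : ℝ → ℂ}
    (hγ : ContDiff ℝ ∞ γ) {t₀ r : ℝ} (hr : 0 < r)
    (hΦ : ∀ t ∈ Icc (t₀ - r) (t₀ + r), ∀ s ∈ Ioc 0 r, boundaryChart γ t₀ ⟨t, s⟩ ∈ Ω)
    (hγΩ : ∀ t, γ t ∈ closure Ω)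
    (hl : ∀ s ∈ Icc 0 r, ψ (boundaryChart γ t₀ ⟨t₀ - r, s⟩) = 0)
    (hR : ∀ s ∈ Icc 0 r, ψ (boundaryChart γ t₀ ⟨t₀ + r, s⟩) = 0)
    (hu : ∀ t ∈ Icc (t₀ - r) (t₀ + r), ψ (boundaryChart γ t₀ ⟨t, r⟩) = 0) :
    2 * Complex.I * ∫ p in Ioo (t₀ - r) (t₀ + r) ×ˢ Ioo 0 r,
        (boundaryChartDeriv γ t₀ ⟨p.1, p.2⟩).det •
          (f (boundaryChart γ t₀ ⟨p.1, p.2⟩) * dbar ψ (boundaryChart γ t₀ ⟨p.1, p.2⟩)) =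
      ∫ t in (t₀ - r)..(t₀ + r), f (γ t) * ψ (γ t) * deriv γ t := by
  set n := Complex.I * deriv γ t₀ with hn
  set Θ : ℝ × ℝ → ℂ := fun p => γ p.1 + p.2 * n with hΘ
  have hΘe : ∀ t s : ℝ, boundaryChart γ t₀ ⟨t, s⟩ = Θ (t, s) := fun t s => rfl
  simp only [hΘe] at *
  have hdet : ∀ p : ℝ × ℝ, (boundaryChartDeriv γ t₀ ⟨p.1, p.2⟩).det =
      ((starRingEnd ℂ) (deriv γ p.1) * n).im := fun p => det_boundaryChartDeriv γ t₀ _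
  simp only [hdet, Prod.mk.eta]
  have hγ' : ContDiff ℝ ∞ (deriv γ) := hγ.iterate_deriv 1
  have hΘc : Continuous Θ := by
    have := hγ.continuous
    fun_prop
  have hle : t₀ - r ≤ t₀ + r := by linarith
  have hmaps : MapsTo Θ (Icc (t₀ - r) (t₀ + r) ×ˢ Icc 0 r) (closure Ω) := by
    rintro ⟨t, s⟩ ⟨ht, hs⟩
    rcases hs.1.eq_or_lt with h0 | h0
    · have : Θ (t, s) = γ t := by
        simp only at h0
        simp [hΘ, ← h0]
      rw [this]
      exact hγΩ t
    · exact subset_closure (hΦ t ht s ⟨h0, hs.2⟩)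
  set F : ℂ → ℂ := fun z => f z * ψ z with hF
  have hFd : ∀ z ∈ Ω, DifferentiableAt ℝ F z := fun z hz =>
    ((hfd.differentiableAt (hΩ.mem_nhds hz)).restrictScalars ℝ).mul
      (hψ.differentiable (by simp) z)
  have hFc : ContinuousOn (fun p => F (Θ p)) (Icc (t₀ - r) (t₀ + r) ×ˢ Icc 0 r) :=
    (hf.comp hΘc.continuousOn hmaps).mul (hψ.continuous.comp hΘc).continuousOn
  set DΘ : ℝ × ℝ → ℝ × ℝ →L[ℝ] ℂ := fun p =>
    (ContinuousLinearMap.fst ℝ ℝ ℝ).smulRight (deriv γ p.1) +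
      (ContinuousLinearMap.snd ℝ ℝ ℝ).smulRight n with hDΘ
  have hΘd : ∀ p, HasFDerivAt Θ (DΘ p) p := fun p => by
    have h1 : HasFDerivAt (fun p : ℝ × ℝ => γ p.1)
        ((ContinuousLinearMap.fst ℝ ℝ ℝ).smulRight (deriv γ p.1)) p := by
      have h2 : HasDerivAt γ (deriv γ p.1) p.1 := (hγ.differentiable (by simp) p.1).hasDerivAt
      refine (h2.hasFDerivAt.comp p (hasFDerivAt_fst (𝕜 := ℝ) (p := p))).congr_fderiv ?_
      ext <;> simp
    have h3 : HasFDerivAt (fun p : ℝ × ℝ => (p.2 : ℂ) * n)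
        ((ContinuousLinearMap.snd ℝ ℝ ℝ).smulRight n) p := by
      refine ((ContinuousLinearMap.snd ℝ ℝ ℝ).smulRight n).hasFDerivAt.congr_of_eventuallyEq
        (Eventually.of_forall fun q => ?_)
      simp
    exact h1.add h3
  -- the derivatives of the two components `-n F(Θ)` and `γ' F(Θ)` of the field to which the
  -- divergence theorem is applied
  set f' : ℝ × ℝ → ℝ × ℝ →L[ℝ] ℂ := fun p =>
    -((ContinuousLinearMap.mul ℝ ℂ n).comp ((fderiv ℝ F (Θ p)).comp (DΘ p))) with hf'
  set g₂ : ℝ × ℝ → ℝ × ℝ →L[ℝ] ℂ := fun p =>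
    (ContinuousLinearMap.fst ℝ ℝ ℝ).smulRight (deriv (deriv γ) p.1) with hg₂
  set g' : ℝ × ℝ → ℝ × ℝ →L[ℝ] ℂ := fun p =>
    F (Θ p) • g₂ p + deriv γ p.1 • ((fderiv ℝ F (Θ p)).comp (DΘ p)) with hg'
  have hsubΩ : ∀ p ∈ Ioo (t₀ - r) (t₀ + r) ×ˢ Ioo 0 r, Θ p ∈ Ω := fun p hp =>
    hΦ p.1 (Ioo_subset_Icc_self hp.1) p.2 (Ioo_subset_Ioc_self hp.2)
  -- the divergence is a multiple of `∂F/∂ζ̄`, as the complex linear part of the derivative of `F`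
  -- cancels out
  have hdiv : ∀ p ∈ Ioo (t₀ - r) (t₀ + r) ×ˢ Ioo 0 r, f' p (1, 0) + g' p (0, 1) =
      -(2 * Complex.I) * (((starRingEnd ℂ) (deriv γ p.1) * n).im • (f (Θ p) * dbar ψ (Θ p))) := by
    intro p hp
    have h1 : dbar F (Θ p) = f (Θ p) * dbar ψ (Θ p) := by
      have hd := hfd.differentiableAt (hΩ.mem_nhds (hsubΩ p hp))
      rw [hF, dbar_mul (hd.restrictScalars ℝ) (hψ.differentiable (by simp) _), hd.dbar_eq_zero,
        mul_zero, add_zero]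
    have hlin : ∀ (T : ℂ →L[ℝ] ℂ) (v : ℂ), T v = v.re * T 1 + v.im * T Complex.I := fun T v => by
      conv_lhs => rw [show v = v.re • (1 : ℂ) + v.im • Complex.I by simp [Complex.re_add_im]]
      rw [map_add, map_smul, map_smul, Complex.real_smul, Complex.real_smul]
    have e1 : f' p (1, 0) = -(n * fderiv ℝ F (Θ p) (deriv γ p.1)) := by
      simp [hf', hDΘ]
    have e2 : g' p (0, 1) = deriv γ p.1 * fderiv ℝ F (Θ p) n := by
      simp [hg', hg₂, hDΘ]
    rw [e1, e2, ← h1, dbar, hlin _ (deriv γ p.1), hlin _ n]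
    generalize fderiv ℝ F (Θ p) 1 = X
    generalize fderiv ℝ F (Θ p) Complex.I = Y
    generalize deriv γ p.1 = g
    generalize n = n
    rw [Complex.mul_im, Complex.conj_re, Complex.conj_im, Complex.real_smul]
    conv_lhs => rw [← Complex.re_add_im g, ← Complex.re_add_im n]
    push_cast
    simp only [Complex.add_re, Complex.add_im, Complex.ofReal_re, Complex.ofReal_im,
      Complex.mul_re, Complex.mul_im, Complex.I_re, Complex.I_im, mul_zero, mul_one,
      add_zero, zero_add, sub_self]
    linear_combination (Y * ((g.re : ℂ) * n.im - g.im * n.re)) * Complex.I_mul_I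
  have hcontdiv : ContinuousOn (fun p : ℝ × ℝ => -(2 * Complex.I) *
      (((starRingEnd ℂ) (deriv γ p.1) * n).im • (f (Θ p) * dbar ψ (Θ p))))
      (Icc (t₀ - r) (t₀ + r) ×ˢ Icc 0 r) := by
    have h1 : ContinuousOn (fun p => f (Θ p)) (Icc (t₀ - r) (t₀ + r) ×ˢ Icc 0 r) :=
      hf.comp hΘc.continuousOn hmaps
    have h2 : Continuous fun p => dbar ψ (Θ p) := hψ.dbar.continuous.comp hΘc
    have h3 : Continuous fun p : ℝ × ℝ => ((starRingEnd ℂ) (deriv γ p.1) * n).im :=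
      Complex.continuous_im.comp ((Complex.continuous_conj.comp
        (hγ'.continuous.comp continuous_fst)).mul continuous_const)
    exact continuousOn_const.mul (h3.continuousOn.smul (h1.mul h2.continuousOn))
  have hae : (Icc (t₀ - r) (t₀ + r) ×ˢ Icc 0 r : Set (ℝ × ℝ)) =ᵐ[volume]
      (Ioo (t₀ - r) (t₀ + r) ×ˢ Ioo 0 r : Set (ℝ × ℝ)) :=
    Measure.set_prod_ae_eq Ioo_ae_eq_Icc.symm Ioo_ae_eq_Icc.symm
  have hmeas : MeasurableSet (Ioo (t₀ - r) (t₀ + r) ×ˢ Ioo 0 r : Set (ℝ × ℝ)) :=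
    measurableSet_Ioo.prod measurableSet_Ioo
  have hint : IntegrableOn (fun p => f' p (1, 0) + g' p (0, 1))
      (Ioo (t₀ - r) (t₀ + r) ×ˢ Ioo 0 r) := by
    refine IntegrableOn.congr_fun ?_ (fun p hp => (hdiv p hp).symm) hmeas
    exact (hcontdiv.integrableOn_compact (isCompact_Icc.prod isCompact_Icc)).congr_set_ae hae.symm
  have hgreen := integral2_divergence_prod_of_hasFDerivAt_off_countable
    (fun p => -(n * F (Θ p))) (fun p => F (Θ p) * deriv γ p.1) f' g' (t₀ - r) 0 (t₀ + r) r ∅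
    countable_empty
  simp only [uIcc_of_le hle, uIcc_of_le hr.le, min_eq_left hle, max_eq_right hle,
    min_eq_left hr.le, max_eq_right hr.le, sdiff_empty] at hgreen
  specialize hgreen (continuousOn_const.mul hFc).neg
    (hFc.mul (hγ'.continuous.comp continuous_fst).continuousOn) ?_ ?_ ?_
  · intro p hp
    have h1 : HasFDerivAt (fun p => F (Θ p)) ((fderiv ℝ F (Θ p)).comp (DΘ p)) p :=
      (hFd _ (hsubΩ p hp)).hasFDerivAt.comp p (hΘd p)
    exact ((ContinuousLinearMap.mul ℝ ℂ n).hasFDerivAt.comp p h1).neg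
  · intro p hp
    have h1 : HasFDerivAt (fun p => F (Θ p)) ((fderiv ℝ F (Θ p)).comp (DΘ p)) p :=
      (hFd _ (hsubΩ p hp)).hasFDerivAt.comp p (hΘd p)
    have h2 : HasFDerivAt (fun p : ℝ × ℝ => deriv γ p.1) (g₂ p) p := by
      have h3 : HasDerivAt (deriv γ) (deriv (deriv γ) p.1) p.1 :=
        (hγ'.differentiable (by simp) p.1).hasDerivAt
      refine (h3.hasFDerivAt.comp p (hasFDerivAt_fst (𝕜 := ℝ) (p := p))).congr_fderiv ?_
      ext <;> simp [hg₂]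
    exact h1.mul h2
  · exact hint.congr_set_ae hae
  have hF0 : ∀ z, ψ z = 0 → F z = 0 := fun z hz => by rw [hF]; simp [hz]
  -- three sides of the rectangle contribute nothing, as `ψ` vanishes there
  have z1 : ∫ x in (t₀ - r)..(t₀ + r), F (Θ (x, r)) * deriv γ x = 0 := by
    rw [intervalIntegral.integral_congr (g := fun _ => 0)]
    · simp
    · intro x hx
      rw [uIcc_of_le hle] at hx
      simp [hF0 _ (hu x hx)]
  have z2 : ∫ y in (0 : ℝ)..r, -(n * F (Θ (t₀ + r, y))) = 0 := by
    rw [intervalIntegral.integral_congr (g := fun _ => 0)]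
    · simp
    · intro y hy
      rw [uIcc_of_le hr.le] at hy
      simp [hF0 _ (hR y hy)]
  have z3 : ∫ y in (0 : ℝ)..r, -(n * F (Θ (t₀ - r, y))) = 0 := by
    rw [intervalIntegral.integral_congr (g := fun _ => 0)]
    · simp
    · intro y hy
      rw [uIcc_of_le hr.le] at hy
      simp [hF0 _ (hl y hy)]
  rw [z1, z2, z3] at hgreen
  have hset : ∫ x in (t₀ - r)..(t₀ + r), ∫ y in (0 : ℝ)..r, f' (x, y) (1, 0) + g' (x, y) (0, 1) =
      ∫ p in Ioo (t₀ - r) (t₀ + r) ×ˢ Ioo 0 r, (f' p (1, 0) + g' p (0, 1)) := by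
    rw [Measure.volume_eq_prod, setIntegral_prod _ (by rwa [← Measure.volume_eq_prod]),
      intervalIntegral.integral_of_le hle, integral_Ioc_eq_integral_Ioo]
    refine setIntegral_congr_fun measurableSet_Ioo fun x _ => ?_
    rw [intervalIntegral.integral_of_le hr.le, integral_Ioc_eq_integral_Ioo]
  rw [hset, setIntegral_congr_fun hmeas hdiv, integral_const_mul] at hgreen
  have hbase : ∀ x, Θ (x, 0) = γ x := fun x => by simp [hΘ]
  simp only [hbase] at hgreen
  simp only [zero_sub, add_zero, sub_zero, neg_mul, neg_inj] at hgreen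
  exact hgreen

end Stokes

section StokesGlobal

variable {Ω : Set ℂ} {d : ℕ} {γ : Fin d → ℝ → ℂ}

theorem IsSmoothlyBoundedBy.mem_closure (h : IsSmoothlyBoundedBy Ω γ) (j : Fin d) (t : ℝ) :
    γ j t ∈ closure Ω := frontier_subset_closure (h.mem_frontier j t)

theorem IsSmoothlyBoundedBy.continuous_comp {E : Type*} [TopologicalSpace E]
    (h : IsSmoothlyBoundedBy Ω γ) {f : ℂ → E} (hf : ContinuousOn f (closure Ω)) (j : Fin d) :
    Continuous fun t => f (γ j t) :=
  hf.comp_continuous (h.continuous j) (h.mem_closure j)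

/-- The integral of `|f ψ|` over the boundary with respect to arc length. -/
noncomputable def boundaryNorm (γ : Fin d → ℝ → ℂ) (f ψ : ℂ → ℂ) : ℝ :=
  ∑ i, ∫ t in (0 : ℝ)..1, ‖f (γ i t)‖ * ‖ψ (γ i t)‖ * ‖deriv (γ i) t‖

theorem IsSmoothlyBoundedBy.continuous_boundaryNorm (h : IsSmoothlyBoundedBy Ω γ) {f ψ : ℂ → ℂ}
    (hf : ContinuousOn f (closure Ω)) (hψ : Continuous ψ) (i : Fin d) :
    Continuous fun t => ‖f (γ i t)‖ * ‖ψ (γ i t)‖ * ‖deriv (γ i) t‖ := by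
  have h1 := h.continuous_comp hf i
  have h2 := h.continuous i
  exact (h1.norm.mul (hψ.comp h2).norm).mul (h.continuous_deriv i).norm

theorem boundaryNorm_nonneg (f ψ : ℂ → ℂ) : 0 ≤ boundaryNorm γ f ψ :=
  Finset.sum_nonneg fun _ _ => intervalIntegral.integral_nonneg zero_le_one fun _ _ => by positivity

/-- A boundary point has a neighbourhood such that the Stokes inequality holds for the test
functions supported in it. -/
theorem IsSmoothlyBoundedBy.exists_local_stokes (h : IsSmoothlyBoundedBy Ω γ) (j : Fin d) (t₀ : ℝ) :
    ∃ U, IsOpen U ∧ γ j t₀ ∈ U ∧ ∀ f ψ : ℂ → ℂ, ContinuousOn f (closure Ω) →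
      DifferentiableOn ℂ f Ω → ContDiff ℝ ∞ ψ → tsupport ψ ⊆ U →
      ‖∫ z in Ω, f z * dbar ψ z‖ ≤ boundaryNorm γ f ψ := by
  set Φ := boundaryChart (γ j) t₀ with hΦdef
  have hg : deriv (γ j) t₀ ≠ 0 := h.deriv_ne_zero j t₀
  obtain ⟨L, hL⟩ : ∃ L : ℂ ≃L[ℝ] ℂ, HasStrictFDerivAt Φ (L : ℂ →L[ℝ] ℂ) t₀ := by
    refine ⟨(ContinuousLinearEquiv.unitsEquivAut ℂ (Units.mk0 _ hg)).restrictScalars ℝ,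
      (boundaryChart_hasStrictFDerivAt (h.contDiff j) t₀ t₀).congr_fderiv ?_⟩
    ext v
    simp [boundaryChartDeriv_center, mul_comm]
  set e := hL.toOpenPartialHomeomorph Φ
  obtain ⟨r, hr, hr2, hrW, hinj, hrΩ, hdet⟩ := h.exists_chart j t₀
    (e.open_source.mem_nhds hL.mem_toOpenPartialHomeomorph_source)
  set B : Set ℂ := Ioo (t₀ - r) (t₀ + r) ×ℂ Ioo (-r) r with hB
  have hBbox : B ⊆ chartBox t₀ r := fun z hz =>
    ⟨Ioo_subset_Icc_self hz.1, Ioo_subset_Icc_self hz.2⟩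
  have hBo : IsOpen B := isOpen_Ioo.reProdIm isOpen_Ioo
  have hUo : IsOpen (Φ '' B) := e.isOpen_image_of_subset_source hBo (hBbox.trans hrW)
  refine ⟨Φ '' B, hUo, ⟨t₀, ⟨by simp [hr], by simp [hr]⟩, boundaryChart_ofReal _ _ _⟩, ?_⟩
  intro f ψ hf hfd hψ hsupp
  -- `ψ ∘ Φ` vanishes on the boundary of the square
  have hψ0 : ∀ z ∈ chartBox t₀ r, z ∉ B → ψ (Φ z) = 0 := fun z hz hzB => by
    by_contra h0
    obtain ⟨y, hy, hyz⟩ := hsupp (subset_tsupport _ h0)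
    exact hzB (hinj (hBbox hy) hz hyz ▸ hy)
  have hgreen := integral_boundaryChart (f := f) (ψ := ψ) hf hfd hψ h.isOpen (h.contDiff j)
    (t₀ := t₀) hr
    (fun t ht s hs => (hrΩ ⟨t, s⟩ ⟨ht, ⟨by linarith [hs.1], hs.2⟩⟩).2 hs.1)
    (h.mem_closure j)
    (fun s hs => hψ0 _ ⟨⟨le_rfl, by linarith⟩, ⟨by linarith [hs.1], hs.2⟩⟩
      fun hB => lt_irrefl _ hB.1.1)
    (fun s hs => hψ0 _ ⟨⟨by linarith, le_rfl⟩, ⟨by linarith [hs.1], hs.2⟩⟩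
      fun hB => lt_irrefl _ hB.1.2)
    (fun t ht => hψ0 _ ⟨ht, ⟨by linarith, le_rfl⟩⟩ fun hB => lt_irrefl _ hB.2.2)
  -- the integral over `Ω` in terms of the chart
  set Q : Set (ℝ × ℝ) := Ioo (t₀ - r) (t₀ + r) ×ˢ Ioo 0 r with hQ
  set P : Set ℂ := Ioo (t₀ - r) (t₀ + r) ×ℂ Ioo 0 r with hP
  have hPB : P ⊆ B := fun z hz => ⟨hz.1, ⟨by linarith [hz.2.1], hz.2.2⟩⟩
  have hPm : MeasurableSet P := (isOpen_Ioo.reProdIm isOpen_Ioo).measurableSet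
  have hPΩ : Φ '' P ⊆ Ω := by
    rintro _ ⟨z, hz, rfl⟩
    exact (hrΩ z (hBbox (hPB hz))).2 hz.2.1
  have hcov : ∫ z in Ω, f z * dbar ψ z = ∫ p in Q,
      (boundaryChartDeriv (γ j) t₀ ⟨p.1, p.2⟩).det •
        (f (boundaryChart (γ j) t₀ ⟨p.1, p.2⟩) * dbar ψ (boundaryChart (γ j) t₀ ⟨p.1, p.2⟩)) := by
    rw [setIntegral_eq_of_subset_of_forall_sdiff_eq_zero h.isOpen.measurableSet hPΩ]
    · rw [integral_image_eq_integral_abs_det_fderiv_smul volume hPm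
        (fun z _ =>
          (boundaryChart_hasStrictFDerivAt (h.contDiff j) t₀ z).hasFDerivAt.hasFDerivWithinAt)
        (hinj.mono (hPB.trans hBbox))]
      rw [← (Complex.volume_preserving_equiv_real_prod).setIntegral_preimage_emb
        Complex.measurableEquivRealProd.measurableEmbedding]
      refine setIntegral_congr_fun hPm fun z hz => ?_
      have := hdet z (hBbox (hPB hz))
      simp only [abs_of_pos this]
      rfl
    · rintro z ⟨hz, hzP⟩
      by_contra h0
      obtain ⟨y, hy, rfl⟩ := hsupp (tsupport_dbar_subset ψ (subset_tsupport _
        (right_ne_zero_of_mul h0)))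
      exact hzP ⟨y, ⟨hy.1, ⟨(hrΩ y (hBbox hy)).1 hz, hy.2.2⟩⟩, rfl⟩
  rw [← hcov] at hgreen
  have hcont := h.continuous_boundaryNorm hf hψ.continuous j
  have hper : Function.Periodic (fun t => ‖f (γ j t)‖ * ‖ψ (γ j t)‖ * ‖deriv (γ j) t‖) 1 :=
    fun t => by
      have h1 : deriv (γ j) (t + 1) = deriv (γ j) t := by
        rw [← deriv_comp_add_const]
        congr 1
        ext s
        exact h.periodic j s
      simp only [h.periodic j t, h1]
  -- the arc `(t₀ - r, t₀ + r)` is part of one period of the curve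
  calc ‖∫ z in Ω, f z * dbar ψ z‖ ≤ ‖2 * Complex.I * ∫ z in Ω, f z * dbar ψ z‖ := by
        rw [norm_mul]
        refine le_mul_of_one_le_left (norm_nonneg _) ?_
        simp
    _ = ‖∫ t in (t₀ - r)..(t₀ + r), f (γ j t) * ψ (γ j t) * deriv (γ j) t‖ := by rw [hgreen]
    _ ≤ ∫ t in (t₀ - r)..(t₀ + r), ‖f (γ j t)‖ * ‖ψ (γ j t)‖ * ‖deriv (γ j) t‖ := by
        refine (intervalIntegral.norm_integral_le_integral_norm (by linarith)).trans_eq ?_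
        simp only [norm_mul]
    _ ≤ ∫ t in (t₀ - 1 / 2)..(t₀ - 1 / 2 + 1), ‖f (γ j t)‖ * ‖ψ (γ j t)‖ * ‖deriv (γ j) t‖ := by
        refine intervalIntegral.integral_mono_interval (by linarith) (by linarith) (by linarith)
          (ae_of_all _ fun t => by positivity) (hcont.intervalIntegrable _ _)
    _ = ∫ t in (0 : ℝ)..1, ‖f (γ j t)‖ * ‖ψ (γ j t)‖ * ‖deriv (γ j) t‖ := by
        rw [hper.intervalIntegral_add_eq (t₀ - 1 / 2) 0, zero_add]
    _ ≤ boundaryNorm γ f ψ :=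
        Finset.single_le_sum (f := fun i => ∫ t in (0 : ℝ)..1,
          ‖f (γ i t)‖ * ‖ψ (γ i t)‖ * ‖deriv (γ i) t‖)
          (fun i _ => intervalIntegral.integral_nonneg zero_le_one fun _ _ => by positivity)
          (Finset.mem_univ j)

/-! ### The Cauchy–Pompeiu formula and the Stokes inequality on the domain -/

theorem contDiff_mul_of_tsupport_subset {W : Set ℂ} (hW : IsOpen W) {f θ : ℂ → ℂ}
    (hf : ContDiffOn ℝ ∞ f W) (hθ : ContDiff ℝ ∞ θ) (hsupp : tsupport θ ⊆ W) :
    ContDiff ℝ ∞ fun z => f z * θ z := by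
  rw [contDiff_iff_contDiffAt]
  intro z
  by_cases hz : z ∈ W
  · exact (hf.contDiffAt (hW.mem_nhds hz)).mul hθ.contDiffAt
  · have h1 : (fun z => f z * θ z) =ᶠ[𝓝 z] fun _ => 0 := by
      filter_upwards [notMem_tsupport_iff_eventuallyEq.1 fun h => hz (hsupp h)] with y hy
      simp [hy]
    exact contDiffAt_const.congr_of_eventuallyEq h1

theorem DifferentiableOn.contDiffOn_real (hΩ : IsOpen Ω) {f : ℂ → ℂ}
    (hf : DifferentiableOn ℂ f Ω) : ContDiffOn ℝ ∞ f Ω := fun _ hz =>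
  (((hf.analyticAt (hΩ.mem_nhds hz)).contDiffAt.restrict_scalars ℝ)).contDiffWithinAt

theorem dbar_mul_of_tsupport_subset (hΩ : IsOpen Ω) {f θ : ℂ → ℂ}
    (hf : DifferentiableOn ℂ f Ω) (hθ : ContDiff ℝ ∞ θ) (hsupp : tsupport θ ⊆ Ω) (z : ℂ) :
    dbar (fun z => f z * θ z) z = f z * dbar θ z := by
  by_cases hz : z ∈ Ω
  · have hd := hf.differentiableAt (hΩ.mem_nhds hz)
    rw [dbar_mul (hd.restrictScalars ℝ) (hθ.differentiable (by simp) z), hd.dbar_eq_zero, mul_zero,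
      add_zero]
  · have h0 : θ =ᶠ[𝓝 z] fun _ => 0 := notMem_tsupport_iff_eventuallyEq.1 fun h => hz (hsupp h)
    have h1 : (fun z => f z * θ z) =ᶠ[𝓝 z] fun _ => 0 := by
      filter_upwards [h0] with y hy
      simp [hy]
    rw [h1.dbar_eq, h0.dbar_eq]
    simp [dbar]

/-- The Cauchy–Pompeiu formula for `f θ` with `f` holomorphic on `Ω` and `θ` a test function
on `Ω`. -/
theorem setIntegral_mul_dbar_div (hΩ : IsOpen Ω) {f θ : ℂ → ℂ} (hf : DifferentiableOn ℂ f Ω)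
    (hθ : ContDiff ℝ ∞ θ) (hc : HasCompactSupport θ) (hsupp : tsupport θ ⊆ Ω) (w : ℂ) :
    ∫ z in Ω, f z * dbar θ z / (z - w) = -Real.pi * (f w * θ w) := by
  have h0 : ∫ z in Ω, f z * dbar θ z / (z - w) = ∫ z, f z * dbar θ z / (z - w) := by
    refine setIntegral_eq_integral_of_forall_compl_eq_zero fun z hz => ?_
    have : dbar θ z = 0 := by
      by_contra h
      exact hz (hsupp (tsupport_dbar_subset θ (subset_tsupport _ h)))
    simp [this]
  have hF := contDiff_mul_of_tsupport_subset hΩ (hf.contDiffOn_real hΩ) hθ hsupp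
  have hFc : HasCompactSupport fun z => f z * θ z := hc.mul_left
  have h1 := integral_dbar_div (F := fun z => f (z + w) * θ (z + w))
    ((hF.of_le (by exact_mod_cast le_top)).comp (contDiff_id.add contDiff_const))
    (hFc.comp_homeomorph (Homeomorph.addRight w))
  rw [zero_add] at h1
  rw [h0, ← h1, ← integral_add_right_eq_self _ w]
  congr 1
  ext z
  have h2 : dbar (fun z => f (z + w) * θ (z + w)) z = dbar (fun z => f z * θ z) (z + w) := by
    simp only [dbar]
    rw [fderiv_comp_add_right (f := fun z => f z * θ z) w]
  rw [h2, dbar_mul_of_tsupport_subset hΩ hf hθ hsupp, add_sub_cancel_right]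

theorem setIntegral_mul_dbar_eq_zero (hΩ : IsOpen Ω) {f θ : ℂ → ℂ} (hf : DifferentiableOn ℂ f Ω)
    (hθ : ContDiff ℝ ∞ θ) (hc : HasCompactSupport θ) (hsupp : tsupport θ ⊆ Ω) :
    ∫ z in Ω, f z * dbar θ z = 0 := by
  -- the Cauchy–Pompeiu formula for `z f`, at the point `0`
  have h1 := setIntegral_mul_dbar_div hΩ (f := fun z => z * f z) (differentiableOn_id.mul hf) hθ hc
    hsupp 0
  rw [zero_mul, zero_mul, mul_zero] at h1
  rw [← h1]
  refine integral_congr_ae ?_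
  have h2 : ∀ᵐ z : ℂ ∂volume.restrict Ω, z ≠ 0 :=
    ae_restrict_of_ae (measure_eq_zero_iff_ae_notMem.1 (measure_singleton (0 : ℂ)))
  filter_upwards [h2] with z hz
  rw [sub_zero]
  field_simp

theorem dbar_sum {ι : Type*} (s : Finset ι) {g : ι → ℂ → ℂ} {z : ℂ}
    (hg : ∀ i ∈ s, DifferentiableAt ℝ (g i) z) :
    dbar (fun ζ => ∑ i ∈ s, g i ζ) z = ∑ i ∈ s, dbar (g i) z := by
  simp only [dbar]
  rw [fderiv_fun_sum hg, sum_apply, sum_apply, Finset.mul_sum, ← Finset.sum_add_distrib,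
    Finset.sum_div]

/-- The Stokes inequality: for `f` holomorphic on `Ω` and continuous on its closure, `∬ f ∂ψ/∂z̄`
is bounded by the integral of `|f ψ|` over the boundary. -/
theorem IsSmoothlyBoundedBy.norm_setIntegral_mul_dbar_le (h : IsSmoothlyBoundedBy Ω γ)
    {f ψ : ℂ → ℂ} (hf : ContinuousOn f (closure Ω)) (hfd : DifferentiableOn ℂ f Ω)
    (hψ : ContDiff ℝ ∞ ψ) (hc : HasCompactSupport ψ) :
    ‖∫ z in Ω, f z * dbar ψ z‖ ≤ boundaryNorm γ f ψ := by
  -- the inequality holds for test functions supported near any given point of the plane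
  have hloc : ∀ p : ℂ, ∃ U, IsOpen U ∧ p ∈ U ∧ ∀ θ : ℂ → ℂ, ContDiff ℝ ∞ θ → HasCompactSupport θ →
      tsupport θ ⊆ U → ‖∫ z in Ω, f z * dbar θ z‖ ≤ boundaryNorm γ f θ := by
    intro p
    by_cases hp : p ∈ Ω
    · refine ⟨Ω, h.isOpen, hp, fun θ hθ hθc hs => ?_⟩
      rw [setIntegral_mul_dbar_eq_zero h.isOpen hfd hθ hθc hs, norm_zero]
      exact boundaryNorm_nonneg _ _
    by_cases hp' : p ∈ closure Ω
    · have hfr : p ∈ frontier Ω := by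
        rw [h.isOpen.frontier_eq]
        exact ⟨hp', hp⟩
      rw [h.frontier_eq] at hfr
      obtain ⟨j, t, rfl⟩ := mem_iUnion.1 hfr
      obtain ⟨U, hU, hpU, hUs⟩ := h.exists_local_stokes j t
      exact ⟨U, hU, hpU, fun θ hθ _ hs => hUs f θ hf hfd hθ hs⟩
    · refine ⟨(closure Ω)ᶜ, isClosed_closure.isOpen_compl, hp', fun θ hθ _ hs => ?_⟩
      rw [setIntegral_eq_zero_of_forall_eq_zero, norm_zero]
      · exact boundaryNorm_nonneg _ _
      · intro z hz
        have : dbar θ z = 0 := by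
          by_contra h0
          exact hs (tsupport_dbar_subset θ (subset_tsupport _ h0)) (subset_closure hz)
        rw [this, mul_zero]
  choose U hUo hUmem hU using hloc
  -- a partition of unity reduces the inequality to these test functions
  obtain ⟨ρ, hρ⟩ := SmoothPartitionOfUnity.exists_isSubordinate (modelWithCornersSelf ℝ ℂ)
    (isClosed_univ (X := ℂ)) U hUo fun p _ => mem_iUnion.2 ⟨p, hUmem p⟩
  have hfin := ρ.locallyFinite.finite_nonempty_inter_compact hc.isCompact
  set s := hfin.toFinset with hs
  have hρd : ∀ i, ContDiff ℝ ∞ fun z => ((ρ i z : ℝ) : ℂ) := fun i =>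
    Complex.ofRealCLM.contDiff.comp (contMDiff_iff_contDiff.1 (ρ i).contMDiff)
  have hsum : ∀ z ∈ tsupport ψ, ∑ i ∈ s, ρ i z = 1 := fun z hz => by
    rw [← ρ.sum_eq_one (mem_univ z), finsum_eq_sum_of_support_subset]
    intro i hi
    rw [hs, Set.Finite.coe_toFinset]
    exact ⟨z, hi, hz⟩
  have hψs : ψ = fun z => ∑ i ∈ s, (ρ i z : ℂ) * ψ z := by
    ext z
    by_cases hz : z ∈ tsupport ψ
    · rw [← Finset.sum_mul, ← Complex.ofReal_sum, hsum z hz, Complex.ofReal_one, one_mul]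
    · simp [image_eq_zero_of_notMem_tsupport hz]
  have hψi : ∀ i, ContDiff ℝ ∞ fun z => (ρ i z : ℂ) * ψ z := fun i => (hρd i).mul hψ
  have hci : ∀ i, HasCompactSupport fun z => (ρ i z : ℂ) * ψ z := fun i => hc.mul_left
  have hdb : ∀ z, dbar ψ z = ∑ i ∈ s, dbar (fun z => (ρ i z : ℂ) * ψ z) z := fun z => by
    conv_lhs => rw [hψs]
    exact dbar_sum s fun i _ => (hψi i).differentiable (by simp) z
  have hint : ∀ i, IntegrableOn (fun z => f z * dbar (fun z => (ρ i z : ℂ) * ψ z) z) Ω := fun i => by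
    refine IntegrableOn.mono_set ?_ subset_closure
    exact (hf.mul (hψi i).dbar.continuous.continuousOn).integrableOn_compact h.isCompact_closure
  have hsplit : ∫ z in Ω, f z * dbar ψ z =
      ∑ i ∈ s, ∫ z in Ω, f z * dbar (fun z => (ρ i z : ℂ) * ψ z) z := by
    rw [← integral_finsetSum s fun i _ => hint i]
    simp only [hdb, Finset.mul_sum]
  rw [hsplit]
  refine (norm_sum_le _ _).trans ((Finset.sum_le_sum fun i _ => hU i _ (hψi i) (hci i) ?_).trans ?_)
  · refine (closure_mono fun z hz => ?_).trans (hρ i)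
    have := left_ne_zero_of_mul hz
    simpa using this
  · simp only [boundaryNorm]
    rw [Finset.sum_comm]
    refine Finset.sum_le_sum fun k _ => ?_
    rw [← intervalIntegral.integral_finsetSum fun i _ =>
      (h.continuous_boundaryNorm hf (hψi i).continuous k).intervalIntegrable _ _]
    refine intervalIntegral.integral_mono_on zero_le_one
      (Continuous.intervalIntegrable (continuous_finsetSum _ fun i _ =>
        h.continuous_boundaryNorm hf (hψi i).continuous k) _ _)
      ((h.continuous_boundaryNorm hf hψ.continuous k).intervalIntegrable _ _) fun t _ => ?_
    have h1 : ∀ i, ‖f (γ k t)‖ * ‖(ρ i (γ k t) : ℂ) * ψ (γ k t)‖ * ‖deriv (γ k) t‖ =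
        ρ i (γ k t) * (‖f (γ k t)‖ * ‖ψ (γ k t)‖ * ‖deriv (γ k) t‖) := fun i => by
      rw [norm_mul, Complex.norm_real, Real.norm_of_nonneg (ρ.nonneg i _)]
      ring
    simp only [h1]
    rw [← Finset.sum_mul]
    refine mul_le_of_le_one_left (by positivity) ?_
    -- the finite sum over `s` is part of the sum of the whole partition, even outside the support
    -- of `ψ`
    refine (ρ.toPartitionOfUnity.sum_le_one (γ k t)).trans' ?_
    have hf' : (Function.support fun i => ρ i (γ k t)).Finite := ρ.locallyFinite.point_finite (γ k t)
    have := finsum_eq_sum_of_support_subset (fun i => ρ i (γ k t)) (s := s ∪ hf'.toFinset)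
      (by intro i hi; exact Finset.mem_coe.2 (Finset.mem_union_right _ (hf'.mem_toFinset.2 hi)))
    exact (Finset.sum_le_sum_of_subset_of_nonneg Finset.subset_union_left
      fun i _ _ => ρ.nonneg i _).trans_eq this.symm

/-- Point evaluations are bounded by the `L¹` norm on the boundary, locally uniformly. -/
theorem IsSmoothlyBoundedBy.exists_norm_le_boundaryNorm (h : IsSmoothlyBoundedBy Ω γ) {a : ℂ}
    (ha : a ∈ Ω) : ∃ r > 0, Metric.ball a r ⊆ Ω ∧ ∃ C, ∀ w ∈ Metric.ball a r, ∀ f : ℂ → ℂ,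
      ContinuousOn f (closure Ω) → DifferentiableOn ℂ f Ω →
      ‖f w‖ ≤ C * boundaryNorm γ f fun _ => 1 := by
  obtain ⟨R, hR, hRΩ⟩ := Metric.nhds_basis_closedBall.mem_iff.1 (h.isOpen.mem_nhds ha)
  -- `θ` is `1` near `a` and supported in `Ω`, and `κ` is `1` on `closure Ω`
  let θ₀ : ContDiffBump a := ⟨R / 2, R, by positivity, by linarith⟩
  set θ : ℂ → ℂ := fun z => (θ₀ z : ℂ) with hθ
  have hθd : ContDiff ℝ ∞ θ := Complex.ofRealCLM.contDiff.comp θ₀.contDiff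
  have hθc : HasCompactSupport θ := θ₀.hasCompactSupport.comp_left (g := fun x : ℝ => (x : ℂ)) rfl
  have hθs : tsupport θ ⊆ Ω := by
    refine Subset.trans (closure_mono fun z hz => ?_) (θ₀.tsupport_eq.trans_subset hRΩ)
    simpa [hθ] using hz
  have hθ1 : ∀ z ∈ Metric.closedBall a (R / 2), θ z = 1 := fun z hz => by
    simp only [hθ, θ₀.one_of_mem_closedBall hz, Complex.ofReal_one]
  obtain ⟨R', hR', hΩR'⟩ := h.isBounded.closure.subset_closedBall_lt 0 a
  let κ₀ : ContDiffBump a := ⟨R', R' + 1, hR', by linarith⟩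
  set κ : ℂ → ℂ := fun z => (κ₀ z : ℂ) with hκ
  have hκd : ContDiff ℝ ∞ κ := Complex.ofRealCLM.contDiff.comp κ₀.contDiff
  have hκc : HasCompactSupport κ := κ₀.hasCompactSupport.comp_left (g := fun x : ℝ => (x : ℂ)) rfl
  have hκ1 : ∀ z ∈ closure Ω, κ z = 1 := fun z hz => by
    simp only [hκ, κ₀.one_of_mem_closedBall (hΩR' hz), Complex.ofReal_one]
  refine ⟨R / 4, by positivity,
    (Metric.ball_subset_closedBall.trans (Metric.closedBall_subset_closedBall (by linarith))).trans
      hRΩ, (R / 4)⁻¹, fun w hw f hf hfd => ?_⟩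
  have hwΩ : w ∈ Ω := hRΩ (Metric.closedBall_subset_closedBall (by linarith)
    (Metric.ball_subset_closedBall hw))
  -- on `Ω`, `∂ψ/∂z̄ = -(∂θ/∂z̄) / (z - w)`, so that the Cauchy–Pompeiu formula recovers `f w`,
  -- and on the boundary `ψ = 1 / (z - w)`
  set ψ : ℂ → ℂ := fun z => (κ z - θ z) / (z - w) with hψ
  have hnear : ∀ z ∈ Metric.ball a (R / 2), κ z - θ z = 0 := fun z hz => by
    rw [hθ1 z (Metric.ball_subset_closedBall hz), hκ1 z (subset_closure (hRΩ
      (Metric.closedBall_subset_closedBall (by linarith) (Metric.ball_subset_closedBall hz)))),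
      sub_self]
  have hw2 : w ∈ Metric.ball a (R / 2) := Metric.ball_subset_ball (by linarith) hw
  have hψd : ContDiff ℝ ∞ ψ := by
    rw [contDiff_iff_contDiffAt]
    intro z
    by_cases hz : z = w
    · have : ψ =ᶠ[𝓝 z] fun _ => 0 := by
        filter_upwards [Metric.isOpen_ball.mem_nhds (hz ▸ hw2)] with y hy
        simp [hψ, hnear y hy]
      exact contDiffAt_const.congr_of_eventuallyEq this
    · have h1 : ContDiffAt ℝ ∞ (fun y : ℂ => (y - w)⁻¹) z :=
        (contDiff_id.sub contDiff_const).contDiffAt.inv (sub_ne_zero.2 hz)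
      simp only [hψ, div_eq_mul_inv]
      exact (hκd.sub hθd).contDiffAt.mul h1
  have hψc : HasCompactSupport ψ := by
    have := (hκc.sub hθc).mul_right (f' := fun z => (z - w)⁻¹)
    simp only [hψ, div_eq_mul_inv]
    exact this
  have h1 := setIntegral_mul_dbar_div h.isOpen hfd hθd hθc hθs w
  rw [hθ1 w (Metric.ball_subset_closedBall hw2), mul_one] at h1
  have h2 : ∫ z in Ω, f z * dbar ψ z = Real.pi * f w := by
    rw [← neg_inj, ← integral_neg, ← neg_mul, ← h1]
    refine setIntegral_congr_fun h.isOpen.measurableSet fun z hz => ?_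
    by_cases hzw : z ∈ Metric.ball a (R / 2)
    · have e1 : ψ =ᶠ[𝓝 z] fun _ => 0 := by
        filter_upwards [Metric.isOpen_ball.mem_nhds hzw] with y hy
        simp [hψ, hnear y hy]
      have e2 : θ =ᶠ[𝓝 z] fun _ => 1 := by
        filter_upwards [Metric.isOpen_ball.mem_nhds hzw] with y hy
        exact hθ1 y (Metric.ball_subset_closedBall hy)
      simp only [e1.dbar_eq, e2.dbar_eq]
      simp [dbar]
    · have hzw' : z - w ≠ 0 := sub_ne_zero.2 fun h0 => hzw (h0 ▸ hw2)
      have e1 : ψ =ᶠ[𝓝 z] fun y => (1 - θ y) * (y - w)⁻¹ := by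
        filter_upwards [h.isOpen.mem_nhds hz] with y hy
        simp only [hψ, hκ1 y (subset_closure hy), div_eq_mul_inv]
      have d1 : DifferentiableAt ℂ (fun y => (y - w)⁻¹) z :=
        (differentiableAt_id.sub_const w).inv hzw'
      have dθ : DifferentiableAt ℝ θ z := hθd.differentiable (by simp) z
      simp only [e1.dbar_eq]
      rw [dbar_mul (g := fun y => 1 - θ y) ((differentiableAt_const _).sub dθ)
          (d1.restrictScalars ℝ), d1.dbar_eq_zero,
        dbar_sub (differentiableAt_const _) dθ, (differentiableAt_const (1 : ℂ)).dbar_eq_zero]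
      rw [div_eq_mul_inv]
      ring
  have h3 := h.norm_setIntegral_mul_dbar_le hf hfd hψd hψc
  rw [h2, norm_mul, Complex.norm_real, Real.norm_of_nonneg Real.pi_pos.le] at h3
  refine (le_mul_of_one_le_left (norm_nonneg (f w)) (by linarith [Real.pi_gt_three])).trans
    (h3.trans ?_)
  simp only [boundaryNorm]
  rw [Finset.mul_sum]
  refine Finset.sum_le_sum fun i _ => ?_
  rw [← intervalIntegral.integral_const_mul]
  refine intervalIntegral.integral_mono_on zero_le_one
    ((h.continuous_boundaryNorm hf hψd.continuous i).intervalIntegrable _ _)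
    (((h.continuous_boundaryNorm hf continuous_const i).const_mul _ |>.intervalIntegrable _ _))
    fun t _ => ?_
  have hfr := h.mem_frontier i t
  have hθ0 : θ (γ i t) = 0 := image_eq_zero_of_notMem_tsupport fun h0 => by
    rw [h.isOpen.frontier_eq] at hfr
    exact hfr.2 (hθs h0)
  have hdist : R / 4 ≤ ‖γ i t - w‖ := by
    by_contra h0
    rw [not_le] at h0
    rw [h.isOpen.frontier_eq] at hfr
    refine hfr.2 (hRΩ ?_)
    rw [Metric.mem_closedBall]
    have := dist_triangle (γ i t) w a
    rw [dist_eq_norm (γ i t) w] at this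
    rw [Metric.mem_ball] at hw
    linarith
  have hψb : ‖ψ (γ i t)‖ ≤ (R / 4)⁻¹ := by
    rw [hψ]
    simp only [hθ0, hκ1 _ (h.mem_closure i t), sub_zero, one_div, norm_inv]
    exact inv_anti₀ (by positivity) hdist
  calc ‖f (γ i t)‖ * ‖ψ (γ i t)‖ * ‖deriv (γ i) t‖
      ≤ ‖f (γ i t)‖ * (R / 4)⁻¹ * ‖deriv (γ i) t‖ := by gcongr
    _ = (R / 4)⁻¹ * (‖f (γ i t)‖ * ‖(1 : ℂ)‖ * ‖deriv (γ i) t‖) := by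
        rw [norm_one]
        ring

end StokesGlobal

/-! ### The boundary measure -/

section BoundaryMeasure

variable {Ω : Set ℂ} {d : ℕ} {γ : Fin d → ℝ → ℂ} {φ : ℂ → ℝ}

theorem IsSmoothlyBoundedBy.lintegral_weightedArcLength (h : IsSmoothlyBoundedBy Ω γ)
    (hφ : ∀ j, ContDiff ℝ ∞ fun t => φ (γ j t)) {g : ℂ → ENNReal} (hg : Measurable g) :
    ∫⁻ z, g z ∂weightedArcLength γ φ =
      ∑ j, ∫⁻ t in Ico (0 : ℝ) 1, ENNReal.ofReal (φ (γ j t) * ‖deriv (γ j) t‖) * g (γ j t) := by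
  rw [weightedArcLength, lintegral_finsetSum_measure]
  refine Finset.sum_congr rfl fun j _ => ?_
  have hm : Measurable (γ j) := (h.continuous j).measurable
  rw [lintegral_map hg hm]
  exact lintegral_withDensity_eq_lintegral_mul _
    ((hφ j).continuous.mul (h.continuous_deriv j).norm).measurable.ennreal_ofReal (hg.comp hm)

theorem IsSmoothlyBoundedBy.isFiniteMeasure (h : IsSmoothlyBoundedBy Ω γ)
    (hφ : ∀ j, ContDiff ℝ ∞ fun t => φ (γ j t)) : IsFiniteMeasure (weightedArcLength γ φ) := by
  refine ⟨?_⟩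
  have h1 := h.lintegral_weightedArcLength hφ (g := fun _ => 1) measurable_const
  rw [lintegral_one] at h1
  rw [h1, ENNReal.sum_lt_top]
  intro j _
  simp only [mul_one]
  have hc : Continuous fun t => φ (γ j t) * ‖deriv (γ j) t‖ :=
    (hφ j).continuous.mul (h.continuous_deriv j).norm
  have hi : IntegrableOn (fun t => φ (γ j t) * ‖deriv (γ j) t‖) (Ico 0 1) :=
    (hc.continuousOn.integrableOn_compact isCompact_Icc).mono_set Ico_subset_Icc_self
  exact hi.lintegral_lt_top

theorem IsSmoothlyBoundedBy.ae_mem_frontier (h : IsSmoothlyBoundedBy Ω γ)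
    (hφ : ∀ j, ContDiff ℝ ∞ fun t => φ (γ j t)) :
    ∀ᵐ z ∂weightedArcLength γ φ, z ∈ frontier Ω := by
  have hm : MeasurableSet (frontier Ω)ᶜ := isClosed_frontier.measurableSet.compl
  have h1 := h.lintegral_weightedArcLength hφ (g := (frontier Ω)ᶜ.indicator fun _ => 1)
    (measurable_const.indicator hm)
  rw [lintegral_indicator_const hm, one_mul] at h1
  rw [ae_iff]
  refine h1.trans (Finset.sum_eq_zero fun j _ => ?_)
  simp [h.mem_frontier j]

theorem IsSmoothlyBoundedBy.memLp (h : IsSmoothlyBoundedBy Ω γ)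
    (hφ : ∀ j, ContDiff ℝ ∞ fun t => φ (γ j t)) {f : ℂ → ℂ} (hf : ContinuousOn f (closure Ω)) :
    MemLp f 2 (weightedArcLength γ φ) := by
  have := h.isFiniteMeasure hφ
  have hae : ∀ᵐ z ∂weightedArcLength γ φ, z ∈ closure Ω :=
    (h.ae_mem_frontier hφ).mono fun z hz => frontier_subset_closure hz
  obtain ⟨C, hC⟩ := h.isCompact_closure.exists_bound_of_continuousOn hf
  refine MemLp.of_bound ?_ C (hae.mono fun z hz => hC z hz)
  rw [← Measure.restrict_eq_self_of_ae_mem hae]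
  exact hf.aestronglyMeasurable isClosed_closure.measurableSet

/-- The `L¹` norm of boundary values is bounded by their norm in `L²_φ(bΩ)`. -/
theorem IsSmoothlyBoundedBy.exists_boundaryNorm_le (h : IsSmoothlyBoundedBy Ω γ)
    (hφpos : ∀ z ∈ frontier Ω, 0 < φ z) (hφ : ∀ j, ContDiff ℝ ∞ fun t => φ (γ j t)) :
    ∃ C, 0 ≤ C ∧ ∀ (f : ℂ → ℂ) (u : WeightedL2 γ φ), ContinuousOn f (closure Ω) →
      ⇑u =ᵐ[weightedArcLength γ φ] f → (boundaryNorm γ f fun _ => 1) ≤ C * ‖u‖ := by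
  have := h.isFiniteMeasure hφ
  set μ := weightedArcLength γ φ with hμ
  have hmin : ∀ j, ∃ m > 0, ∀ t ∈ Icc (0 : ℝ) 1, m ≤ φ (γ j t) := fun j => by
    obtain ⟨t, -, ht⟩ := isCompact_Icc.exists_isMinOn (nonempty_Icc.2 zero_le_one)
      (hφ j).continuous.continuousOn (s := Icc (0 : ℝ) 1)
    exact ⟨φ (γ j t), hφpos _ (h.mem_frontier j t), fun s hs => ht hs⟩
  choose m hm hmφ using hmin
  set A : ℝ := (μ univ ^ (1 / 2 : ℝ)).toReal with hA
  refine ⟨∑ j, (m j)⁻¹ * A, Finset.sum_nonneg fun j _ =>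
    mul_nonneg (inv_nonneg.2 (hm j).le) ENNReal.toReal_nonneg, fun f u hf hu => ?_⟩
  rw [boundaryNorm, Finset.sum_mul]
  refine Finset.sum_le_sum fun j _ => ?_
  have hcont := h.continuous_boundaryNorm hf (ψ := fun _ => 1) continuous_const j
  -- a measurable function with the same values on the boundary
  set F : ℂ → ℂ := (closure Ω).indicator f with hF
  have hFm : Measurable F := by
    classical
    rw [hF, ← piecewise_eq_indicator]
    exact hf.measurable_piecewise continuousOn_const isClosed_closure.measurableSet
  have hFγ : ∀ t, F (γ j t) = f (γ j t) := fun t => indicator_of_mem (h.mem_closure j t) f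
  have hFu : F =ᵐ[μ] u := by
    filter_upwards [h.ae_mem_frontier hφ, hu] with z hz hzu
    rw [hzu, hF, indicator_of_mem (frontier_subset_closure hz)]
  have h1 : ∫⁻ z, ‖F z‖ₑ ∂μ ≤ ENNReal.ofReal (‖u‖ * A) := by
    have e1 : ∫⁻ z, ‖F z‖ₑ ∂μ = eLpNorm u 1 μ := by
      rw [eLpNorm_one_eq_lintegral_enorm]
      exact lintegral_congr_ae (hFu.fun_comp _)
    rw [e1, ENNReal.ofReal_mul (norm_nonneg _), Lp.norm_def, ENNReal.ofReal_toReal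
      (Lp.eLpNorm_ne_top u), hA, ENNReal.ofReal_toReal (by finiteness)]
    have := eLpNorm_le_eLpNorm_mul_rpow_measure_univ (p := 1) (q := 2) (by norm_num)
      (Lp.aestronglyMeasurable u)
    refine this.trans_eq ?_
    norm_num [hμ]
  have h2 : ∫⁻ t in Ico (0 : ℝ) 1, ENNReal.ofReal (φ (γ j t) * ‖deriv (γ j) t‖) * ‖F (γ j t)‖ₑ ≤
      ∫⁻ z, ‖F z‖ₑ ∂μ := by
    rw [hμ, h.lintegral_weightedArcLength hφ hFm.enorm]
    exact Finset.single_le_sum (f := fun j => ∫⁻ t in Ico (0 : ℝ) 1,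
      ENNReal.ofReal (φ (γ j t) * ‖deriv (γ j) t‖) * ‖F (γ j t)‖ₑ) (fun _ _ => zero_le)
      (Finset.mem_univ j)
  have h3 : ENNReal.ofReal (∫ t in (0 : ℝ)..1, ‖f (γ j t)‖ * ‖(1 : ℂ)‖ * ‖deriv (γ j) t‖) ≤
      ENNReal.ofReal ((m j)⁻¹ * (‖u‖ * A)) := by
    rw [intervalIntegral.integral_of_le zero_le_one, ← restrict_Ico_eq_restrict_Ioc,
      ofReal_integral_eq_lintegral_ofReal ((hcont.continuousOn.integrableOn_compact
        isCompact_Icc).mono_set Ico_subset_Icc_self) (ae_of_all _ fun t => by positivity),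
      ENNReal.ofReal_mul (inv_nonneg.2 (hm j).le)]
    refine le_trans ?_ (mul_le_mul_right (h2.trans h1) _)
    rw [← lintegral_const_mul']
    · refine setLIntegral_mono' measurableSet_Ico fun t ht => ?_
      rw [← ofReal_norm, hFγ, ← ENNReal.ofReal_mul (mul_nonneg
        (hφpos _ (h.mem_frontier j t)).le (norm_nonneg _)), ← ENNReal.ofReal_mul
        (inv_nonneg.2 (hm j).le)]
      refine ENNReal.ofReal_le_ofReal ?_
      have h4 : 1 ≤ (m j)⁻¹ * φ (γ j t) := by
        rw [← div_eq_inv_mul, one_le_div (hm j)]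
        exact hmφ j t (Ico_subset_Icc_self ht)
      calc ‖f (γ j t)‖ * ‖(1 : ℂ)‖ * ‖deriv (γ j) t‖
          = 1 * (‖f (γ j t)‖ * ‖deriv (γ j) t‖) := by rw [norm_one]; ring
        _ ≤ (m j)⁻¹ * φ (γ j t) * (‖f (γ j t)‖ * ‖deriv (γ j) t‖) := by gcongr
        _ = _ := by ring
    · exact ENNReal.ofReal_ne_top
  have hnn : 0 ≤ (m j)⁻¹ * (‖u‖ * A) := mul_nonneg (inv_nonneg.2 (hm j).le)
    (mul_nonneg (norm_nonneg _) ENNReal.toReal_nonneg)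
  refine ((ENNReal.ofReal_le_ofReal_iff hnn).1 h3).trans_eq ?_
  ring

/-! ### The Szegő kernel function -/

theorem IsAInfty.continuousOn {f : ℂ → ℂ} (hf : IsAInfty Ω f) : ContinuousOn f (closure Ω) :=
  hf.2.continuousOn

theorem IsAInfty.sub {f g : ℂ → ℂ} (hf : IsAInfty Ω f) (hg : IsAInfty Ω g) :
    IsAInfty Ω (f - g) := ⟨hf.1.sub hg.1, hf.2.sub hg.2⟩

/-- Evaluations of `A^∞(Ω)` are bounded in the norm of `L²_φ(bΩ)`, locally uniformly. -/
theorem IsSmoothlyBoundedBy.exists_eval_bound (h : IsSmoothlyBoundedBy Ω γ)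
    (hφpos : ∀ z ∈ frontier Ω, 0 < φ z) (hφ : ∀ j, ContDiff ℝ ∞ fun t => φ (γ j t)) {a : ℂ}
    (ha : a ∈ Ω) : ∃ r > 0, Metric.ball a r ⊆ Ω ∧ ∃ C, ∀ w ∈ Metric.ball a r,
      ∀ (f : ℂ → ℂ) (u : WeightedL2 γ φ), IsAInfty Ω f → ⇑u =ᵐ[weightedArcLength γ φ] f →
        ‖f w‖ ≤ C * ‖u‖ := by
  obtain ⟨r, hr, hrΩ, C, hC⟩ := h.exists_norm_le_boundaryNorm ha
  obtain ⟨C', hC'0, hC'⟩ := h.exists_boundaryNorm_le hφpos hφ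
  refine ⟨r, hr, hrΩ, |C| * C', fun w hw f u hf hu => ?_⟩
  refine (hC w hw f hf.continuousOn hf.1).trans ?_
  rw [mul_assoc]
  exact mul_le_mul (le_abs_self C) (hC' f u hf.continuousOn hu) (boundaryNorm_nonneg _ _)
    (abs_nonneg C)

instance completeSpace_hardySpace : CompleteSpace (hardySpace Ω γ φ) :=
  (aInftyBoundaryValues Ω γ φ).isClosed_topologicalClosure.completeSpace_coe

/-- The evaluation at `a` extends to a continuous functional on `L²_φ(bΩ)`; the vector that
represents it is projected to the Hardy space. -/
theorem IsSmoothlyBoundedBy.exists_isReproducingAt (h : IsSmoothlyBoundedBy Ω γ)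
    (hφpos : ∀ z ∈ frontier Ω, 0 < φ z) (hφ : ∀ j, ContDiff ℝ ∞ fun t => φ (γ j t)) {a : ℂ}
    (ha : a ∈ Ω) : ∃ k, IsReproducingAt Ω γ φ a k := by
  obtain ⟨r, hr, -, C, hC⟩ := h.exists_eval_bound hφpos hφ ha
  have hC := hC a (Metric.mem_ball_self hr)
  -- the value at `a` depends only on the boundary values
  have huniq : ∀ (f g : ℂ → ℂ) (u : WeightedL2 γ φ), IsAInfty Ω f → IsAInfty Ω g →
      ⇑u =ᵐ[weightedArcLength γ φ] f → ⇑u =ᵐ[weightedArcLength γ φ] g → f a = g a := by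
    intro f g u hf hg huf hug
    have h0 : ⇑(0 : WeightedL2 γ φ) =ᵐ[weightedArcLength γ φ] (f - g) := by
      filter_upwards [Lp.coeFn_zero ℂ 2 (weightedArcLength γ φ), huf, hug] with z h1 h2 h3
      rw [h1, Pi.sub_apply, ← h2, ← h3, sub_self, Pi.zero_apply]
    have := hC (f - g) 0 (hf.sub hg) h0
    rw [norm_zero, mul_zero] at this
    exact sub_eq_zero.1 (norm_le_zero_iff.1 this)
  choose F hF hFu using fun u : aInftyBoundaryValues Ω γ φ => u.2
  let ℓ : aInftyBoundaryValues Ω γ φ →ₗ[ℂ] ℂ :=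
    { toFun := fun u => F u a
      map_add' := fun u v => huniq _ (F u + F v) _ (hF _)
        ⟨(hF u).1.add (hF v).1, (hF u).2.add (hF v).2⟩ (hFu _)
        ((Lp.coeFn_add _ _).trans ((hFu u).add (hFu v)))
      map_smul' := fun c u => huniq _ (c • F u) _ (hF _)
        ⟨(hF u).1.const_smul c, (hF u).2.const_smul c⟩ (hFu _)
        ((Lp.coeFn_smul _ _).trans ((hFu u).const_smul c)) }
  let ℓ' : aInftyBoundaryValues Ω γ φ →L[ℂ] ℂ := ℓ.mkContinuous C fun u => hC _ _ (hF u) (hFu u)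
  obtain ⟨g, hg, -⟩ := exists_extension_norm_eq (aInftyBoundaryValues Ω γ φ) ℓ'
  set k₀ := (InnerProductSpace.toDual ℂ (WeightedL2 γ φ)).symm g with hk₀
  refine ⟨(hardySpace Ω γ φ).starProjection k₀, Submodule.starProjection_apply_mem _ _,
    fun f u hf hu => ?_⟩
  have hu' : u ∈ aInftyBoundaryValues Ω γ φ := ⟨f, hf, hu⟩
  have hu'' : u ∈ hardySpace Ω γ φ := Submodule.le_topologicalClosure _ hu'
  rw [Submodule.inner_starProjection_left_eq_right,
    Submodule.starProjection_eq_self_iff.2 hu'', hk₀, InnerProductSpace.toDual_symm_apply,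
    hg ⟨u, hu'⟩]
  exact huniq _ _ _ (hF ⟨u, hu'⟩) hf (hFu ⟨u, hu'⟩) hu

theorem IsSmoothlyBoundedBy.isReproducingAt_szegoElement (h : IsSmoothlyBoundedBy Ω γ)
    (hφpos : ∀ z ∈ frontier Ω, 0 < φ z) (hφ : ∀ j, ContDiff ℝ ∞ fun t => φ (γ j t)) {a : ℂ}
    (ha : a ∈ Ω) : IsReproducingAt Ω γ φ a (szegoElement Ω γ φ a) := by
  have := h.exists_isReproducingAt hφpos hφ ha
  rw [szegoElement, dif_pos this]
  exact this.choose_spec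

/-- For `u` in the Hardy space, `z ↦ ⟨u, σ(·, z)⟩` is the holomorphic function with boundary values
`u`, and for a general `u` it is that of the projection of `u`. -/
theorem IsSmoothlyBoundedBy.differentiableOn_inner_szegoElement (h : IsSmoothlyBoundedBy Ω γ)
    (hφpos : ∀ z ∈ frontier Ω, 0 < φ z) (hφ : ∀ j, ContDiff ℝ ∞ fun t => φ (γ j t))
    (u : WeightedL2 γ φ) :
    DifferentiableOn ℂ (fun z => inner ℂ (szegoElement Ω γ φ z) u) Ω := by
  have hrep := fun a (ha : a ∈ Ω) => h.isReproducingAt_szegoElement hφpos hφ ha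
  set v := (hardySpace Ω γ φ).starProjection u with hv
  have huv : ∀ z ∈ Ω, inner ℂ (szegoElement Ω γ φ z) u = inner ℂ (szegoElement Ω γ φ z) v :=
    fun z hz => by
      rw [hv, ← Submodule.inner_starProjection_left_eq_right,
        Submodule.starProjection_eq_self_iff.2 (hrep z hz).1]
  refine DifferentiableOn.congr ?_ huv
  have hvH' : v ∈ hardySpace Ω γ φ := Submodule.starProjection_apply_mem _ _
  have hvH : v ∈ closure (aInftyBoundaryValues Ω γ φ : Set (WeightedL2 γ φ)) := hvH'
  obtain ⟨x, hx, hxv⟩ := mem_closure_iff_seq_limit.1 hvH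
  refine TendstoLocallyUniformlyOn.differentiableOn (φ := atTop)
    (F := fun n z => inner ℂ (szegoElement Ω γ φ z) (x n)) ?_ (Eventually.of_forall fun n => ?_)
    h.isOpen
  · rw [Metric.tendstoLocallyUniformlyOn_iff]
    intro ε hε a ha
    obtain ⟨r, hr, hrΩ, C, hC⟩ := h.exists_eval_bound hφpos hφ ha
    -- the norm of `σ(·, w)` is that of the evaluation at `w`
    have hσ : ∀ w ∈ Metric.ball a r, ‖szegoElement Ω γ φ w‖ ≤ C := by
      intro w hw
      have hcl : IsClosed {y : WeightedL2 γ φ | ‖inner ℂ (szegoElement Ω γ φ w) y‖ ≤ C * ‖y‖} :=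
        isClosed_le (by fun_prop) (by fun_prop)
      have hsub : (aInftyBoundaryValues Ω γ φ : Set (WeightedL2 γ φ)) ⊆
          {y | ‖inner ℂ (szegoElement Ω γ φ w) y‖ ≤ C * ‖y‖} := by
        rintro y ⟨f, hf, hfy⟩
        rw [mem_ofPred_eq, (hrep w (hrΩ hw)).2 f y hf hfy]
        exact hC w hw f y hf hfy
      have h1 : szegoElement Ω γ φ w ∈ {y | ‖inner ℂ (szegoElement Ω γ φ w) y‖ ≤ C * ‖y‖} :=
        closure_minimal hsub hcl (hrep w (hrΩ hw)).1
      rw [mem_ofPred_eq, inner_self_eq_norm_sq_to_K] at h1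
      -- if `σ(·, w)` were zero, `C` might be negative; the constant function `1` excludes it
      rcases (norm_nonneg (szegoElement Ω γ φ w)).eq_or_lt with h0 | h0
      · have := hC w hw 0 0 ⟨differentiableOn_const 0, contDiffOn_const⟩ (Lp.coeFn_zero _ _ _)
        have h2 := hC w hw 1 (MemLp.toLp _ (h.memLp hφ (f := 1) continuousOn_const))
          ⟨differentiableOn_const 1, contDiffOn_const⟩ (MemLp.coeFn_toLp _)
        rw [← h0]
        by_contra hneg
        rw [not_le] at hneg
        have : C * ‖MemLp.toLp _ (h.memLp hφ (f := 1) continuousOn_const)‖ ≤ 0 :=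
          mul_nonpos_of_nonpos_of_nonneg hneg.le (norm_nonneg _)
        have h3 : ‖(1 : ℂ → ℂ) w‖ = 1 := by simp
        linarith
      · refine le_of_mul_le_mul_right ?_ h0
        simpa [sq] using h1
    have hC0 : 0 ≤ C := (norm_nonneg _).trans (hσ a (Metric.mem_ball_self hr))
    refine ⟨Metric.ball a r, mem_nhdsWithin_of_mem_nhds (Metric.ball_mem_nhds a hr), ?_⟩
    have hlim : Tendsto (fun n => C * ‖v - x n‖) atTop (𝓝 0) := by
      have : Tendsto (fun n => v - x n) atTop (𝓝 0) := by
        simpa using hxv.const_sub v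
      simpa using (this.norm.const_mul C)
    filter_upwards [hlim.eventually (gt_mem_nhds hε)] with n hn w hw
    rw [dist_eq_norm, ← inner_sub_right]
    exact ((norm_inner_le_norm _ _).trans (mul_le_mul_of_nonneg_right (hσ w hw)
      (norm_nonneg _))).trans_lt hn
  · obtain ⟨f, hf, hfx⟩ := hx n
    exact hf.1.congr fun z hz => (hrep z hz).2 f (x n) hf hfx

end BoundaryMeasure

/-! ### Approximation of bounded holomorphic functions -/

section Approximation

variable {Ω : Set ℂ} {d : ℕ} {γ : Fin d → ℝ → ℂ}

/-- The boundary is covered by images of the real line under the charts, which are smooth. -/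
theorem IsSmoothlyBoundedBy.volume_frontier (h : IsSmoothlyBoundedBy Ω γ) :
    volume (frontier Ω) = 0 := by
  rw [h.frontier_eq, measure_iUnion_null_iff]
  intro j
  have hline : volume {z : ℂ | z.im = 0} = 0 := by
    have := Measure.addHaar_submodule (volume : Measure ℂ) (LinearMap.ker Complex.imLm) fun h0 => by
      have h1 : Complex.I ∈ LinearMap.ker Complex.imLm := h0 ▸ Submodule.mem_top
      simp at h1
    exact this
  refine measure_mono_null ?_ (addHaar_image_eq_zero_of_differentiableOn_of_addHaar_eq_zero volume
    (f := boundaryChart (γ j) 0) (fun z _ =>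
      (boundaryChart_hasStrictFDerivAt (h.contDiff j) 0 z).hasFDerivAt.differentiableAt
        |>.differentiableWithinAt) hline)
  rintro _ ⟨t, rfl⟩
  exact ⟨t, by simp, boundaryChart_ofReal _ _ _⟩

theorem exists_smooth_cutoff {K W : Set ℂ} (hK : IsClosed K) (hW : IsOpen W) (hKW : K ⊆ W) :
    ∃ κ : ℂ → ℂ, ContDiff ℝ ∞ κ ∧ tsupport κ ⊆ W ∧ (∀ᶠ z in 𝓝ˢ K, κ z = 1) ∧ ∀ z, ‖κ z‖ ≤ 1 := by
  obtain ⟨κ, h0, h1, h01⟩ := exists_contMDiffMap_zero_one_nhds_of_isClosed (n := ⊤)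
    (modelWithCornersSelf ℝ ℂ) hW.isClosed_compl hK
    (disjoint_compl_left_iff_subset.2 hKW)
  refine ⟨fun z => (κ z : ℂ), Complex.ofRealCLM.contDiff.comp
    (contMDiff_iff_contDiff.1 κ.contMDiff), fun z hz => ?_, ?_, fun z => ?_⟩
  · by_contra hzW
    refine notMem_tsupport_iff_eventuallyEq.2 ?_ hz
    filter_upwards [eventually_nhdsSet_iff_forall.1 h0 z hzW] with y hy
    rw [hy, Complex.ofReal_zero, Pi.zero_apply]
  · filter_upwards [h1] with z hz
    rw [hz, Complex.ofReal_one]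
  · rw [Complex.norm_real, Real.norm_of_nonneg (h01 z).1]
    exact (h01 z).2

/-- One approximation step.  The vector field `V` points into the domain, and `G` is the function
`g (z + ε V z)` minus a Cauchy transform of its derivative `v` with respect to `z̄`, which makes it
holomorphic.  The derivative is `v = ε g'(z + ε V z) ∂V/∂z̄`; since `|g'|` is of order at most `1/ε`
at a distance of order `ε` from the boundary, `v` is bounded uniformly in `ε`. -/
theorem IsSmoothlyBoundedBy.exists_pushed (h : IsSmoothlyBoundedBy Ω γ) {V : ℂ → ℂ}
    (hV : ContDiff ℝ ∞ V) {c : ℝ} (hc : 0 < c) {ε : ℝ} (hε : 0 < ε) (hε1 : ε ≤ 1)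
    (hball : ∀ z ∈ closure Ω, Metric.ball (z + (ε : ℝ) * V z) (c * ε) ⊆ Ω) {M : ℝ}
    (hM : ∀ z ∈ Metric.thickening 1 (closure Ω), ‖dbar V z‖ ≤ M) {g : ℂ → ℂ}
    (hg : DifferentiableOn ℂ g Ω) {B : ℝ} (hB : ∀ z ∈ Ω, ‖g z‖ ≤ B) :
    ∃ G v : ℂ → ℂ, IsAInfty Ω G ∧ Continuous v ∧ HasCompactSupport v ∧
      (∀ z, z ∉ Metric.thickening ε (closure Ω) → v z = 0) ∧ (∀ z, ‖v z‖ ≤ 4 * B * M / c) ∧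
      (∀ z ∈ Ω, ‖v z‖ ≤ ‖deriv g (z + ε * V z)‖ * (ε * M)) ∧
      ∀ z ∈ closure Ω, ‖G z - g (z + ε * V z)‖ ≤ ∫ ζ, ‖v (z - ζ)‖ * ‖ζ‖⁻¹ := by
  set Ψ : ℂ → ℂ := fun z => z + ε * V z with hΨ
  have hΨd : ContDiff ℝ ∞ Ψ := contDiff_id.add (contDiff_const.mul hV)
  -- `W` is a neighbourhood of `closure Ω` that `Ψ` maps into `Ω`, to a distance of at least
  -- `c ε / 2` from the boundary
  set W : Set ℂ := Metric.thickening ε (closure Ω) ∩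
    ⋃ y ∈ closure Ω, Ψ ⁻¹' Metric.ball (Ψ y) (c * ε / 2) with hW
  have hcε : 0 < c * ε := by positivity
  have hWo : IsOpen W := Metric.isOpen_thickening.inter (isOpen_biUnion fun y _ =>
    Metric.isOpen_ball.preimage hΨd.continuous)
  have hcl : closure Ω ⊆ W := fun z hz => ⟨Metric.self_subset_thickening hε _ hz,
    mem_iUnion₂.2 ⟨z, hz, Metric.mem_ball_self (by positivity)⟩⟩
  have hWball : ∀ z ∈ W, Metric.ball (Ψ z) (c * ε / 2) ⊆ Ω := by
    rintro z ⟨-, hz⟩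
    obtain ⟨y, hy, hzy⟩ := mem_iUnion₂.1 hz
    refine Subset.trans (Metric.ball_subset_ball' ?_) (hball y hy)
    have : dist (Ψ z) (Ψ y) < c * ε / 2 := hzy
    change c * ε / 2 + dist (Ψ z) (Ψ y) ≤ c * ε
    linarith
  have hWΩ : MapsTo Ψ W Ω := fun z hz => hWball z hz (Metric.mem_ball_self (by positivity))
  have hWM : ∀ z ∈ W, ‖dbar V z‖ ≤ M := fun z hz =>
    hM z (Metric.thickening_mono hε1 _ hz.1)
  obtain ⟨κ, hκd, hκW, hκ1, hκn⟩ := exists_smooth_cutoff isClosed_closure hWo hcl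
  have hκc : HasCompactSupport κ := by
    refine HasCompactSupport.of_support_subset_isCompact
      (K := closure (Metric.thickening ε (closure Ω))) ?_ ?_
    · exact (h.isBounded.closure.thickening).isCompact_closure
    · exact fun z hz => subset_closure (hκW (subset_tsupport _ hz)).1
  have hg1 : ContDiffOn ℝ ∞ (fun z => g (Ψ z)) W :=
    (hg.contDiffOn_real h.isOpen).comp hΨd.contDiffOn hWΩ
  have hg2 : ContDiffOn ℝ ∞ (fun z => deriv g (Ψ z) * (ε * dbar V z)) W :=
    (((hg.deriv h.isOpen).contDiffOn_real h.isOpen).comp hΨd.contDiffOn hWΩ).mul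
      (contDiff_const.mul hV.dbar).contDiffOn
  -- on `closure Ω`, where `κ = 1`, this is `∂/∂z̄` of `g ∘ Ψ`
  set v : ℂ → ℂ := fun z => deriv g (Ψ z) * (ε * dbar V z) * κ z with hv
  have hvd : ContDiff ℝ ∞ v := contDiff_mul_of_tsupport_subset hWo hg2 hκd hκW
  have hvc : HasCompactSupport v := hκc.mul_left
  obtain ⟨u, hud, hudbar, hub⟩ := exists_dbar_eq hvd hvc
  have hGd : ContDiff ℝ ∞ fun z => g (Ψ z) * κ z :=
    contDiff_mul_of_tsupport_subset hWo hg1 hκd hκW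
  have hdV : ∀ z, dbar Ψ z = ε * dbar V z := fun z => by
    have d1 : DifferentiableAt ℝ (fun ζ => (ε : ℂ) * V ζ) z :=
      (differentiableAt_const _).mul (hV.differentiable (by simp) z)
    have h1 : dbar Ψ z = dbar (fun ζ => ζ) z + dbar (fun ζ => (ε : ℂ) * V ζ) z := by
      simp only [dbar, hΨ]
      rw [fderiv_fun_add differentiableAt_fun_id d1, add_apply, add_apply]
      ring
    rw [h1, differentiableAt_fun_id.dbar_eq_zero, dbar_mul (differentiableAt_const _)
      (hV.differentiable (by simp) z), (differentiableAt_const (ε : ℂ)).dbar_eq_zero]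
    ring
  have hκ1' : ∀ z ∈ closure Ω, κ z = 1 := fun z hz =>
    (eventually_nhdsSet_iff_forall.1 hκ1 z hz).self_of_nhds
  have hκ0 : ∀ z, z ∉ W → κ z = 0 := fun z hz =>
    image_eq_zero_of_notMem_tsupport fun h0 => hz (hκW h0)
  refine ⟨fun z => g (Ψ z) * κ z - u z, v, ⟨fun z hz => ?_, (hGd.sub hud).contDiffOn⟩,
    hvd.continuous, hvc, fun z hz => ?_, fun z => ?_, fun z hz => ?_, fun z hz => ?_⟩
  · refine (differentiableAt_of_dbar_eq_zero ((hGd.sub hud).differentiable (by simp) z)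
      ?_).differentiableWithinAt
    rw [dbar_sub (hGd.differentiable (by simp) z) (hud.differentiable (by simp) z), hudbar]
    have e1 : (fun z => g (Ψ z) * κ z) =ᶠ[𝓝 z] fun z => g (Ψ z) := by
      filter_upwards [eventually_nhdsSet_iff_forall.1 hκ1 z (subset_closure hz)] with y hy
      rw [hy, mul_one]
    rw [e1.dbar_eq, dbar_comp (hg.differentiableAt (h.isOpen.mem_nhds (hWΩ (hcl
      (subset_closure hz))))) (hΨd.differentiable (by simp) z), hdV, hv]
    simp only [hκ1' z (subset_closure hz), mul_one, sub_self]
  · simp only [hv, hκ0 z fun h0 => hz h0.1, mul_zero]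
  · by_cases hz : z ∈ W
    -- the Cauchy estimate on a disc of radius `c ε / 4`
    · have hd1 : ‖deriv g (Ψ z)‖ ≤ B / (c * ε / 4) := by
        refine Complex.norm_deriv_le_of_forall_mem_sphere_norm_le (by positivity) ?_ ?_
        · refine DifferentiableOn.diffContOnCl (hg.mono ?_)
          rw [closure_ball _ (by positivity)]
          exact (Metric.closedBall_subset_ball (by linarith)).trans (hWball z hz)
        · intro y hy
          exact hB y (hWball z hz (Metric.sphere_subset_closedBall.trans
            (Metric.closedBall_subset_ball (by linarith)) hy))
      have hM0 : 0 ≤ M := (norm_nonneg _).trans (hWM z hz)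
      calc ‖v z‖ = ‖deriv g (Ψ z)‖ * (ε * ‖dbar V z‖) * ‖κ z‖ := by
            simp only [hv, norm_mul, Complex.norm_real, Real.norm_of_nonneg hε.le]
        _ ≤ ‖deriv g (Ψ z)‖ * (ε * ‖dbar V z‖) * 1 := by gcongr; exact hκn z
        _ ≤ B / (c * ε / 4) * (ε * M) * 1 := by
            gcongr
            · exact (norm_nonneg _).trans hd1
            · exact hWM z hz
        _ = 4 * B * M / c := by
            field_simp
    · have hB0 : 0 ≤ B := by
        obtain ⟨y, hy⟩ := h.isConnected.nonempty
        exact (norm_nonneg _).trans (hB y hy)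
      have hM0 : 0 ≤ M := by
        obtain ⟨y, hy⟩ := h.isConnected.nonempty
        exact (norm_nonneg _).trans (hWM y (hcl (subset_closure hy)))
      simp only [hv, hκ0 z hz, mul_zero, norm_zero]
      positivity
  · simp only [hv, hκ1' z (subset_closure hz), mul_one, norm_mul, Complex.norm_real,
      Real.norm_of_nonneg hε.le]
    gcongr
    exact hWM z (hcl (subset_closure hz))
  · change ‖g (Ψ z) * κ z - u z - g (Ψ z)‖ ≤ _
    rw [hκ1' z hz, mul_one, sub_sub_cancel_left, norm_neg]
    exact hub z

/-- A bounded holomorphic function `g` on `Ω`, dominated by `|f|` near the boundary, is a pointwise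
limit of functions in `A^∞(Ω)` which are asymptotically dominated by `|f|` on the boundary. -/
theorem IsSmoothlyBoundedBy.exists_approx (h : IsSmoothlyBoundedBy Ω γ) {g f : ℂ → ℂ}
    (hg : DifferentiableOn ℂ g Ω) {B : ℝ} (hB : ∀ z ∈ Ω, ‖g z‖ ≤ B)
    (hf : ContinuousOn f (closure Ω))
    (hmaj : ∀ η > 0, ∃ K ⊆ Ω, IsCompact K ∧ ∀ z ∈ Ω \ K, ‖g z‖ ≤ ‖f z‖ + η) :
    ∃ G : ℕ → ℂ → ℂ, (∀ n, IsAInfty Ω (G n)) ∧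
      (∀ z ∈ Ω, Tendsto (fun n => G n z) atTop (𝓝 (g z))) ∧
      ∀ η > 0, ∀ᶠ n in atTop, ∀ z ∈ frontier Ω, ‖G n z‖ ≤ ‖f z‖ + η := by
  obtain ⟨V, hV, c, hc, ε₀, hε₀, hball⟩ := h.exists_inward_field
  have hcomp : IsCompact (closure (Metric.thickening 1 (closure Ω))) :=
    (h.isBounded.closure.thickening).isCompact_closure
  obtain ⟨M, hM⟩ := hcomp.exists_bound_of_continuousOn hV.dbar.continuous.continuousOn
  obtain ⟨MV, hMV⟩ := h.isCompact_closure.exists_bound_of_continuousOn hV.continuous.continuousOn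
  set ε : ℕ → ℝ := fun n => min ε₀ 1 / (n + 2) with hε
  have hmin : 0 < min ε₀ 1 := lt_min hε₀ one_pos
  have hε0 : ∀ n, 0 < ε n := fun n => by positivity
  have hεlt : ∀ n, ε n < min ε₀ 1 := fun n => by
    rw [hε]
    simp only
    rw [div_lt_iff₀ (by positivity)]
    nlinarith [(n.cast_nonneg : (0 : ℝ) ≤ n)]
  have hεlim : Tendsto ε atTop (𝓝 0) :=
    tendsto_const_nhds.div_atTop (tendsto_atTop_add_const_right _ _ tendsto_natCast_atTop_atTop)
  have hshift : ∀ z, Tendsto (fun n => z + ε n * V z) atTop (𝓝 z) := fun z => by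
    have h1 : Tendsto (fun n => ((ε n : ℝ) : ℂ)) atTop (𝓝 0) :=
      (Complex.continuous_ofReal.tendsto' 0 0 rfl).comp hεlim
    simpa using (h1.mul_const (V z)).const_add z
  have hstep := fun n => h.exists_pushed hV hc (hε0 n) ((hεlt n).le.trans (min_le_right _ _))
    (fun z hz => hball z hz (ε n) ⟨hε0 n, (hεlt n).trans_le (min_le_left _ _)⟩)
    (fun z hz => hM z (subset_closure hz)) hg hB
  choose G v hG hvc hvs hv0 hvB hvΩ hGv using hstep
  -- `v n` tends to zero in `L¹`
  have hL1 : Tendsto (fun n => ∫ ζ, ‖v n ζ‖) atTop (𝓝 0) := by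
    have hD : MeasurableSet (Metric.thickening 1 (closure Ω)) :=
      Metric.isOpen_thickening.measurableSet
    have key := tendsto_integral_of_dominated_convergence (μ := volume) (F := fun n ζ => ‖v n ζ‖)
      (f := fun _ => 0) ((Metric.thickening 1 (closure Ω)).indicator fun _ => 4 * B * M / c)
      (fun n => (hvc n).norm.aestronglyMeasurable) ?_ ?_ ?_
    · simpa using key
    · refine (integrable_indicator_iff hD).2 (integrableOn_const ?_ )
      exact (measure_mono subset_closure).trans_lt hcomp.measure_lt_top |>.ne
    · intro n
      refine ae_of_all _ fun z => ?_
      rw [norm_norm]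
      by_cases hz : z ∈ Metric.thickening 1 (closure Ω)
      · rw [indicator_of_mem hz]
        exact hvB n z
      · rw [indicator_of_notMem hz, hv0 n z fun h0 => hz
          (Metric.thickening_mono ((hεlt n).le.trans (min_le_right _ _)) _ h0), norm_zero]
    · filter_upwards [measure_eq_zero_iff_ae_notMem.1 h.volume_frontier] with z hz
      by_cases hzΩ : z ∈ Ω
      · have h1 := hshift z
        have h2 : ContinuousAt (deriv g) z :=
          ((hg.deriv h.isOpen).differentiableAt (h.isOpen.mem_nhds hzΩ)).continuousAt
        have h3 : Tendsto (fun n => ‖deriv g (z + ε n * V z)‖ * (ε n * M)) atTop (𝓝 0) := by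
          have := (h2.tendsto.comp h1).norm.mul (hεlim.mul_const M)
          simpa using this
        exact squeeze_zero (fun n => norm_nonneg _) (fun n => hvΩ n z hzΩ) h3
      · have hzc : z ∉ closure Ω := fun h0 => hz (by
          rw [h.isOpen.frontier_eq]
          exact ⟨h0, hzΩ⟩)
        obtain ⟨δ, hδ, hδz⟩ := Metric.isOpen_iff.1 isClosed_closure.isOpen_compl z hzc
        refine tendsto_const_nhds.congr' ?_
        filter_upwards [hεlim.eventually (gt_mem_nhds hδ)] with n hn
        rw [hv0 n z, norm_zero]
        intro h0
        obtain ⟨y, hy, hyz⟩ := Metric.mem_thickening_iff.1 h0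
        exact hδz (Metric.mem_ball'.2 (hyz.trans hn)) hy
  -- `v n` is bounded and tends to zero in `L¹`, so its Cauchy transform tends to zero uniformly
  have hunif : ∀ η > 0, ∀ᶠ n in atTop, ∀ z ∈ closure Ω, ‖G n z - g (z + ε n * V z)‖ ≤ η := by
    intro η hη
    obtain ⟨K, hK⟩ := exists_cauchyTransform_bound (4 * B * M / c) (half_pos hη)
    have h1 : Tendsto (fun n => K * ∫ ζ, ‖v n ζ‖) atTop (𝓝 0) := by
      simpa using hL1.const_mul K
    filter_upwards [h1.eventually (gt_mem_nhds (half_pos hη))] with n hn z hz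
    refine (hGv n z hz).trans ((hK (v n) (hvc n) (hvs n) (hvB n) z).trans ?_)
    linarith
  refine ⟨G, hG, fun z hz => ?_, fun η hη => ?_⟩
  · have h1 := hshift z
    have h2 : Tendsto (fun n => g (z + ε n * V z)) atTop (𝓝 (g z)) :=
      (hg.differentiableAt (h.isOpen.mem_nhds hz)).continuousAt.tendsto.comp h1
    have h3 : Tendsto (fun n => G n z - g (z + ε n * V z)) atTop (𝓝 0) := by
      rw [Metric.tendsto_nhds]
      intro η hη
      filter_upwards [hunif (η / 2) (by positivity)] with n hn
      rw [dist_zero_right]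
      exact (hn z (subset_closure hz)).trans_lt (by linarith)
    simpa using h3.add h2
  -- for large `n`, the points `z + ε V z` with `z` on the boundary avoid the compact set `K`
  · obtain ⟨K, hKΩ, hKc, hK⟩ := hmaj (η / 3) (by positivity)
    have hdisj : Disjoint K (frontier Ω) := by
      rw [h.isOpen.frontier_eq]
      exact disjoint_sdiff_right.mono_left hKΩ
    obtain ⟨δ, hδ, hδK⟩ := hdisj.exists_thickenings hKc isClosed_frontier
    obtain ⟨δ', hδ', hfδ⟩ := Metric.uniformContinuousOn_iff.1
      (h.isCompact_closure.uniformContinuousOn_of_continuous hf) (η / 3) (by positivity)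
    have hsmall : Tendsto (fun n => ε n * MV) atTop (𝓝 0) := by
      simpa using hεlim.mul_const MV
    filter_upwards [hunif (η / 3) (by positivity),
      hsmall.eventually (gt_mem_nhds (lt_min hδ hδ'))] with n hn hn2 z hz
    have hzc : z ∈ closure Ω := frontier_subset_closure hz
    have hzΩ : z + ε n * V z ∈ Ω := hball z hzc (ε n) ⟨hε0 n, (hεlt n).trans_le (min_le_left _ _)⟩
      (Metric.mem_ball_self (mul_pos hc (hε0 n)))
    have hd : dist (z + ε n * V z) z < min δ δ' := by
      rw [dist_eq_norm, add_sub_cancel_left, norm_mul, Complex.norm_real,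
        Real.norm_of_nonneg (hε0 n).le]
      exact (mul_le_mul_of_nonneg_left (hMV z hzc) (hε0 n).le).trans_lt hn2
    have hzK : z + ε n * V z ∉ K := fun h0 => disjoint_left.1 hδK
      (Metric.self_subset_thickening hδ _ h0)
      (Metric.mem_thickening_iff.2 ⟨z, hz, hd.trans_le (min_le_left _ _)⟩)
    have h1 := hK _ ⟨hzΩ, hzK⟩
    have h2 := hfδ _ (subset_closure hzΩ) z hzc (hd.trans_le (min_le_right _ _))
    rw [dist_eq_norm] at h2
    have h3 := norm_sub_norm_le (f (z + ε n * V z)) (f z)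
    have h4 := norm_sub_norm_le (G n z) (g (z + ε n * V z))
    have h5 := hn z hzc
    linarith

end Approximation

/-! ### Weak limits, derivatives of the kernel and finite-rank projections -/

section HilbertSpace

variable {E : Type*} [NormedAddCommGroup E] [InnerProductSpace ℂ E]

/-- Weak sequential limits: a sequence whose norms are asymptotically at most `C` has a weak cluster
point of norm at most `C`, and its inner products are the limits of those of the sequence, where
these exist.  The cluster point is the limit along an ultrafilter, by the Banach–Alaoglu theorem. -/
theorem exists_weakLimit [CompleteSpace E] {x : ℕ → E} {C : ℝ}
    (hx : ∀ η > 0, ∀ᶠ n in atTop, ‖x n‖ ≤ C + η) :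
    ∃ u, ‖u‖ ≤ C ∧ ∀ (y : E) (c : ℂ), Tendsto (fun n => inner ℂ y (x n)) atTop (𝓝 c) →
      inner ℂ y u = c := by
  let ℓ : ℕ → WeakDual ℂ E := fun n =>
    StrongDual.toWeakDual (InnerProductSpace.toDual ℂ E (x n))
  have hU : (hyperfilter ℕ : Filter ℕ) ≤ atTop := Nat.hyperfilter_le_atTop
  have hmem : WeakDual.toStrongDual ⁻¹' Metric.closedBall (0 : StrongDual ℂ E) (C + 1) ∈
      (hyperfilter ℕ).map ℓ := by
    rw [Ultrafilter.mem_map]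
    refine hU ((hx 1 one_pos).mono fun n hn => ?_)
    have : ‖InnerProductSpace.toDual ℂ E (x n)‖ ≤ C + 1 := by
      rwa [LinearIsometryEquiv.norm_map]
    simpa [ℓ] using this
  obtain ⟨L, -, hL⟩ := (WeakDual.isCompact_closedBall (𝕜 := ℂ) (0 : StrongDual ℂ E)
    (C + 1)).ultrafilter_le_nhds' _ hmem
  have hL' : Tendsto ℓ (hyperfilter ℕ) (𝓝 L) := hL
  set u := (InnerProductSpace.toDual ℂ E).symm (WeakDual.toStrongDual L) with hu
  have hev : ∀ y, Tendsto (fun n => inner ℂ (x n) y) (hyperfilter ℕ) (𝓝 (inner ℂ u y)) := by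
    intro y
    have h1 : Tendsto (fun n => ℓ n y) (hyperfilter ℕ) (𝓝 (L y)) :=
      ((WeakDual.eval_continuous y).tendsto L).comp hL'
    rw [hu, InnerProductSpace.toDual_symm_apply]
    exact h1
  have hev' : ∀ y, Tendsto (fun n => inner ℂ y (x n)) (hyperfilter ℕ) (𝓝 (inner ℂ y u)) := by
    intro y
    simpa [Function.comp_def] using (Complex.continuous_conj.tendsto _).comp (hev y)
  refine ⟨u, le_of_forall_pos_le_add fun η hη => ?_, fun y c hc =>
    tendsto_nhds_unique (hev' y) (hc.mono_left hU)⟩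
  obtain ⟨n, hn⟩ := (hx η hη).exists
  have hC : 0 ≤ C + η := (norm_nonneg _).trans hn
  have h2 : ‖inner ℂ u u‖ ≤ (C + η) * ‖u‖ := by
    refine le_of_tendsto (hev u).norm (hU ((hx η hη).mono fun n hn => ?_))
    exact (norm_inner_le_norm _ _).trans (mul_le_mul_of_nonneg_right hn (norm_nonneg _))
  rcases (norm_nonneg u).eq_or_lt with h0 | h0
  · rwa [← h0]
  · refine le_of_mul_le_mul_right ?_ h0
    rw [inner_self_eq_norm_sq_to_K] at h2
    simpa [sq] using h2

theorem exists_inner_eq_deriv [CompleteSpace E] {σ : ℂ → E} {a : ℂ}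
    (hσ : ∀ u, DifferentiableAt ℂ (fun z => inner ℂ (σ z) u) a) :
    ∃ τ : E, ∀ u, inner ℂ τ u = deriv (fun z => inner ℂ (σ z) u) a := by
  -- difference quotients, whose pointwise limit is continuous by the Banach–Steinhaus theorem
  let g : ℂ → E →L[ℂ] ℂ := fun z => (z - a)⁻¹ • (innerSL ℂ (σ z) - innerSL ℂ (σ a))
  have hlim : Tendsto (fun z u => g z u) (𝓝[≠] a)
      (𝓝 fun u => deriv (fun z => inner ℂ (σ z) u) a) := by
    rw [tendsto_pi_nhds]
    intro u
    have := hasDerivAt_iff_tendsto_slope.1 (hσ u).hasDerivAt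
    refine this.congr fun z => ?_
    simp [g, slope]
  refine ⟨(InnerProductSpace.toDual ℂ E).symm (continuousLinearMapOfTendsto g hlim), fun u => ?_⟩
  rw [InnerProductSpace.toDual_symm_apply]
  rfl

/-- Point evaluations of all derivatives are represented by vectors, as soon as point evaluations
depend holomorphically on the point. -/
theorem exists_inner_eq_deriv_iterate [CompleteSpace E] {Ω : Set ℂ} (hΩ : IsOpen Ω) {σ : ℂ → E}
    (hσ : ∀ u, DifferentiableOn ℂ (fun z => inner ℂ (σ z) u) Ω) (n : ℕ) :
    ∃ τ : ℂ → E, ∀ a ∈ Ω, ∀ u, inner ℂ (τ a) u = deriv^[n] (fun z => inner ℂ (σ z) u) a := by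
  induction n with
  | zero => exact ⟨σ, fun a _ u => rfl⟩
  | succ n ih =>
    obtain ⟨τ, hτ⟩ := ih
    have hev : ∀ a ∈ Ω, ∀ u, (fun z => inner ℂ (τ z) u) =ᶠ[𝓝 a]
        deriv^[n] (fun z => inner ℂ (σ z) u) := fun a ha u =>
      eventually_of_mem (hΩ.mem_nhds ha) fun z hz => hτ z hz u
    have hd : ∀ a, ∃ τ' : E, a ∈ Ω → ∀ u, inner ℂ τ' u = deriv (fun z => inner ℂ (τ z) u) a := by
      intro a
      by_cases ha : a ∈ Ω
      · obtain ⟨τ', h'⟩ := exists_inner_eq_deriv (σ := τ) (a := a) fun u =>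
          ((((hσ u).analyticOnNhd hΩ).iterated_deriv n a ha).differentiableAt).congr_of_eventuallyEq
            (hev a ha u)
        exact ⟨τ', fun _ => h'⟩
      · exact ⟨0, fun h => absurd h ha⟩
    choose τ' hτ' using hd
    refine ⟨τ', fun a ha u => ?_⟩
    rw [hτ' a ha u, (hev a ha u).deriv_eq, Function.iterate_succ_apply']

/-- On antiholomorphic functions the iterated Wirtinger derivative is the ordinary one,
conjugated. -/
theorem dbar_iterate_conj {Ω : Set ℂ} (hΩ : IsOpen Ω) {g : ℂ → ℂ} (hg : DifferentiableOn ℂ g Ω)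
    (n : ℕ) : ∀ w ∈ Ω, (dbar^[n] fun ζ => (starRingEnd ℂ) (g ζ)) w =
      (starRingEnd ℂ) (deriv^[n] g w) := by
  induction n with
  | zero => exact fun w _ => rfl
  | succ n ih =>
    intro w hw
    rw [Function.iterate_succ_apply', Function.iterate_succ_apply',
      Filter.EventuallyEq.dbar_eq (eventually_of_mem (hΩ.mem_nhds hw) ih),
      dbar_conj ((hg.analyticOnNhd hΩ).iterated_deriv n w hw).differentiableAt]

/-- The orthogonal projection to the span of finitely many vectors `τ p`, which may be linearly
dependent, is a combination of the operators `x ↦ ⟨x, τ q⟩ τ p`. -/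
theorem exists_starProjection_span_eq {ι : Type*} [Fintype ι] (τ : ι → E)
    [FiniteDimensional ℂ (Submodule.span ℂ (range τ))] :
    ∃ c : ι → ι → ℂ, ∀ x, (Submodule.span ℂ (range τ)).starProjection x =
      ∑ p, ∑ q, (c p q * inner ℂ (τ q) x) • τ p := by
  let b := stdOrthonormalBasis ℂ (Submodule.span ℂ (range τ))
  have hb : ∀ k, ∃ r : ι → ℂ, ∑ p, r p • τ p = (b k : E) := fun k =>
    (Submodule.mem_span_range_iff_exists_fun ℂ).1 (b k).2
  choose r hr using hb
  refine ⟨fun p q => ∑ k, r k p * (starRingEnd ℂ) (r k q), fun x => ?_⟩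
  rw [OrthonormalBasis.starProjection_eq_sum_rankOne b]
  simp only [sum_apply, InnerProductSpace.rankOne_apply, ← hr, sum_inner,
    inner_smul_left, Finset.smul_sum, Finset.sum_smul, Finset.sum_mul, smul_smul]
  rw [Finset.sum_comm]
  refine Finset.sum_congr rfl fun p _ => ?_
  rw [Finset.sum_comm]
  refine Finset.sum_congr rfl fun q _ => Finset.sum_congr rfl fun k _ => ?_
  congr 1
  ring

end HilbertSpace

/-! ### Division of holomorphic functions -/

/-- A holomorphic function is divisible by `f` if it vanishes at least to the order of `f`
everywhere. -/
theorem exists_differentiableOn_mul_eq {Ω : Set ℂ} (hΩ : IsOpen Ω) {f h : ℂ → ℂ}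
    (hf : DifferentiableOn ℂ f Ω) (hh : DifferentiableOn ℂ h Ω)
    (htop : ∀ z ∈ Ω, analyticOrderAt f z ≠ ⊤)
    (hle : ∀ z ∈ Ω, analyticOrderAt f z ≤ analyticOrderAt h z) :
    ∃ g, DifferentiableOn ℂ g Ω ∧ ∀ z ∈ Ω, f z * g z = h z := by
  -- local quotients: each is `h / f` near `a`, with the removable singularity at `a` filled in
  have hloc : ∀ a, ∃ q : ℂ → ℂ, a ∈ Ω → AnalyticAt ℂ q a ∧
      ∀ᶠ z in 𝓝 a, (f z = 0 → z = a) ∧ f z * q z = h z := by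
    intro a
    by_cases ha : a ∈ Ω
    · have hfa := hf.analyticOnNhd hΩ a ha
      have hha := hh.analyticOnNhd hΩ a ha
      obtain ⟨n, hn⟩ := ENat.ne_top_iff_exists.1 (htop a ha)
      obtain ⟨u, hu, hu0, hfu⟩ := hfa.analyticOrderAt_eq_natCast.1 hn.symm
      obtain ⟨v, hv, hhv⟩ := (natCast_le_analyticOrderAt hha).1 (hn.symm ▸ hle a ha)
      refine ⟨fun z => v z / u z, fun _ => ⟨hv.div hu hu0, ?_⟩⟩
      filter_upwards [hfu, hhv, hu.continuousAt.eventually_ne hu0] with z h1 h2 h3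
      refine ⟨fun h0 => ?_, ?_⟩
      · rw [h1, smul_eq_mul, mul_eq_zero, or_iff_left h3] at h0
        exact sub_eq_zero.1 (eq_zero_of_pow_eq_zero h0)
      · rw [h1, h2, smul_eq_mul, smul_eq_mul]
        field_simp
    · exact ⟨0, fun h => absurd h ha⟩
  choose q hq using hloc
  classical
  refine ⟨fun z => if f z = 0 then q z z else h z / f z, fun a ha => ?_, fun z hz => ?_⟩
  · refine DifferentiableAt.differentiableWithinAt ?_
    refine (hq a ha).1.differentiableAt.congr_of_eventuallyEq ?_
    filter_upwards [(hq a ha).2] with z hz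
    split_ifs with h0
    · rw [hz.1 h0]
    · rw [← hz.2, mul_div_cancel_left₀ _ h0]
  · dsimp only
    split_ifs with h0
    · exact (hq z hz).2.self_of_nhds.2
    · rw [mul_div_cancel₀ _ h0]

/-! ### Multiplication and division by a holomorphic function -/

/-- An element of the closure of `D` that satisfies finitely many continuous linear conditions is a
limit of elements of `D` that satisfy them. -/
theorem Submodule.mem_topologicalClosure_inf_ker {E F : Type*} [NormedAddCommGroup E]
    [NormedSpace ℂ E] [NormedAddCommGroup F] [NormedSpace ℂ F] [FiniteDimensional ℂ F]
    {D : Submodule ℂ E} (L : E →L[ℂ] F) {u : E} (hu : u ∈ D.topologicalClosure) (hL : L u = 0) :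
    u ∈ (D ⊓ LinearMap.ker (L : E →ₗ[ℂ] F)).topologicalClosure := by
  let ℓ := ((L : E →ₗ[ℂ] F).comp D.subtype).rangeRestrict
  -- `R` solves the conditions within `D`; on a finite-dimensional space it is continuous, so that
  -- it corrects a sequence in `D` by terms that tend to zero
  obtain ⟨R, hR⟩ := LinearMap.exists_rightInverse_of_surjective ℓ
    (LinearMap.range_rangeRestrict _)
  have hRc : Continuous R := R.continuous_of_finiteDimensional
  obtain ⟨x, hx, hxu⟩ := mem_closure_iff_seq_limit.1 (show u ∈ closure (D : Set E) from hu)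
  refine mem_closure_iff_seq_limit.2 ⟨fun n => x n - R (ℓ ⟨x n, hx n⟩), fun n => ⟨?_, ?_⟩, ?_⟩
  · exact D.sub_mem (hx n) (R _).2
  · have h1 : ℓ (R (ℓ ⟨x n, hx n⟩)) = ℓ ⟨x n, hx n⟩ := LinearMap.congr_fun hR _
    have h2 : L (R (ℓ ⟨x n, hx n⟩)) = L (x n) := congrArg Subtype.val h1
    simp [h2]
  · have h1 : Tendsto (fun n => ℓ ⟨x n, hx n⟩) atTop (𝓝 0) := by
      rw [tendsto_subtype_rng]
      have := (L.continuous.tendsto u).comp hxu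
      rw [hL] at this
      exact this
    have h2 : Tendsto (fun n => (R (ℓ ⟨x n, hx n⟩) : E)) atTop (𝓝 0) := by
      have := ((continuous_subtype_val.comp hRc).tendsto 0).comp h1
      simpa [Function.comp_def] using this
    simpa using hxu.sub h2

/-- The sublevel sets `|f| ≤ ρ < 1` of a proper map to the unit disc are compact. -/
theorem IsProperMap.isCompact_norm_le {Ω : Set ℂ} {f : ℂ → ℂ}
    {hmaps : MapsTo f Ω (Metric.ball 0 1)}
    (hproper : IsProperMap (hmaps.restrict f Ω (Metric.ball 0 1))) {ρ : ℝ} (hρ : ρ < 1) :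
    IsCompact {z ∈ Ω | ‖f z‖ ≤ ρ} := by
  have h1 : IsCompact ((↑) ⁻¹' Metric.closedBall (0 : ℂ) ρ : Set (Metric.ball (0 : ℂ) 1)) := by
    rw [Subtype.isCompact_iff, Subtype.image_preimage_coe,
      inter_eq_right.2 (Metric.closedBall_subset_ball hρ)]
    exact isCompact_closedBall 0 ρ
  have h2 := Subtype.isCompact_iff.1 (hproper.isCompact_preimage h1)
  convert h2 using 1
  ext z
  simp [MapsTo.restrict, Subtype.map, and_comm]

section Factorization

variable {Ω : Set ℂ} {d : ℕ} {γ : Fin d → ℝ → ℂ} {φ : ℂ → ℝ}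

/-- A bounded holomorphic function `g` that is dominated near the boundary by a function with
boundary values `x` has itself boundary values, of norm at most `‖x‖`: a weak limit of the
boundary values of the functions that approximate `g`. -/
theorem IsSmoothlyBoundedBy.exists_norm_le_inner_eq (h : IsSmoothlyBoundedBy Ω γ)
    (hφpos : ∀ z ∈ frontier Ω, 0 < φ z) (hφ : ∀ j, ContDiff ℝ ∞ fun t => φ (γ j t))
    {g f : ℂ → ℂ} {x : WeightedL2 γ φ} {B : ℝ} (hg : DifferentiableOn ℂ g Ω)
    (hB : ∀ z ∈ Ω, ‖g z‖ ≤ B) (hf : ContinuousOn f (closure Ω))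
    (hx : ⇑x =ᵐ[weightedArcLength γ φ] f)
    (hmaj : ∀ η > 0, ∃ K ⊆ Ω, IsCompact K ∧ ∀ z ∈ Ω \ K, ‖g z‖ ≤ ‖f z‖ + η) :
    ∃ u : WeightedL2 γ φ, ‖u‖ ≤ ‖x‖ ∧ ∀ z ∈ Ω, inner ℂ (szegoElement Ω γ φ z) u = g z := by
  obtain ⟨G, hG, hlim, hbd⟩ := h.exists_approx hg hB hf hmaj
  let X : ℕ → WeightedL2 γ φ := fun n => (h.memLp hφ (hG n).continuousOn).toLp
  have hX : ∀ n, ⇑(X n) =ᵐ[weightedArcLength γ φ] G n := fun n => MemLp.coeFn_toLp _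
  let y : WeightedL2 γ φ := (h.memLp hφ (f := fun z => ((‖f z‖ : ℝ) : ℂ))
    (Complex.continuous_ofReal.comp_continuousOn hf.norm)).toLp
  have hy : ⇑y =ᵐ[weightedArcLength γ φ] fun z => ((‖f z‖ : ℝ) : ℂ) := MemLp.coeFn_toLp _
  let o : WeightedL2 γ φ := (h.memLp hφ (f := fun _ => 1) continuousOn_const).toLp
  have ho : ⇑o =ᵐ[weightedArcLength γ φ] fun _ => 1 := MemLp.coeFn_toLp _
  have hyx : ‖y‖ ≤ ‖x‖ := by
    refine Lp.norm_le_norm_of_ae_le ?_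
    filter_upwards [hy, hx] with z h1 h2
    rw [h1, h2]
    simp
  obtain ⟨u, hu, hu'⟩ := exists_weakLimit (x := X) (C := ‖x‖) fun η hη => by
    filter_upwards [hbd (η / (‖o‖ + 1)) (by positivity)] with n hn
    -- `|G n| ≤ |f| + η / (‖1‖ + 1)` on the boundary, where `‖1‖` is the norm of the constant `1`
    have h1 : ‖X n‖ ≤ ‖y + ((η / (‖o‖ + 1) : ℝ) : ℂ) • o‖ := by
      refine Lp.norm_le_norm_of_ae_le ?_
      filter_upwards [hX n, hy, ho, Lp.coeFn_add y (((η / (‖o‖ + 1) : ℝ) : ℂ) • o),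
        Lp.coeFn_smul ((η / (‖o‖ + 1) : ℝ) : ℂ) o, h.ae_mem_frontier hφ] with z h1 h2 h3 h4 h5 h6
      rw [h1, h4, Pi.add_apply, h5, Pi.smul_apply, h2, h3, smul_eq_mul, mul_one,
        ← Complex.ofReal_add, Complex.norm_real, Real.norm_of_nonneg (by positivity)]
      exact hn z h6
    refine h1.trans ((norm_add_le _ _).trans (add_le_add hyx ?_))
    rw [norm_smul, Complex.norm_real, Real.norm_of_nonneg (by positivity), div_mul_eq_mul_div,
      div_le_iff₀ (by positivity)]
    nlinarith [norm_nonneg o]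
  refine ⟨u, hu, fun z hz => hu' _ _ ?_⟩
  refine (hlim z hz).congr fun n => ?_
  exact ((h.isReproducingAt_szegoElement hφpos hφ hz).2 _ _ (hG n) (hX n)).symm

/-- Multiplication by a holomorphic function `f` with `|f| < 1` is a contraction of the Hardy space,
even though nothing is known about `f` at the boundary. -/
theorem IsSmoothlyBoundedBy.exists_inner_eq_mul (h : IsSmoothlyBoundedBy Ω γ)
    (hφpos : ∀ z ∈ frontier Ω, 0 < φ z) (hφ : ∀ j, ContDiff ℝ ∞ fun t => φ (γ j t))
    {f : ℂ → ℂ} (hf : DifferentiableOn ℂ f Ω) (hf1 : ∀ z ∈ Ω, ‖f z‖ < 1) {u : WeightedL2 γ φ}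
    (hu : u ∈ hardySpace Ω γ φ) :
    ∃ m : WeightedL2 γ φ, ‖m‖ ≤ ‖u‖ ∧ ∀ z ∈ Ω,
      inner ℂ (szegoElement Ω γ φ z) m = f z * inner ℂ (szegoElement Ω γ φ z) u := by
  obtain ⟨x, hx, hxu⟩ := mem_closure_iff_seq_limit.1
    (show u ∈ closure (aInftyBoundaryValues Ω γ φ : Set (WeightedL2 γ φ)) from hu)
  choose k hk hkx using hx
  have hM : ∀ n, ∃ m : WeightedL2 γ φ, ‖m‖ ≤ ‖x n‖ ∧ ∀ z ∈ Ω,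
      inner ℂ (szegoElement Ω γ φ z) m = f z * k n z := by
    intro n
    obtain ⟨B, hB⟩ := h.isCompact_closure.exists_bound_of_continuousOn (hk n).continuousOn
    have hle : ∀ z ∈ Ω, ‖f z * k n z‖ ≤ ‖k n z‖ := fun z hz => by
      rw [norm_mul]
      exact mul_le_of_le_one_left (norm_nonneg _) (hf1 z hz).le
    exact h.exists_norm_le_inner_eq hφpos hφ (hf.mul (hk n).1)
      (fun z hz => (hle z hz).trans (hB z (subset_closure hz))) (hk n).continuousOn (hkx n)
      fun η hη => ⟨∅, empty_subset _, isCompact_empty, fun z hz => (hle z hz.1).trans (by linarith)⟩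
  choose m hm hm' using hM
  obtain ⟨v, hv, hv'⟩ := exists_weakLimit (x := m) (C := ‖u‖) fun η hη =>
    (hxu.norm.eventually (gt_mem_nhds (by linarith : ‖u‖ < ‖u‖ + η))).mono fun n hn =>
      (hm n).trans hn.le
  refine ⟨v, hv, fun z hz => hv' _ _ ?_⟩
  have h1 : Tendsto (fun n => f z * inner ℂ (szegoElement Ω γ φ z) (x n)) atTop
      (𝓝 (f z * inner ℂ (szegoElement Ω γ φ z) u)) := (tendsto_const_nhds.inner hxu).const_mul _
  refine h1.congr fun n => ?_
  rw [hm' n z hz, (h.isReproducingAt_szegoElement hφpos hφ hz).2 _ _ (hk n) (hkx n)]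

/-- Division by a proper map `f` is a contraction on the functions of the Hardy space that vanish at
least to the order of `f`.  Since `|f|` tends to `1` at the boundary, `h / f` is dominated there by
`|h| + η`, for every `h` in `A^∞(Ω)` with the required zeros, and such `h` are dense.  The order
condition enters as orthogonality to finitely many vectors `τ p`. -/
theorem IsSmoothlyBoundedBy.exists_mul_inner_eq (h : IsSmoothlyBoundedBy Ω γ)
    (hφpos : ∀ z ∈ frontier Ω, 0 < φ z) (hφ : ∀ j, ContDiff ℝ ∞ fun t => φ (γ j t))
    {f : ℂ → ℂ} (hf : DifferentiableOn ℂ f Ω) {hmaps : MapsTo f Ω (Metric.ball 0 1)}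
    (hproper : IsProperMap (hmaps.restrict f Ω (Metric.ball 0 1)))
    (htop : ∀ z ∈ Ω, analyticOrderAt f z ≠ ⊤) {ι : Type*} [Fintype ι] (τ : ι → WeightedL2 γ φ)
    (hτ : ∀ x, (∀ p, inner ℂ (τ p) x = 0) → ∀ z ∈ Ω,
      analyticOrderAt f z ≤ analyticOrderAt (fun ζ => inner ℂ (szegoElement Ω γ φ ζ) x) z)
    {u : WeightedL2 γ φ} (hu : u ∈ hardySpace Ω γ φ) (hu0 : ∀ p, inner ℂ (τ p) u = 0) :
    ∃ d : WeightedL2 γ φ, ‖d‖ ≤ ‖u‖ ∧ ∀ z ∈ Ω,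
      f z * inner ℂ (szegoElement Ω γ φ z) d = inner ℂ (szegoElement Ω γ φ z) u := by
  let L : WeightedL2 γ φ →L[ℂ] (ι → ℂ) := ContinuousLinearMap.pi fun p => innerSL ℂ (τ p)
  obtain ⟨x, hx, hxu⟩ := mem_closure_iff_seq_limit.1 (show u ∈ closure
    ((aInftyBoundaryValues Ω γ φ ⊓ LinearMap.ker (L : WeightedL2 γ φ →ₗ[ℂ] (ι → ℂ)) :
      Submodule ℂ (WeightedL2 γ φ)) : Set (WeightedL2 γ φ)) from
    Submodule.mem_topologicalClosure_inf_ker L hu (funext hu0))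
  have hx0 : ∀ n p, inner ℂ (τ p) (x n) = 0 := fun n p => congrFun (hx n).2 p
  choose k hk hkx using fun n => (hx n).1
  have hM : ∀ n, ∃ d : WeightedL2 γ φ, ‖d‖ ≤ ‖x n‖ ∧ ∀ z ∈ Ω,
      f z * inner ℂ (szegoElement Ω γ φ z) d = inner ℂ (szegoElement Ω γ φ z) (x n) := by
    intro n
    obtain ⟨g, hg, hfg⟩ := exists_differentiableOn_mul_eq h.isOpen hf
      (h.differentiableOn_inner_szegoElement hφpos hφ (x n)) htop (hτ _ (hx0 n))
    have hfgk : ∀ z ∈ Ω, f z * g z = k n z := fun z hz => by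
      rw [hfg z hz, (h.isReproducingAt_szegoElement hφpos hφ hz).2 _ _ (hk n) (hkx n)]
    obtain ⟨B, hB⟩ := h.isCompact_closure.exists_bound_of_continuousOn (hk n).continuousOn
    have hmaj : ∀ η > 0, ∃ K ⊆ Ω, IsCompact K ∧ ∀ z ∈ Ω \ K, ‖g z‖ ≤ ‖k n z‖ + η := by
      intro η hη
      have hB' : 0 < |B| + 1 := by positivity
      -- `ρ = b / (b + η)` with `b = |B| + 1` gives `|h| / ρ ≤ |h| + η`, as `|h| ≤ b`
      have hρ : (|B| + 1) / (|B| + 1 + η) < 1 := by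
        rw [div_lt_one (by positivity)]
        linarith
      refine ⟨_, fun z hz => hz.1, hproper.isCompact_norm_le hρ, fun z hz => ?_⟩
      have h1 : (|B| + 1) / (|B| + 1 + η) < ‖f z‖ := not_le.1 fun h0 => hz.2 ⟨hz.1, h0⟩
      rw [div_lt_iff₀ (by positivity)] at h1
      have h2 : ‖f z‖ * ‖g z‖ = ‖k n z‖ := by rw [← norm_mul, hfgk z hz.1]
      have h3 : ‖k n z‖ ≤ |B| + 1 := by
        linarith [hB z (subset_closure hz.1), le_abs_self B]
      have hf0 : 0 < ‖f z‖ := pos_of_mul_pos_left (hB'.trans h1) (by positivity)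
      refine le_of_mul_le_mul_left ?_ hf0
      rw [h2]
      have hf1 : ‖f z‖ < 1 := mem_ball_zero_iff.1 (hmaps hz.1)
      nlinarith
    obtain ⟨K, hKΩ, hKc, hK⟩ := hmaj 1 one_pos
    obtain ⟨B', hB'⟩ := hKc.exists_bound_of_continuousOn (hg.continuousOn.mono hKΩ)
    obtain ⟨d, hd, hd'⟩ := h.exists_norm_le_inner_eq hφpos hφ hg (B := max B' (B + 1))
      (fun z hz => by
        by_cases hzK : z ∈ K
        · exact (hB' z hzK).trans (le_max_left _ _)
        · refine (hK z ⟨hz, hzK⟩).trans (le_trans ?_ (le_max_right _ _))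
          linarith [hB z (subset_closure hz)]) (hk n).continuousOn (hkx n) hmaj
    exact ⟨d, hd, fun z hz => by rw [hd' z hz, hfg z hz]⟩
  choose m hm hm' using hM
  obtain ⟨v, hv, hv'⟩ := exists_weakLimit (x := m) (C := ‖u‖) fun η hη =>
    (hxu.norm.eventually (gt_mem_nhds (by linarith : ‖u‖ < ‖u‖ + η))).mono fun n hn =>
      (hm n).trans hn.le
  refine ⟨v, hv, fun z hz => ?_⟩
  -- off the zeros of `f` the values converge; at the zeros both sides vanish
  by_cases hfz : f z = 0
  · have h1 : analyticOrderAt f z ≠ 0 :=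
      analyticOrderAt_ne_zero.2 ⟨hf.analyticOnNhd h.isOpen z hz, hfz⟩
    have h2 := apply_eq_zero_of_analyticOrderAt_ne_zero
      (ne_bot_of_le_ne_bot h1 (hτ u hu0 z hz))
    rw [hfz, zero_mul, h2]
  · have h1 : Tendsto (fun n => (f z)⁻¹ * inner ℂ (szegoElement Ω γ φ z) (x n)) atTop
        (𝓝 ((f z)⁻¹ * inner ℂ (szegoElement Ω γ φ z) u)) :=
      (tendsto_const_nhds.inner hxu).const_mul _
    rw [hv' (szegoElement Ω γ φ z) _ (h1.congr fun n => by
      rw [← hm' n z hz, inv_mul_cancel_left₀ hfz]), mul_inv_cancel_left₀ hfz]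

end Factorization

/-! ### The kernel and the zeros of a proper map -/

/-- The Hilbert space argument behind the formula for the kernel. In the application `s = σ(·,
w)`, `q` is its projection to the span of the derivative vectors, `c = f w`, and `m` and `d` are
the product `f s` and the quotient `(s - q) / f`. The product gives `|c| ‖s‖ ≤ ‖s - q‖`, because
`m` is orthogonal to `q`; the quotient gives `⟨c̄ s, d⟩ = ‖s - q‖²`, so that `‖d - c̄ s‖² ≤ |c|²
‖s‖² - ‖s - q‖² ≤ 0`. -/
theorem eq_smul_of_contraction {E : Type*} [NormedAddCommGroup E] [InnerProductSpace ℂ E]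
    {s q d m : E} {c : ℂ} (hsq : inner ℂ q (s - q) = 0)
    (hd : ‖d‖ ≤ ‖s - q‖) (hsd : c * inner ℂ s d = inner ℂ s (s - q))
    (hm : ‖m‖ ≤ ‖s‖) (hsm : inner ℂ s m = c * inner ℂ s s) (hqm : inner ℂ q m = 0) :
    d = (starRingEnd ℂ) c • s := by
  have h1 : inner ℂ (s - q) m = c * (‖s‖ : ℂ) ^ 2 := by
    rw [inner_sub_left, hqm, sub_zero, hsm, inner_self_eq_norm_sq_to_K]
    rfl
  have h2 : inner ℂ s (s - q) = ((‖s - q‖ ^ 2 : ℝ) : ℂ) := by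
    have : inner ℂ (s - q) (s - q) = inner ℂ s (s - q) := by
      rw [inner_sub_left, hsq, sub_zero]
    rw [← this, inner_self_eq_norm_sq_to_K]
    simp
  have h3 : ‖c‖ * ‖s‖ ≤ ‖s - q‖ := by
    have h4 := norm_inner_le_norm (𝕜 := ℂ) (s - q) m
    rw [h1, norm_mul, norm_pow, Complex.norm_real, norm_norm] at h4
    have h5 : ‖c‖ * ‖s‖ ^ 2 ≤ ‖s - q‖ * ‖s‖ :=
      h4.trans (mul_le_mul_of_nonneg_left hm (norm_nonneg _))
    rcases (norm_nonneg s).eq_or_lt with h0 | h0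
    · rw [← h0, mul_zero]
      exact norm_nonneg _
    · refine le_of_mul_le_mul_right ?_ h0
      linarith [h5, sq ‖s‖, mul_assoc ‖c‖ ‖s‖ ‖s‖]
  have h4 : ‖d - (starRingEnd ℂ) c • s‖ ^ 2 =
      ‖d‖ ^ 2 - 2 * ‖s - q‖ ^ 2 + (‖c‖ * ‖s‖) ^ 2 := by
    have h5 : RCLike.re (inner ℂ d ((starRingEnd ℂ) c • s)) = ‖s - q‖ ^ 2 := by
      rw [inner_re_symm, inner_smul_left, RingHomCompTriple.comp_apply, RingHom.id_apply, hsd, h2]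
      exact Complex.ofReal_re _
    rw [norm_sub_sq (𝕜 := ℂ), h5, norm_smul, RCLike.norm_conj]
  have h5 : ‖d - (starRingEnd ℂ) c • s‖ ^ 2 ≤ 0 := by
    rw [h4]
    nlinarith [norm_nonneg d, norm_nonneg (s - q), mul_nonneg (norm_nonneg c) (norm_nonneg s)]
  rw [← sub_eq_zero, ← norm_le_zero_iff]
  nlinarith [norm_nonneg (d - (starRingEnd ℂ) c • s)]

section Kernel

variable {Ω : Set ℂ} {d : ℕ} {γ : Fin d → ℝ → ℂ} {φ : ℂ → ℝ}

/-- Vectors that represent derivatives lie in the Hardy space, as the extension of an element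
orthogonal to the Hardy space is zero. -/
theorem IsSmoothlyBoundedBy.mem_hardySpace_of_inner_eq (h : IsSmoothlyBoundedBy Ω γ)
    (hφpos : ∀ z ∈ frontier Ω, 0 < φ z) (hφ : ∀ j, ContDiff ℝ ∞ fun t => φ (γ j t))
    {τ : WeightedL2 γ φ} {a : ℂ} (ha : a ∈ Ω) {n : ℕ}
    (hτ : ∀ u, inner ℂ τ u = deriv^[n] (fun z => inner ℂ (szegoElement Ω γ φ z) u) a) :
    τ ∈ hardySpace Ω γ φ := by
  rw [← Submodule.orthogonal_orthogonal (hardySpace Ω γ φ), Submodule.mem_orthogonal']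
  intro y hy
  have h1 : (fun z => inner ℂ (szegoElement Ω γ φ z) y) =ᶠ[𝓝 a] fun _ => 0 :=
    eventually_of_mem (h.isOpen.mem_nhds ha) fun z hz =>
      (Submodule.mem_orthogonal _ _).1 hy _ (h.isReproducingAt_szegoElement hφpos hφ hz).1
  rw [hτ, ← iteratedDeriv_eq_iterate, h1.iteratedDeriv_eq]
  simp

/-- The function `σ_{n̄}(·, a)` has as boundary values the vector that represents the `n`-th
derivative at `a`. -/
theorem IsSmoothlyBoundedBy.szegoKernelDbar_eq (h : IsSmoothlyBoundedBy Ω γ)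
    (hφpos : ∀ z ∈ frontier Ω, 0 < φ z) (hφ : ∀ j, ContDiff ℝ ∞ fun t => φ (γ j t))
    {τ : WeightedL2 γ φ} {a : ℂ} (ha : a ∈ Ω) {n : ℕ}
    (hτ : ∀ u, inner ℂ τ u = deriv^[n] (fun z => inner ℂ (szegoElement Ω γ φ z) u) a) (z : ℂ) :
    szegoKernelDbar Ω γ φ n z a = inner ℂ (szegoElement Ω γ φ z) τ := by
  have h1 : (fun ζ => szegoKernel Ω γ φ z ζ) = fun ζ =>
      (starRingEnd ℂ) (inner ℂ (szegoElement Ω γ φ ζ) (szegoElement Ω γ φ z)) := by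
    funext ζ
    rw [inner_conj_symm, szegoKernel]
  rw [szegoKernelDbar, h1, dbar_iterate_conj h.isOpen
    (h.differentiableOn_inner_szegoElement hφpos hφ _) n a ha, ← hτ, inner_conj_symm]

/-- The kernel `σ(z, w) (1 - f(z) f̄(w))` is that of the projection to the span of the vectors
`τ p`, whose orthogonal complement in the Hardy space consists of the multiples of `f`. -/
theorem IsSmoothlyBoundedBy.szegoKernel_eq (h : IsSmoothlyBoundedBy Ω γ)
    (hφpos : ∀ z ∈ frontier Ω, 0 < φ z) (hφ : ∀ j, ContDiff ℝ ∞ fun t => φ (γ j t))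
    {f : ℂ → ℂ} (hf : DifferentiableOn ℂ f Ω) {hmaps : MapsTo f Ω (Metric.ball 0 1)}
    (hproper : IsProperMap (hmaps.restrict f Ω (Metric.ball 0 1)))
    (htop : ∀ z ∈ Ω, analyticOrderAt f z ≠ ⊤) {ι : Type*} [Fintype ι] {τ : ι → WeightedL2 γ φ}
    (hτH : ∀ p, τ p ∈ hardySpace Ω γ φ)
    (hτ : ∀ x, (∀ p, inner ℂ (τ p) x = 0) ↔ ∀ z ∈ Ω,
      analyticOrderAt f z ≤ analyticOrderAt (fun ζ => inner ℂ (szegoElement Ω γ φ ζ) x) z)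
    [FiniteDimensional ℂ (Submodule.span ℂ (range τ))] {z w : ℂ} (hz : z ∈ Ω) (hw : w ∈ Ω) :
    szegoKernel Ω γ φ z w * (1 - f z * (starRingEnd ℂ) (f w)) = inner ℂ (szegoElement Ω γ φ z)
      ((Submodule.span ℂ (range τ)).starProjection (szegoElement Ω γ φ w)) := by
  set Q := Submodule.span ℂ (range τ) with hQ
  set s := szegoElement Ω γ φ w with hs
  set q := Q.starProjection s with hq
  have hqQ : q ∈ Q := Submodule.starProjection_apply_mem _ _
  have hsH : s ∈ hardySpace Ω γ φ := (h.isReproducingAt_szegoElement hφpos hφ hw).1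
  have hqH : q ∈ hardySpace Ω γ φ :=
    Submodule.span_le.2 (range_subset_iff.2 hτH) hqQ
  have horth : ∀ x ∈ Q, inner ℂ x (s - q) = 0 :=
    (Submodule.mem_orthogonal _ _).1 (Submodule.sub_starProjection_mem_orthogonal s)
  have hf1 : ∀ z ∈ Ω, ‖f z‖ < 1 := fun z hz => mem_ball_zero_iff.1 (hmaps hz)
  have hfa := hf.analyticOnNhd h.isOpen
  obtain ⟨e, he, he'⟩ := h.exists_mul_inner_eq hφpos hφ hf hproper htop τ (fun x => (hτ x).1)
    (Submodule.sub_mem _ hsH hqH) fun p => horth _ (Submodule.subset_span ⟨p, rfl⟩)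
  obtain ⟨m, hm, hm'⟩ := h.exists_inner_eq_mul hφpos hφ hf hf1 hsH
  -- `m` is a multiple of `f`
  have hmτ : ∀ p, inner ℂ (τ p) m = 0 := by
    refine (hτ m).2 fun ζ hζ => ?_
    have h1 : (fun ζ => inner ℂ (szegoElement Ω γ φ ζ) m) =ᶠ[𝓝 ζ]
        f * fun ζ => inner ℂ (szegoElement Ω γ φ ζ) s :=
      eventually_of_mem (h.isOpen.mem_nhds hζ) hm'
    rw [analyticOrderAt_congr h1, analyticOrderAt_mul (hfa ζ hζ)
      ((h.differentiableOn_inner_szegoElement hφpos hφ s).analyticOnNhd h.isOpen ζ hζ)]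
    exact le_self_add
  have hqm : inner ℂ q m = 0 := by
    have h1 : Q ≤ LinearMap.ker (innerₛₗ ℂ m) := by
      refine Submodule.span_le.2 (range_subset_iff.2 fun p => ?_)
      simpa using inner_eq_zero_symm.1 (hmτ p)
    exact inner_eq_zero_symm.1 (h1 hqQ)
  have hes : e = (starRingEnd ℂ) (f w) • s :=
    eq_smul_of_contraction (horth q hqQ) he (he' w hw) hm (hm' w hw) hqm
  have h1 := he' z hz
  rw [hes, inner_smul_right, inner_sub_right] at h1
  rw [szegoKernel]
  linear_combination -h1

end Kernel

end

theorem theorem8p1 {d : ℕ} (Ω : Set ℂ) (γ : Fin d → ℝ → ℂ) (hΩ : IsSmoothlyBoundedBy Ω γ)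
    -- the positive smooth weight on the boundary
    (φ : ℂ → ℝ) (hφpos : ∀ z ∈ frontier Ω, 0 < φ z)
    (hφsmooth : ∀ j, ContDiff ℝ ∞ fun t => φ (γ j t))
    -- the proper holomorphic map to the unit disc
    (f : ℂ → ℂ) (hf : DifferentiableOn ℂ f Ω) (hmaps : Set.MapsTo f Ω (Metric.ball 0 1))
    (hproper : IsProperMap (hmaps.restrict f Ω (Metric.ball 0 1)))
    -- its zeros, without repetition, and their multiplicities
    {N : ℕ} (a : Fin N → ℂ) (ha : Function.Injective a)
    (hzeros : Set.range a = {z ∈ Ω | f z = 0})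
    (M : Fin N → ℕ) (hM : ∀ i, analyticOrderAt f (a i) = M i) :
    (∀ w ∈ Ω, IsReproducingAt Ω γ φ w (szegoElement Ω γ φ w)) ∧
    ∃ c : Fin N → Fin N → ℕ → ℕ → ℂ, ∀ z ∈ Ω, ∀ w ∈ Ω,
      szegoKernel Ω γ φ z w =
        1 / (1 - f z * (starRingEnd ℂ) (f w)) *
          ∑ i, ∑ j, ∑ n ∈ Finset.range (M i), ∑ m ∈ Finset.range (M j),
            c i j n m * szegoKernelDbar Ω γ φ n z (a i) *
              (starRingEnd ℂ) (szegoKernelDbar Ω γ φ m w (a j)) := by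
  refine ⟨fun w hw => hΩ.isReproducingAt_szegoElement hφpos hφsmooth hw, ?_⟩
  have haΩ : ∀ i, a i ∈ Ω := fun i => (hzeros.subset ⟨i, rfl⟩).1
  have hhol := fun u => hΩ.differentiableOn_inner_szegoElement hφpos hφsmooth u
  choose T hT using exists_inner_eq_deriv_iterate hΩ.isOpen hhol
  -- the vectors that represent the derivatives at `a i` of order less than `M i`
  let τ : (Σ i, Fin (M i)) → WeightedL2 γ φ := fun p => T p.2 (a p.1)
  have hnonzero : ∀ z ∈ Ω, z ∉ Set.range a → analyticOrderAt f z = 0 := fun z hz hza =>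
    analyticOrderAt_eq_zero.2 (Or.inr fun h0 => hza (hzeros.superset ⟨hz, h0⟩))
  have htop : ∀ z ∈ Ω, analyticOrderAt f z ≠ ⊤ := by
    intro z hz
    by_cases hza : z ∈ Set.range a
    · obtain ⟨i, rfl⟩ := hza
      rw [hM i]
      exact ENat.natCast_ne_top _
    · rw [hnonzero z hz hza]
      exact ENat.zero_ne_top
  have hτ : ∀ x, (∀ p, inner ℂ (τ p) x = 0) ↔ ∀ z ∈ Ω,
      analyticOrderAt f z ≤ analyticOrderAt (fun ζ => inner ℂ (szegoElement Ω γ φ ζ) x) z := by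
    intro x
    have hord : ∀ i, analyticOrderAt f (a i) ≤
        analyticOrderAt (fun ζ => inner ℂ (szegoElement Ω γ φ ζ) x) (a i) ↔
        ∀ n < M i, inner ℂ (T n (a i)) x = 0 := fun i => by
      rw [hM i, natCast_le_analyticOrderAt_iff_iteratedDeriv_eq_zero
        ((hhol x).analyticOnNhd hΩ.isOpen _ (haΩ i))]
      simp only [iteratedDeriv_eq_iterate, hT _ _ (haΩ i)]
    refine ⟨fun h0 z hz => ?_, fun h0 p => (hord p.1).1 (h0 _ (haΩ p.1)) p.2 p.2.2⟩
    by_cases hza : z ∈ Set.range a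
    · obtain ⟨i, rfl⟩ := hza
      exact (hord i).2 fun n hn => h0 ⟨i, ⟨n, hn⟩⟩
    · rw [hnonzero z hz hza]
      exact zero_le
  have hfin : FiniteDimensional ℂ (Submodule.span ℂ (Set.range τ)) :=
    FiniteDimensional.span_of_finite ℂ (Set.finite_range τ)
  obtain ⟨c, hc⟩ := exists_starProjection_span_eq τ
  refine ⟨fun i j n m => if hn : n < M i then if hm : m < M j then c ⟨i, n, hn⟩ ⟨j, m, hm⟩ else 0
    else 0, fun z hz w hw => ?_⟩
  have hdbar : ∀ i n ζ, szegoKernelDbar Ω γ φ n ζ (a i) =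
      inner ℂ (szegoElement Ω γ φ ζ) (T n (a i)) := fun i n ζ =>
    hΩ.szegoKernelDbar_eq hφpos hφsmooth (haΩ i) (hT n _ (haΩ i)) ζ
  have hne : 1 - f z * (starRingEnd ℂ) (f w) ≠ 0 := by
    intro h0
    have h1 : ‖f z‖ < 1 := mem_ball_zero_iff.1 (hmaps hz)
    have h2 : ‖f w‖ < 1 := mem_ball_zero_iff.1 (hmaps hw)
    have h3 : ‖f z‖ * ‖f w‖ = 1 := by
      rw [← RCLike.norm_conj (f w), ← norm_mul, ← sub_eq_zero.1 h0, norm_one]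
    nlinarith [norm_nonneg (f z), norm_nonneg (f w)]
  have hkey := hΩ.szegoKernel_eq hφpos hφsmooth hf hproper htop (τ := τ)
    (fun p => hΩ.mem_hardySpace_of_inner_eq hφpos hφsmooth (haΩ p.1) (hT p.2 _ (haΩ p.1)))
    hτ hz hw
  rw [one_div, ← div_eq_inv_mul, eq_div_iff hne, hkey, hc]
  simp only [hdbar, inner_conj_symm, inner_sum, inner_smul_right, Fintype.sum_sigma,
    Finset.sum_range]
  refine Finset.sum_congr rfl fun i _ => ?_
  rw [Finset.sum_comm]
  refine Finset.sum_congr rfl fun j _ => Finset.sum_congr rfl fun n _ =>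
    Finset.sum_congr rfl fun m _ => ?_
  simp only [n.2, m.2, dif_pos, τ]
  ring
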